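/- Let $N\ge 1$, $0<s<1$ and $2\le q\le p<\infty$. Write $B_R(x)\subset\mathbb{R}^N$ for open balls, $B_R=B_R(0)$ and $J_m(t)=|t|^{m-2}t$. For bounded $\Omega\subset\mathbb{R}^N$, let $\widetilde W^{s,m}(\Omega)$ be the set of $u\in L^m_{loc}(\mathbb{R}^N)$ such that $\int_{\mathbb{R}^N}\frac{|u(x)|^{m-1}}{(1+|x|)^{N+sm}}\,dx<\infty$ and, for some open $U\supset\overline\Omega$, $u\in L^m(U)$ and $\int_U\int_U\frac{|u(x)-u(y)|^m}{|x-y|^{N+sm}}\,dx\,dy<\infty$. Put $\mathcal W(\Omega)=\widetilde W^{s,p}(\Omega)\cap\widetilde W^{s,q}(\Omega)$. For $u\in\mathcal W(\Omega)$ and $K\ge0$, we say that $|(-\Delta_p)^su+(-\Delta_q)^su|\le K$ weakly in $\Omega$ if $$-K\int_\Omega\varphi\,dx\ \le\ \sum_{m=p,q}\int_{\mathbb{R}^N}\int_{\mathbb{R}^N}\frac{J_m(u(x)-u(y))(\varphi(x)-\varphi(y))}{|x-y|^{N+sm}}\,dx\,dy\ \le\ K\int_\Omega\varphi\,dx$$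 for all $0\le\varphi\in C_c^\infty(\Omega)$ (for $p=q$ the two equal terms are both counted). Further put $$\mathrm{Tail}_p(u;x;R)=\Big(R^{sp}\int_{\mathbb{R}^N\setminus B_R(x)}\frac{|u(y)|^{p-1}}{|x-y|^{N+sp}}\,dy\Big)^{\frac1{p-1}},\qquad Q(u;x;R)=\|u\|_{L^\infty(B_R(x))}+\mathrm{Tail}_p(u;x;R),$$ and $K_0=K+\|u\|_{L^\infty(\mathbb{R}^N)}^{q-1}$. For a bounded measurable $u$, $\operatorname{osc}_{B_r}u$ is the essential supremum minus the essential infimum of $u$ over $B_r$. There are $\alpha\in(0,1)$ and $C>0$, depending only on $N,s,p,q$, such that the following hold for all $K\ge 0$ and $R_0\in(0,1]$. (1) If $u\in\mathcal W(B_{R_0})\cap L^\infty(\mathbb{R}^N)$ satisfies $|(-\Delta_p)^su+(-\Delta_q)^su|\le K$ weakly in $B_{R_0}$, then for every $0<r\le R_0$ $$\operatorname{osc}_{B_r}u\le C\Big[\big(K_0R_0^{s(p-q)}\big)^{\frac1{p-1}}+Q(u;0;R_0)\Big]\Big(\frac r{R_0}\Big)^\alpha .$$ (2) If $x_0\in\mathbb{R}^N$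 and $u\in\mathcal W(B_{2R_0}(x_0))\cap L^\infty(\mathbb{R}^N)$ satisfies $|(-\Delta_p)^su+(-\Delta_q)^su|\le K$ weakly in $B_{2R_0}(x_0)$, then, after modification of $u$ on a null set, $$\sup_{x\ne y\in B_{R_0}(x_0)}\frac{|u(x)-u(y)|}{|x-y|^\alpha}\le C\Big[\big(K_0R_0^{s(p-q)}\big)^{\frac1{p-1}}+Q(u;x_0;2R_0)\Big]R_0^{-\alpha}.$$ -/

import Mathlib

open MeasureTheory Set Metric
open scoped ENNReal

namespace FracPQ

/-- `J_m(t) = |t|^{m-2} t`. -/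
noncomputable def J (m t : ℝ) : ℝ := |t| ^ (m - 2) * t

/-- The `m`-th power of the Gagliardo seminorm of order `s` on `U`, with values in `[0, ∞]`. -/
noncomputable def gagliardo {N : ℕ} (s m : ℝ) (U : Set (EuclideanSpace ℝ (Fin N)))
    (u : EuclideanSpace ℝ (Fin N) → ℝ) : ℝ≥0∞ :=
  ∫⁻ x in U, ∫⁻ y in U, ENNReal.ofReal (|u x - u y| ^ m / ‖x - y‖ ^ ((N : ℝ) + s * m))

/-- The fractional Sobolev space `W^{s,m}(U)`. -/
def MemW {N : ℕ} (s m : ℝ) (U : Set (EuclideanSpace ℝ (Fin N)))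
    (u : EuclideanSpace ℝ (Fin N) → ℝ) : Prop :=
  MemLp u (ENNReal.ofReal m) (volume.restrict U) ∧ gagliardo s m U u < ∞

/-- The space `W̃^{s,m}(Ω)` for bounded `Ω`: functions in `L^m_loc(ℝ^N)` that belong to
`W^{s,m}(U)` for some open `U` compactly containing `Ω`, and with
`∫ |u|^{m-1} / (1 + |x|)^{N+sm} dx < ∞`. -/
def MemWTilde {N : ℕ} (s m : ℝ) (Ω : Set (EuclideanSpace ℝ (Fin N)))
    (u : EuclideanSpace ℝ (Fin N) → ℝ) : Prop :=
  (∀ A : Set (EuclideanSpace ℝ (Fin N)), IsCompact A →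
      MemLp u (ENNReal.ofReal m) (volume.restrict A)) ∧
  (∃ U : Set (EuclideanSpace ℝ (Fin N)), IsOpen U ∧ IsCompact (closure Ω) ∧ closure Ω ⊆ U ∧
      MemW s m U u) ∧
  (∫⁻ x, ENNReal.ofReal (|u x| ^ (m - 1) / (1 + ‖x‖) ^ ((N : ℝ) + s * m))) < ∞

/-- `𝓦(Ω) = W̃^{s,p}(Ω) ∩ W̃^{s,q}(Ω)`. -/
def MemWpq {N : ℕ} (s p q : ℝ) (Ω : Set (EuclideanSpace ℝ (Fin N)))
    (u : EuclideanSpace ℝ (Fin N) → ℝ) : Prop :=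
  MemWTilde s p Ω u ∧ MemWTilde s q Ω u

/-- The weak form of the fractional `m`-Laplacian,
`∬ J_m(u(x) - u(y)) (φ(x) - φ(y)) / |x - y|^{N+sm} dx dy` (an absolutely convergent integral for
`u ∈ W̃^{s,m}(Ω)` and `φ ∈ C_c^∞(Ω)`). -/
noncomputable def form {N : ℕ} (s m : ℝ) (u φ : EuclideanSpace ℝ (Fin N) → ℝ) : ℝ :=
  ∫ z : EuclideanSpace ℝ (Fin N) × EuclideanSpace ℝ (Fin N),
    J m (u z.1 - u z.2) * (φ z.1 - φ z.2) / ‖z.1 - z.2‖ ^ ((N : ℝ) + s * m)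

/-- `φ ∈ C_c^∞(Ω)`. -/
def IsTest {N : ℕ} (Ω : Set (EuclideanSpace ℝ (Fin N)))
    (φ : EuclideanSpace ℝ (Fin N) → ℝ) : Prop :=
  ContDiff ℝ (⊤ : ℕ∞) φ ∧ HasCompactSupport φ ∧ tsupport φ ⊆ Ω

/-- `(-Δ_p)^s u + (-Δ_q)^s u ≤ f` weakly in `Ω`. -/
def WeakLE {N : ℕ} (s p q : ℝ) (Ω : Set (EuclideanSpace ℝ (Fin N)))
    (u f : EuclideanSpace ℝ (Fin N) → ℝ) : Prop :=
  ∀ φ, IsTest Ω φ → (∀ x, 0 ≤ φ x) → form s p u φ + form s q u φ ≤ ∫ x in Ω, f x * φ x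

/-- `(-Δ_p)^s u + (-Δ_q)^s u ≥ f` weakly in `Ω`. -/
def WeakGE {N : ℕ} (s p q : ℝ) (Ω : Set (EuclideanSpace ℝ (Fin N)))
    (u f : EuclideanSpace ℝ (Fin N) → ℝ) : Prop :=
  ∀ φ, IsTest Ω φ → (∀ x, 0 ≤ φ x) → ∫ x in Ω, f x * φ x ≤ form s p u φ + form s q u φ

/-- `|(-Δ_p)^s u + (-Δ_q)^s u| ≤ K` weakly in `Ω`. -/
def WeakAbsLE {N : ℕ} (s p q : ℝ) (Ω : Set (EuclideanSpace ℝ (Fin N)))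
    (u : EuclideanSpace ℝ (Fin N) → ℝ) (K : ℝ) : Prop :=
  WeakLE s p q Ω u (fun _ => K) ∧ WeakGE s p q Ω u (fun _ => -K)

/-- `‖u‖_{L^∞(A)}`. -/
noncomputable def supNorm {N : ℕ} (A : Set (EuclideanSpace ℝ (Fin N)))
    (u : EuclideanSpace ℝ (Fin N) → ℝ) : ℝ :=
  (eLpNorm u ∞ (volume.restrict A)).toReal

/-- The nonlocal tail
`Tail_m(u; x; R) = (R^{sm} ∫_{B_R(x)^c} |u(y)|^{m-1} / |x - y|^{N+sm} dy)^{1/(m-1)}`. -/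
noncomputable def tail {N : ℕ} (s m : ℝ) (u : EuclideanSpace ℝ (Fin N) → ℝ)
    (x : EuclideanSpace ℝ (Fin N)) (R : ℝ) : ℝ :=
  (R ^ (s * m) *
    ∫ y in (ball x R)ᶜ, |u y| ^ (m - 1) / ‖x - y‖ ^ ((N : ℝ) + s * m)) ^ (1 / (m - 1))

/-- `Q(u; x; R) = ‖u‖_{L^∞(B_R(x))} + Tail_p(u; x; R)`. -/
noncomputable def Q {N : ℕ} (s p : ℝ) (u : EuclideanSpace ℝ (Fin N) → ℝ)
    (x : EuclideanSpace ℝ (Fin N)) (R : ℝ) : ℝ :=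
  supNorm (ball x R) u + tail s p u x R

/-- `K_0 = K + ‖u‖_{L^∞(ℝ^N)}^{q-1}`. -/
noncomputable def K0 {N : ℕ} (q K : ℝ) (u : EuclideanSpace ℝ (Fin N) → ℝ) : ℝ :=
  K + supNorm univ u ^ (q - 1)

/-- The essential oscillation of a (bounded) function `u` on `A`. -/
noncomputable def osc {N : ℕ} (A : Set (EuclideanSpace ℝ (Fin N)))
    (u : EuclideanSpace ℝ (Fin N) → ℝ) : ℝ :=
  essSup u (volume.restrict A) - essInf u (volume.restrict A)

/-- The Hölder seminorm `sup_{x ≠ y ∈ A} |v(x) - v(y)| / |x - y|^α`, with values in `[0, ∞]`. -/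
noncomputable def holderSeminorm {N : ℕ} (α : ℝ) (A : Set (EuclideanSpace ℝ (Fin N)))
    (v : EuclideanSpace ℝ (Fin N) → ℝ) : ℝ≥0∞ :=
  ⨆ x ∈ A, ⨆ y ∈ A, ⨆ _ : x ≠ y, ENNReal.ofReal (|v x - v y| / ‖x - y‖ ^ α)

end FracPQ

/-! The proof is a barrier argument followed by a geometric iteration; no Caccioppoli or Harnack
inequality is used.

Growth (`IsSupersol.growth`). Let u be a supersolution with u ≥ μ in B_R and u ≥ μ + ω/2 on a fixed
fraction of the annulus B_R \ B_{R/2}. Test with ψ = (w - (u - μ))_+, where w is a concave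
paraboloid of height τ = σω. For |x - y| < R/8 monotonicity of J_m lets w replace u
(`formDensity_near_le`), and the second differences of w cost only a multiple of τ^{m-1} R^{-sm} ∫ψ
(`integral_near_barrier_le`). For distant pairs, wherever ψ > 0 the value of u is within σω of μ, so
the large set contributes a fixed negative multiple of ω^{m-1} R^{-sm}. The remaining points of
B_{R₀} cost a (σ+δ)^{m-1} multiple of the same quantity, and the points outside B_{R₀} cost a tail
(`integral_J_far_le`). When the gain exceeds K and the tails, ∫ψ = 0, hence u ≥ μ + w. The orders p
and q are estimated separately and added.

Admissibility. ψ is not smooth. It has finite energy, and `IsSupersol.le_form` extends the weak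
inequality to it: the form of a mollification is an average of forms of translates, and these depend
continuously on the shift.

Iteration (`exists_osc_decay`). On radii R_k = R₀ 8^{-k} the target oscillation is ω_k = A 8^{-αk}.
At each scale u lies in the upper or the lower half of its range on half of the annulus, so growth
applies to u or to -u. The gain ω_k^{m-1} R_k^{-sm} grows geometrically in k while K and the tails
beyond R₀ are fixed, so from some k₀ on the gain wins. The first k₀ scales are paid for by enlarging
A. The q-tail is not controlled by Tail_p; it is bounded by the sup norm of u, which is the origin
of the term ‖u‖^{q-1} in K₀.

Hölder bound. The decay is applied in balls of radius R₀ centred at all points of B_{R₀}(x₀), after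
recentring the tail (`rawTail_center_le`). Countably many balls then give a full-measure set on
which u is Hölder, and a McShane extension supplies the representative (`exists_holder_rep`). -/

namespace FracPQ

/-! ### Integrals of powers of the norm, near the origin and at infinity. -/

section Radial

variable {N : ℕ}

/-- The surface measure of the unit sphere, as the constant in polar integrals. -/
noncomputable def sphereConst (N : ℕ) : ℝ :=
  N * (volume : Measure (EuclideanSpace ℝ (Fin N))).real (ball 0 1)

lemma sphereConst_pos [NeZero N] : 0 < sphereConst N := by
  have : 0 < (volume : Measure (EuclideanSpace ℝ (Fin N))).real (ball 0 1) :=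
    ENNReal.toReal_pos (measure_ball_pos _ _ one_pos).ne' measure_ball_lt_top.ne
  have hN : (0 : ℝ) < N := by exact_mod_cast Nat.pos_of_ne_zero (NeZero.ne N)
  exact mul_pos hN this

lemma pow_smul_rpow [NeZero N] {y b : ℝ} (hy : 0 < y) :
    y ^ (Module.finrank ℝ (EuclideanSpace ℝ (Fin N)) - 1) • y ^ b = y ^ ((N : ℝ) - 1 + b) := by
  have hN : 1 ≤ N := Nat.one_le_iff_ne_zero.2 (NeZero.ne N)
  rw [finrank_euclideanSpace_fin, smul_eq_mul, Real.rpow_add hy, ← Real.rpow_natCast]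
  push_cast [hN]
  rfl

lemma integrableOn_norm_rpow_far [NeZero N] {a r : ℝ} (ha : 0 < a) (hr : 0 < r) :
    IntegrableOn (fun h : EuclideanSpace ℝ (Fin N) => ‖h‖ ^ (-((N : ℝ) + a))) (ball 0 r)ᶜ := by
  rw [← integrable_indicator_iff measurableSet_ball.compl]
  have : ((ball (0 : EuclideanSpace ℝ (Fin N)) r)ᶜ).indicator
      (fun h : EuclideanSpace ℝ (Fin N) => ‖h‖ ^ (-((N : ℝ) + a))) =
      fun h => (Ici r).indicator (fun t : ℝ => t ^ (-((N : ℝ) + a))) ‖h‖ := by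
    ext h; simp [indicator]
  rw [this, integrable_fun_norm_addHaar volume]
  have h1 : IntegrableOn (fun t : ℝ => t ^ (-a - 1)) (Ici r) := by
    rw [integrableOn_Ici_iff_integrableOn_Ioi]
    exact integrableOn_Ioi_rpow_of_lt (by linarith) hr
  rw [← integrable_indicator_iff measurableSet_Ici] at h1
  refine h1.integrableOn.congr_fun (fun t ht => ?_) measurableSet_Ioi
  by_cases h : t ∈ Ici r
  · simp only [indicator_of_mem h]
    rw [pow_smul_rpow ht]; congr 1; ring
  · simp only [indicator_of_notMem h, smul_zero]

lemma integral_norm_rpow_far [NeZero N] {a r : ℝ} (ha : 0 < a) (hr : 0 < r) :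
    ∫ h in (ball (0 : EuclideanSpace ℝ (Fin N)) r)ᶜ, ‖h‖ ^ (-((N : ℝ) + a)) =
      sphereConst N / a * r ^ (-a) := by
  rw [← integral_indicator measurableSet_ball.compl]
  have : ((ball (0 : EuclideanSpace ℝ (Fin N)) r)ᶜ).indicator
      (fun h : EuclideanSpace ℝ (Fin N) => ‖h‖ ^ (-((N : ℝ) + a))) =
      fun h => (Ici r).indicator (fun t : ℝ => t ^ (-((N : ℝ) + a))) ‖h‖ := by
    ext h; simp [indicator]
  rw [this, integral_fun_norm_addHaar volume]
  have h1 : ∫ t in Ioi (0 : ℝ), t ^ (Module.finrank ℝ (EuclideanSpace ℝ (Fin N)) - 1) •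
      (Ici r).indicator (fun t : ℝ => t ^ (-((N : ℝ) + a))) t =
      ∫ t in Ioi (0 : ℝ), (Ici r).indicator (fun t : ℝ => t ^ (-a - 1)) t := by
    refine setIntegral_congr_fun measurableSet_Ioi (fun t ht => ?_)
    by_cases h : t ∈ Ici r
    · simp only [indicator_of_mem h]
      rw [pow_smul_rpow ht]; congr 1; ring
    · simp only [indicator_of_notMem h, smul_zero]
  rw [h1, setIntegral_indicator measurableSet_Ici,
    inter_eq_self_of_subset_right (Ici_subset_Ioi.2 hr), integral_Ici_eq_integral_Ioi,
    integral_Ioi_rpow_of_lt (by linarith) hr, finrank_euclideanSpace_fin, sphereConst]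
  simp only [nsmul_eq_mul, smul_eq_mul, sub_add_cancel]
  rw [div_neg, neg_div, neg_neg]
  ring

lemma integrableOn_norm_rpow_near [NeZero N] {a r : ℝ} (ha : 0 < a) (hr : 0 < r) :
    IntegrableOn (fun h : EuclideanSpace ℝ (Fin N) => ‖h‖ ^ (a - N)) (ball 0 r) := by
  rw [integrableOn_fun_norm_addHaar volume (f := fun t : ℝ => t ^ (a - N))]
  have h1 : IntegrableOn (fun t : ℝ => t ^ (a - 1)) (Ioo 0 r) := by
    have := intervalIntegral.intervalIntegrable_rpow' (a := 0) (b := r)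
      (r := a - 1) (by linarith)
    rw [intervalIntegrable_iff_integrableOn_Ioo_of_le hr.le] at this
    exact this
  refine h1.congr_fun (fun t ht => ?_) measurableSet_Ioo
  simp only
  rw [pow_smul_rpow ht.1]; congr 1; ring

lemma integral_norm_rpow_near [NeZero N] {a r : ℝ} (ha : 0 < a) (hr : 0 < r) :
    ∫ h in ball (0 : EuclideanSpace ℝ (Fin N)) r, ‖h‖ ^ (a - N) =
      sphereConst N / a * r ^ a := by
  rw [← integral_indicator measurableSet_ball]
  have : (ball (0 : EuclideanSpace ℝ (Fin N)) r).indicator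
      (fun h : EuclideanSpace ℝ (Fin N) => ‖h‖ ^ (a - N)) =
      fun h => (Iio r).indicator (fun t : ℝ => t ^ (a - N)) ‖h‖ := by
    ext h; simp [indicator]
  rw [this, integral_fun_norm_addHaar volume]
  have h1 : ∫ t in Ioi (0 : ℝ), t ^ (Module.finrank ℝ (EuclideanSpace ℝ (Fin N)) - 1) •
      (Iio r).indicator (fun t : ℝ => t ^ (a - N)) t =
      ∫ t in Ioi (0 : ℝ), (Iio r).indicator (fun t : ℝ => t ^ (a - 1)) t := by
    refine setIntegral_congr_fun measurableSet_Ioi (fun t ht => ?_)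
    by_cases h : t ∈ Iio r
    · simp only [indicator_of_mem h]
      rw [pow_smul_rpow ht]; congr 1; ring
    · simp only [indicator_of_notMem h, smul_zero]
  rw [h1, setIntegral_indicator measurableSet_Iio, Ioi_inter_Iio, ← integral_Ioc_eq_integral_Ioo,
    ← intervalIntegral.integral_of_le hr.le, integral_rpow (Or.inl (by linarith)),
    finrank_euclideanSpace_fin, sphereConst]
  simp only [nsmul_eq_mul, smul_eq_mul, sub_add_cancel]
  rw [Real.zero_rpow ha.ne', sub_zero]
  ring

end Radial

/-! ### Algebraic inequalities for the nonlinearity J_m. -/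

section Power

lemma J_zero (m : ℝ) : J m 0 = 0 := by simp [J]

lemma J_neg (m t : ℝ) : J m (-t) = -J m t := by simp [J]

lemma J_of_nonneg {m t : ℝ} (hm : 2 ≤ m) (ht : 0 ≤ t) : J m t = t ^ (m - 1) := by
  rcases ht.eq_or_lt with rfl | h
  · rw [J_zero, Real.zero_rpow (by linarith)]
  · rw [J, abs_of_pos h, ← Real.rpow_add_one h.ne']; congr 1; ring

lemma abs_J {m : ℝ} (hm : 2 ≤ m) (t : ℝ) : |J m t| = |t| ^ (m - 1) := by
  rw [← J_of_nonneg hm (abs_nonneg t), J, J, abs_mul, abs_abs, abs_of_nonneg]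
  positivity

lemma monotone_J {m : ℝ} (hm : 2 ≤ m) : Monotone (J m) := by
  intro a b hab
  rcases le_total 0 a with ha | ha
  · rw [J_of_nonneg hm ha, J_of_nonneg hm (ha.trans hab)]
    exact Real.rpow_le_rpow ha hab (by linarith)
  · rcases le_total 0 b with hb | hb
    · have h1 : J m b = b ^ (m - 1) := J_of_nonneg hm hb
      have h2 : J m (-a) = (-a) ^ (m - 1) := J_of_nonneg hm (by linarith)
      have : J m a ≤ 0 := by
        rw [J_neg] at h2
        have := Real.rpow_nonneg (neg_nonneg.2 ha) (m - 1)
        linarith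
      have := Real.rpow_nonneg hb (m - 1)
      linarith
    · have h1 : J m (-b) = (-b) ^ (m - 1) := J_of_nonneg hm (by linarith)
      have h2 : J m (-a) = (-a) ^ (m - 1) := J_of_nonneg hm (by linarith)
      have := Real.rpow_le_rpow (neg_nonneg.2 hb) (neg_le_neg hab) (by linarith : 0 ≤ m - 1)
      rw [J_neg] at h1 h2
      linarith

lemma measurable_J (m : ℝ) : Measurable (J m) := by
  unfold J; fun_prop

/-- `J_m` is Lipschitz on `[-L, L]` with constant `(m - 1) L^{m-2}`. -/
lemma abs_J_sub_le {m L a b : ℝ} (hm : 2 ≤ m) (hL : 0 ≤ L) (ha : |a| ≤ L) (hb : |b| ≤ L) :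
    |J m a - J m b| ≤ (m - 1) * L ^ (m - 2) * |a - b| := by
  have key : ∀ x y : ℝ, 0 ≤ y → y ≤ x → x ≤ L →
      x ^ (m - 1) - y ^ (m - 1) ≤ (m - 1) * L ^ (m - 2) * (x - y) := by
    intro x y hy hyx hx
    have hd : ∀ t ∈ Icc (0 : ℝ) L,
        HasDerivWithinAt (fun t : ℝ => t ^ (m - 1)) ((m - 1) * t ^ (m - 1 - 1)) (Icc 0 L) t :=
      fun t _ => (Real.hasDerivAt_rpow_const (Or.inr (by linarith))).hasDerivWithinAt
    have hbd : ∀ t ∈ Icc (0 : ℝ) L, ‖(m - 1) * t ^ (m - 1 - 1)‖ ≤ (m - 1) * L ^ (m - 2) := by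
      intro t ht
      rw [Real.norm_of_nonneg (mul_nonneg (by linarith) (Real.rpow_nonneg ht.1 _))]
      rw [show m - 1 - 1 = m - 2 by ring]
      exact mul_le_mul_of_nonneg_left (Real.rpow_le_rpow ht.1 ht.2 (by linarith)) (by linarith)
    have := (convex_Icc (0 : ℝ) L).norm_image_sub_le_of_norm_hasDerivWithin_le hd hbd
      (⟨hy, hyx.trans hx⟩ : y ∈ Icc 0 L) (⟨hy.trans hyx, hx⟩ : x ∈ Icc 0 L)
    rw [Real.norm_eq_abs, Real.norm_of_nonneg (sub_nonneg.2 hyx)] at this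
    exact (le_abs_self _).trans this
  have hc : 0 ≤ (m - 1) * L ^ (m - 2) := mul_nonneg (by linarith) (Real.rpow_nonneg hL _)
  have hle : ∀ x y : ℝ, |x| ≤ L → |y| ≤ L → y ≤ x →
      J m x - J m y ≤ (m - 1) * L ^ (m - 2) * (x - y) := by
    intro x y hx hy hyx
    rw [abs_le] at hx hy
    rcases le_total 0 y with h0 | h0
    · rw [J_of_nonneg hm h0, J_of_nonneg hm (h0.trans hyx)]
      exact key x y h0 hyx hx.2
    · have hy' := J_of_nonneg hm (neg_nonneg.2 h0)
      rw [J_neg] at hy'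
      have z : (0 : ℝ) ^ (m - 1) = 0 := Real.zero_rpow (by linarith)
      rcases le_total 0 x with h1 | h1
      · rw [J_of_nonneg hm h1]
        have k1 := key x 0 le_rfl h1 hx.2
        have k2 := key (-y) 0 le_rfl (by linarith) (by linarith)
        rw [z] at k1 k2
        linarith
      · have hx' := J_of_nonneg hm (neg_nonneg.2 h1)
        rw [J_neg] at hx'
        have := key (-y) (-x) (by linarith) (by linarith) (by linarith)
        linarith
  rcases le_total b a with h | h
  · rw [abs_of_nonneg (sub_nonneg.2 (monotone_J hm h)), abs_of_nonneg (sub_nonneg.2 h)]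
    exact hle a b ha hb h
  · rw [abs_sub_comm, abs_sub_comm a, abs_of_nonneg (sub_nonneg.2 (monotone_J hm h)),
      abs_of_nonneg (sub_nonneg.2 h)]
    exact hle b a hb ha h

/-- A scaled Young inequality for `|a|^{m-1} |b|`. -/
lemma rpow_mul_le_add {m ε a b : ℝ} (hm : 2 ≤ m) (hε : 0 < ε) (ha : 0 ≤ a) (hb : 0 ≤ b) :
    a ^ (m - 1) * b ≤ ε * a ^ m + ε ^ (1 - m) * b ^ m := by
  have e : ∀ x : ℝ, 0 ≤ x → x ^ (m - 1) * x = x ^ m := by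
    intro x hx
    rcases hx.eq_or_lt with rfl | h
    · rw [mul_zero, Real.zero_rpow (by linarith)]
    · rw [← Real.rpow_add_one h.ne']; congr 1; ring
  have p1 : 0 ≤ ε * a ^ m := by positivity
  have p2 : 0 ≤ ε ^ (1 - m) * b ^ m := by positivity
  -- If b ≤ εa the first term alone suffices; otherwise a ≤ b/ε and the second does.
  rcases le_total b (ε * a) with h | h
  · have : a ^ (m - 1) * b ≤ a ^ (m - 1) * (ε * a) :=
      mul_le_mul_of_nonneg_left h (Real.rpow_nonneg ha _)
    have h2 : a ^ (m - 1) * (ε * a) = ε * a ^ m := by rw [← e a ha]; ring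
    linarith
  · have h3 : a ≤ ε⁻¹ * b := by
      rw [inv_mul_eq_div, le_div_iff₀ hε]; linarith
    have : a ^ (m - 1) * b ≤ (ε⁻¹ * b) ^ (m - 1) * b :=
      mul_le_mul_of_nonneg_right (Real.rpow_le_rpow ha h3 (by linarith)) hb
    have h2 : (ε⁻¹ * b) ^ (m - 1) * b = ε ^ (1 - m) * b ^ m := by
      rw [Real.mul_rpow (inv_nonneg.2 hε.le) hb, ← e b hb, Real.inv_rpow hε.le,
        ← Real.rpow_neg hε.le, neg_sub]
      ring
    linarith

lemma add_rpow_le {r a b : ℝ} (hr : 0 ≤ r) (ha : 0 ≤ a) (hb : 0 ≤ b) :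
    (a + b) ^ r ≤ 2 ^ r * (a ^ r + b ^ r) := by
  wlog h : a ≤ b generalizing a b
  · rw [add_comm a b, add_comm (a ^ r)]
    exact this hb ha (le_of_not_ge h)
  calc (a + b) ^ r ≤ (2 * b) ^ r := Real.rpow_le_rpow (by positivity) (by linarith) hr
    _ = 2 ^ r * b ^ r := Real.mul_rpow (by norm_num) hb
    _ ≤ 2 ^ r * (a ^ r + b ^ r) := by
      have := Real.rpow_nonneg ha r
      gcongr; linarith

/-- The pointwise inequality behind the comparison principle. -/
lemma J_mul_posPart_le {m a b c d : ℝ} (hm : 2 ≤ m) :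
    J m (a - b) * (max (c - a) 0 - max (d - b) 0) ≤
      J m (c - d) * (max (c - a) 0 - max (d - b) 0) := by
  -- The larger positive part, when strictly larger, is attained without truncation; this orders a -
  -- b against c - d in the direction that matches the sign of the common factor.
  rcases le_total (max (d - b) 0) (max (c - a) 0) with h | h
  · rcases h.eq_or_lt with h | h
    · simp [h]
    · refine mul_le_mul_of_nonneg_right (monotone_J hm ?_) (by linarith)
      have h0 : 0 < max (c - a) 0 := (le_max_right _ _).trans_lt h
      have h1 : max (c - a) 0 = c - a := max_eq_left (by
        by_contra hc; rw [max_eq_right (not_le.1 hc).le] at h0; exact lt_irrefl _ h0)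
      have := le_max_left (d - b) 0
      linarith
  · rcases h.eq_or_lt with h | h
    · simp [h]
    · refine mul_le_mul_of_nonpos_right (monotone_J hm ?_) (by linarith)
      have h0 : 0 < max (d - b) 0 := (le_max_right _ _).trans_lt h
      have h1 : max (d - b) 0 = d - b := max_eq_left (by
        by_contra hc; rw [max_eq_right (not_le.1 hc).le] at h0; exact lt_irrefl _ h0)
      have := le_max_left (c - a) 0
      linarith

end Power

/-! ### Gagliardo energy, and continuity of the weak form under translation of the test function. -/

section Energy

open Filter Topology

/-- The ambient Euclidean space. -/
abbrev Euc (N : ℕ) := EuclideanSpace ℝ (Fin N)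

variable {N : ℕ}

/-- The density of the Gagliardo energy. -/
noncomputable def energyDensity (s m : ℝ) (u : Euc N → ℝ) (z : Euc N × Euc N) : ℝ :=
  |u z.1 - u z.2| ^ m / ‖z.1 - z.2‖ ^ ((N : ℝ) + s * m)

/-- The integrand of the weak form. -/
noncomputable def formDensity (s m : ℝ) (u φ : Euc N → ℝ) (z : Euc N × Euc N) : ℝ :=
  J m (u z.1 - u z.2) * (φ z.1 - φ z.2) / ‖z.1 - z.2‖ ^ ((N : ℝ) + s * m)

/-- Pairs of points with at least one of them in `Ω`. -/
def cross (Ω : Set (Euc N)) : Set (Euc N × Euc N) := {z | z.1 ∈ Ω ∨ z.2 ∈ Ω}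

lemma measurableSet_cross {Ω : Set (Euc N)} (h : MeasurableSet Ω) : MeasurableSet (cross Ω) :=
  (measurable_fst h).union (measurable_snd h)

lemma energyDensity_nonneg (s m : ℝ) (u : Euc N → ℝ) (z : Euc N × Euc N) :
    0 ≤ energyDensity s m u z := by unfold energyDensity; positivity

lemma measurable_energyDensity (s m : ℝ) {u : Euc N → ℝ} (hu : Measurable u) :
    Measurable (energyDensity s m u) := by
  unfold energyDensity
  fun_prop

lemma measurable_formDensity (s m : ℝ) {u φ : Euc N → ℝ} (hu : Measurable u)
    (hφ : Measurable φ) : Measurable (formDensity s m u φ) := by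
  unfold formDensity
  have := measurable_J m
  fun_prop

lemma abs_formDensity_le {s m ε : ℝ} (hm : 2 ≤ m) (hε : 0 < ε) (u φ : Euc N → ℝ)
    (z : Euc N × Euc N) :
    |formDensity s m u φ z| ≤ ε * energyDensity s m u z + ε ^ (1 - m) * energyDensity s m φ z := by
  unfold formDensity energyDensity
  rw [abs_div, abs_mul, abs_J hm, abs_of_nonneg (Real.rpow_nonneg (norm_nonneg _) _),
    ← mul_div_assoc, ← mul_div_assoc, ← add_div]
  exact div_le_div_of_nonneg_right (rpow_mul_le_add hm hε (abs_nonneg _) (abs_nonneg _))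
    (Real.rpow_nonneg (norm_nonneg _) _)

lemma formDensity_eq_zero {Ω : Set (Euc N)} {φ : Euc N → ℝ} (hφ : ∀ x ∉ Ω, φ x = 0) (s m : ℝ)
    (u : Euc N → ℝ) {z : Euc N × Euc N} (hz : z ∉ cross Ω) : formDensity s m u φ z = 0 := by
  simp only [cross, mem_ofPred_eq, not_or] at hz
  simp [formDensity, hφ _ hz.1, hφ _ hz.2]

/-- Pairs outside `cross Ω` do not contribute, so u needs finite energy only on pairs that meet Ω;
its global energy may be infinite. -/
lemma abs_formDensity_le_indicator {s m ε : ℝ} (hm : 2 ≤ m) (hε : 0 < ε) (u : Euc N → ℝ)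
    {Ω : Set (Euc N)} {φ : Euc N → ℝ} (hφ : ∀ x ∉ Ω, φ x = 0) (z : Euc N × Euc N) :
    |formDensity s m u φ z| ≤
      ε * (cross Ω).indicator (energyDensity s m u) z + ε ^ (1 - m) * energyDensity s m φ z := by
  by_cases hz : z ∈ cross Ω
  · rw [indicator_of_mem hz]
    exact abs_formDensity_le hm hε u φ z
  · rw [indicator_of_notMem hz, formDensity_eq_zero hφ s m u hz, abs_zero, mul_zero, zero_add]
    exact mul_nonneg (by positivity) (energyDensity_nonneg _ _ _ _)

lemma integrable_formDensity {s m : ℝ} (hm : 2 ≤ m) {u φ : Euc N → ℝ} {Ω : Set (Euc N)}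
    (hΩ : MeasurableSet Ω) (hu : Measurable u) (hφ : Measurable φ) (h0 : ∀ x ∉ Ω, φ x = 0)
    (hue : IntegrableOn (energyDensity s m u) (cross Ω)) (hφe : Integrable (energyDensity s m φ)) :
    Integrable (formDensity s m u φ) := by
  refine Integrable.mono' (((hue.integrable_indicator (measurableSet_cross hΩ)).const_mul 1).add
    (hφe.const_mul ((1 : ℝ) ^ (1 - m)))) (measurable_formDensity s m hu hφ).aestronglyMeasurable
    (ae_of_all _ fun z => ?_)
  exact abs_formDensity_le_indicator hm one_pos u h0 z

/-- The free ε makes the form continuous in φ: the energy of u is first made harmless by a small ε,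
then the energy of φ is sent to zero. -/
lemma abs_form_le {s m ε : ℝ} (hm : 2 ≤ m) (hε : 0 < ε) {u φ : Euc N → ℝ} {Ω : Set (Euc N)}
    (hΩ : MeasurableSet Ω) (h0 : ∀ x ∉ Ω, φ x = 0)
    (hue : IntegrableOn (energyDensity s m u) (cross Ω)) (hφe : Integrable (energyDensity s m φ)) :
    |form s m u φ| ≤ ε * (∫ z in cross Ω, energyDensity s m u z) +
      ε ^ (1 - m) * ∫ z, energyDensity s m φ z := by
  have hi := hue.integrable_indicator (measurableSet_cross hΩ)
  calc |form s m u φ| = ‖∫ z, formDensity s m u φ z‖ := rfl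
    _ ≤ ∫ z, (ε * (cross Ω).indicator (energyDensity s m u) z
        + ε ^ (1 - m) * energyDensity s m φ z) :=
      norm_integral_le_of_norm_le ((hi.const_mul ε).add (hφe.const_mul _))
        (ae_of_all _ fun z => abs_formDensity_le_indicator hm hε u h0 z)
    _ = _ := by
      rw [integral_add (hi.const_mul ε) (hφe.const_mul _), integral_const_mul, integral_const_mul,
        integral_indicator (measurableSet_cross hΩ)]

lemma form_sub {s m : ℝ} {u φ₁ φ₂ : Euc N → ℝ} (h1 : Integrable (formDensity s m u φ₁))
    (h2 : Integrable (formDensity s m u φ₂)) :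
    form s m u (fun x => φ₁ x - φ₂ x) = form s m u φ₁ - form s m u φ₂ := by
  refine Eq.trans ?_ (integral_sub h1 h2)
  unfold form
  congr 1; ext z
  ring

/-- Diagonal translation of pairs of points. -/
lemma measurePreserving_diag_sub (h : Euc N) :
    MeasurePreserving (fun z : Euc N × Euc N => (z.1 - h, z.2 - h)) := by
  exact measurePreserving_sub_right ((volume : Measure (Euc N)).prod volume) (h, h)

lemma energyDensity_translate (s m : ℝ) (φ : Euc N → ℝ) (h : Euc N) (z : Euc N × Euc N) :
    energyDensity s m (fun x => φ (x - h)) z = energyDensity s m φ (z.1 - h, z.2 - h) := by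
  simp [energyDensity]

lemma integrable_energyDensity_translate {s m : ℝ} {φ : Euc N → ℝ} (h : Euc N)
    (hφ : Integrable (energyDensity s m φ)) :
    Integrable (energyDensity s m (fun x => φ (x - h))) := by
  have := (measurePreserving_diag_sub h).integrable_comp_of_integrable hφ
  refine this.congr (ae_of_all _ fun z => ?_)
  rw [energyDensity_translate]; rfl

lemma integral_energyDensity_translate {s m : ℝ} {φ : Euc N → ℝ} (h : Euc N) :
    ∫ z, energyDensity s m (fun x => φ (x - h)) z = ∫ z, energyDensity s m φ z := by
  simp_rw [energyDensity_translate]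
  exact integral_sub_right_eq_self (μ := (volume : Measure (Euc N)).prod volume)
    (energyDensity s m φ) (h, h)

lemma tendsto_integral_translate_rpow {m : ℝ} (hm : 1 ≤ m) {Φ : Euc N × Euc N → ℝ}
    (hΦ : MemLp Φ (ENNReal.ofReal m)) :
    Tendsto (fun h : Euc N => ∫ z : Euc N × Euc N, |Φ (z.1 - h, z.2 - h) - Φ z| ^ m)
      (𝓝 0) (𝓝 0) := by
  have : Fact ((1 : ℝ≥0∞) ≤ ENNReal.ofReal m) := ⟨by simpa using hm⟩
  -- Continuity of translations in L^m is available for families of maps continuous in the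
  -- compact-open topology; currying the joint map provides one.
  let g : C(Euc N, C(Euc N × Euc N, Euc N × Euc N)) :=
    (ContinuousMap.mk (fun a : Euc N × (Euc N × Euc N) => (a.2.1 - a.1, a.2.2 - a.1))
      (by fun_prop)).curry
  have hgm : ∀ h, MeasurePreserving (g h) volume volume := measurePreserving_diag_sub
  have hc : Continuous fun h => Lp.compMeasurePreserving (g h) (hgm h) (hΦ.toLp Φ) :=
    (continuous_const (y := hΦ.toLp Φ)).compMeasurePreservingLp g.continuous hgm
      ENNReal.ofReal_ne_top
  have h0 : Lp.compMeasurePreserving (g 0) (hgm 0) (hΦ.toLp Φ) = hΦ.toLp Φ := by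
    rw [Lp.toLp_compMeasurePreserving]
    congr 1; ext z; simp [g]
  have ht := tendsto_iff_edist_tendsto_0.1 (hc.tendsto 0)
  rw [h0] at ht
  have hm0 : ENNReal.ofReal m ≠ 0 := by simp; linarith
  have he : ∀ h, edist (Lp.compMeasurePreserving (g h) (hgm h) (hΦ.toLp Φ)) (hΦ.toLp Φ) =
      ENNReal.ofReal ((∫ z : Euc N × Euc N, |Φ (z.1 - h, z.2 - h) - Φ z| ^ m) ^ m⁻¹) := by
    intro h
    rw [Lp.toLp_compMeasurePreserving, Lp.edist_toLp_toLp, MemLp.eLpNorm_eq_integral_rpow_norm hm0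
      ENNReal.ofReal_ne_top ((hΦ.comp_measurePreserving (hgm h)).sub hΦ),
      ENNReal.toReal_ofReal (by linarith)]
    rfl
  simp_rw [he] at ht
  have ht2 := (ENNReal.tendsto_toReal ENNReal.zero_ne_top).comp ht
  have hnn : ∀ h : Euc N, 0 ≤ ∫ z : Euc N × Euc N, |Φ (z.1 - h, z.2 - h) - Φ z| ^ m :=
    fun h => integral_nonneg fun z => by positivity
  have ht3 := ht2.rpow_const (p := m) (Or.inr (by linarith))
  rw [ENNReal.toReal_zero, Real.zero_rpow (by linarith)] at ht3
  refine ht3.congr fun h => ?_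
  simp only [Function.comp]
  rw [ENNReal.toReal_ofReal (Real.rpow_nonneg (hnn h) _), Real.rpow_inv_rpow (hnn h) (by linarith)]

/-- The kernel is invariant under diagonal shifts, so this energy is the m-th power of the L^m
distance between (φ(x) - φ(y)) / |x - y|^{(N+sm)/m} and its diagonal translate. -/
lemma tendsto_energy_translate_sub {s m : ℝ} (hm : 2 ≤ m) {φ : Euc N → ℝ} (hφm : Measurable φ)
    (hφ : Integrable (energyDensity s m φ)) :
    Tendsto (fun h : Euc N => ∫ z, energyDensity s m (fun x => φ (x - h) - φ x) z) (𝓝 0) (𝓝 0) := by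
  set e : ℝ := ((N : ℝ) + s * m) / m with he
  have hroot : ∀ t : ℝ, 0 ≤ t → (t ^ e) ^ m = t ^ ((N : ℝ) + s * m) := by
    intro t ht
    rw [← Real.rpow_mul ht, he, div_mul_cancel₀ _ (by linarith)]
  have hdiv : ∀ a t : ℝ, 0 ≤ t → |a / t ^ e| ^ m = |a| ^ m / t ^ ((N : ℝ) + s * m) := by
    intro a t ht
    rw [abs_div, abs_of_nonneg (Real.rpow_nonneg ht e),
      Real.div_rpow (abs_nonneg _) (Real.rpow_nonneg ht e), hroot t ht]
  let Φ : Euc N × Euc N → ℝ := fun z => (φ z.1 - φ z.2) / ‖z.1 - z.2‖ ^ e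
  have hΦm : Measurable Φ := by fun_prop
  have hm0 : ENNReal.ofReal m ≠ 0 := by simp; linarith
  have hΦ : MemLp Φ (ENNReal.ofReal m) := by
    rw [← integrable_norm_rpow_iff hΦm.aestronglyMeasurable hm0 ENNReal.ofReal_ne_top,
      ENNReal.toReal_ofReal (by linarith)]
    refine hφ.congr (ae_of_all _ fun z => ?_)
    exact (hdiv _ _ (norm_nonneg _)).symm
  refine (tendsto_integral_translate_rpow (by linarith) hΦ).congr fun h => ?_
  congr 1; ext z
  have : Φ (z.1 - h, z.2 - h) - Φ z =
      ((φ (z.1 - h) - φ z.1) - (φ (z.2 - h) - φ z.2)) / ‖z.1 - z.2‖ ^ e := by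
    simp only [Φ, sub_sub_sub_cancel_right]; ring
  rw [this, hdiv _ _ (norm_nonneg _)]
  rfl

lemma energyDensity_sub_le {s m : ℝ} (hm : 2 ≤ m) (φ₁ φ₂ : Euc N → ℝ) (z : Euc N × Euc N) :
    energyDensity s m (fun x => φ₁ x - φ₂ x) z ≤
      2 ^ m * (energyDensity s m φ₁ z + energyDensity s m φ₂ z) := by
  unfold energyDensity
  rw [← add_div, ← mul_div_assoc]
  refine div_le_div_of_nonneg_right ?_ (Real.rpow_nonneg (norm_nonneg _) _)
  refine (Real.rpow_le_rpow (abs_nonneg _) ?_ (by linarith)).trans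
    (add_rpow_le (by linarith) (abs_nonneg _) (abs_nonneg _))
  rw [show φ₁ z.1 - φ₂ z.1 - (φ₁ z.2 - φ₂ z.2) = (φ₁ z.1 - φ₁ z.2) - (φ₂ z.1 - φ₂ z.2) by ring]
  exact abs_sub _ _

lemma integrable_energyDensity_sub {s m : ℝ} (hm : 2 ≤ m) {φ₁ φ₂ : Euc N → ℝ}
    (h1m : Measurable φ₁) (h2m : Measurable φ₂)
    (h1 : Integrable (energyDensity s m φ₁)) (h2 : Integrable (energyDensity s m φ₂)) :
    Integrable (energyDensity s m (fun x => φ₁ x - φ₂ x)) := by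
  refine Integrable.mono' ((h1.add h2).const_mul (2 ^ m))
    (measurable_energyDensity s m (h1m.sub h2m)).aestronglyMeasurable (ae_of_all _ fun z => ?_)
  rw [Real.norm_of_nonneg (energyDensity_nonneg _ _ _ _)]
  exact energyDensity_sub_le hm φ₁ φ₂ z

/-- Continuity of the weak form under translations of the test function. -/
lemma tendsto_form_translate {s m : ℝ} (hm : 2 ≤ m) {u φ : Euc N → ℝ} {c : Euc N} {r R : ℝ}
    (hrR : r < R) (hu : Measurable u) (hφ : Measurable φ) (h0 : ∀ x ∉ ball c r, φ x = 0)
    (hue : IntegrableOn (energyDensity s m u) (cross (ball c R)))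
    (hφe : Integrable (energyDensity s m φ)) :
    Tendsto (fun h => form s m u (fun x => φ (x - h))) (𝓝 0) (𝓝 (form s m u φ)) := by
  set Eu := ∫ z in cross (ball c R), energyDensity s m u z with hEu
  have hEu0 : 0 ≤ Eu := integral_nonneg fun z => energyDensity_nonneg _ _ _ _
  have h00 : ∀ x ∉ ball c R, φ x = 0 := fun x hx => h0 x fun h => hx (ball_subset_ball hrR.le h)
  rw [Metric.tendsto_nhds]
  intro η hη
  -- The summand 1 keeps the denominator positive when the energy of u vanishes.
  set ε := η / (2 * (Eu + 1)) with hε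
  have hεp : 0 < ε := by positivity
  have hsmall : ∀ᶠ h : Euc N in 𝓝 0,
      ∫ z, energyDensity s m (fun x => φ (x - h) - φ x) z < η / 2 / ε ^ (1 - m) := by
    refine (tendsto_energy_translate_sub hm hφ hφe).eventually_lt_const ?_
    positivity
  have hnear : ∀ᶠ h : Euc N in 𝓝 0, h ∈ ball (0 : Euc N) (R - r) :=
    ball_mem_nhds _ (sub_pos.2 hrR)
  filter_upwards [hsmall, hnear] with h hh hn
  have ht0 : ∀ x ∉ ball c R, φ (x - h) = 0 := by
    intro x hx
    refine h0 _ fun hxr => hx ?_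
    rw [mem_ball, dist_eq_norm] at hxr ⊢
    rw [mem_ball_zero_iff] at hn
    calc ‖x - c‖ = ‖(x - h - c) + h‖ := by congr 1; abel
      _ ≤ ‖x - h - c‖ + ‖h‖ := norm_add_le _ _
      _ < R := by linarith
  have htm : Measurable fun x => φ (x - h) := by fun_prop
  have hte := integrable_energyDensity_translate h hφe
  have h1 := integrable_formDensity hm measurableSet_ball hu htm ht0 hue hte
  have h2 := integrable_formDensity hm measurableSet_ball hu hφ h00 hue hφe
  rw [Real.dist_eq, ← form_sub h1 h2]
  have := abs_form_le hm hεp (φ := fun x => φ (x - h) - φ x) measurableSet_ball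
    (fun x hx => by rw [ht0 x hx, h00 x hx, sub_zero]) hue
    (integrable_energyDensity_sub hm htm hφ hte hφe)
  have e1 : ε * Eu ≤ η / 2 := by
    have : ε * (Eu + 1) = η / 2 := by rw [hε]; field_simp
    linarith
  have e2 : ε ^ (1 - m) * ∫ z, energyDensity s m (fun x => φ (x - h) - φ x) z < η / 2 := by
    rw [lt_div_iff₀' (by positivity)] at hh
    exact hh
  linarith

end Energy

/-! ### Mollification, and extension of the weak inequality to nonsmooth test functions. -/

section Mollify

open Filter Topology

variable {N : ℕ}

/-- Mollification with a normed bump function. -/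
noncomputable def mollify (ρ : ContDiffBump (0 : Euc N)) (ψ : Euc N → ℝ) (x : Euc N) : ℝ :=
  ∫ h, ρ.normed volume h * ψ (x - h)

lemma integrable_of_bdd_of_support {ψ : Euc N → ℝ} {B r : ℝ} {c : Euc N} (hψ : Measurable ψ)
    (hB : ∀ x, |ψ x| ≤ B) (h0 : ∀ x ∉ ball c r, ψ x = 0) : Integrable ψ := by
  have : IntegrableOn ψ (ball c r) :=
    Measure.integrableOn_of_bounded measure_ball_lt_top.ne hψ.aestronglyMeasurable
      (ae_of_all _ hB)
  rwa [integrableOn_iff_integrable_of_support_subset] at this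
  intro x hx
  by_contra h
  exact hx (h0 x h)

lemma normed_eq_zero {ρ : ContDiffBump (0 : Euc N)} {h : Euc N} (hh : h ∉ ball (0 : Euc N) ρ.rOut) :
    ρ.normed volume h = 0 := by
  rw [← ρ.support_normed_eq (μ := volume), Function.notMem_support] at hh
  exact hh

lemma integrable_normed_mul {ρ : ContDiffBump (0 : Euc N)} {g : Euc N → ℝ} {B : ℝ}
    (hg : AEStronglyMeasurable g) (hB : ∀ h, |g h| ≤ B) :
    Integrable (fun h => ρ.normed volume h * g h) :=
  (ρ.integrable_normed (μ := volume)).mul_bdd hg (ae_of_all _ hB)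

lemma mollify_sub {ρ : ContDiffBump (0 : Euc N)} {ψ : Euc N → ℝ} {B : ℝ}
    (hψ : Measurable ψ) (hB : ∀ x, |ψ x| ≤ B) (x y : Euc N) :
    mollify ρ ψ x - mollify ρ ψ y = ∫ h, ρ.normed volume h * (ψ (x - h) - ψ (y - h)) := by
  have hi : ∀ x, Integrable (fun h => ρ.normed volume h * ψ (x - h)) := fun x =>
    integrable_normed_mul (by fun_prop : Measurable fun h => ψ (x - h)).aestronglyMeasurable
      fun h => hB _
  unfold mollify
  rw [← integral_sub (hi x) (hi y)]
  simp_rw [mul_sub]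

lemma mollify_eq_zero {ρ : ContDiffBump (0 : Euc N)} {ψ : Euc N → ℝ} {c : Euc N} {r : ℝ}
    (h0 : ∀ x ∉ ball c r, ψ x = 0) {x : Euc N} (hx : x ∉ ball c (r + ρ.rOut)) :
    mollify ρ ψ x = 0 := by
  refine integral_eq_zero_of_ae (ae_of_all _ fun h => ?_)
  by_cases hh : h ∈ ball (0 : Euc N) ρ.rOut
  · have : ψ (x - h) = 0 := by
      refine h0 _ fun hxr => hx ?_
      rw [mem_ball, dist_eq_norm] at hxr ⊢
      rw [mem_ball_zero_iff] at hh
      calc ‖x - c‖ = ‖(x - h - c) + h‖ := by congr 1; abel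
        _ ≤ ‖x - h - c‖ + ‖h‖ := norm_add_le _ _
        _ < r + ρ.rOut := by linarith
    simp [this]
  · simp [normed_eq_zero hh]

lemma isTest_mollify {ρ : ContDiffBump (0 : Euc N)} {ψ : Euc N → ℝ} {c : Euc N} {B r R : ℝ}
    (hψ : Measurable ψ) (hB : ∀ x, |ψ x| ≤ B) (h0 : ∀ x ∉ ball c r, ψ x = 0)
    (hR : r + ρ.rOut < R) : IsTest (ball c R) (mollify ρ ψ) := by
  have hsupp : Function.support (mollify ρ ψ) ⊆ closedBall c (r + ρ.rOut) := by
    intro x hx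
    by_contra h
    exact hx (mollify_eq_zero h0 fun h' => h (ball_subset_closedBall h'))
  refine ⟨?_, HasCompactSupport.of_support_subset_isCompact (isCompact_closedBall _ _) hsupp,
    (closure_minimal hsupp isClosed_closedBall).trans (closedBall_subset_ball hR)⟩
  have := (ρ.hasCompactSupport_normed (μ := volume)).contDiff_convolution_left (n := ⊤)
    (ContinuousLinearMap.lsmul ℝ ℝ) ρ.contDiff_normed
    (integrable_of_bdd_of_support hψ hB h0).locallyIntegrable
  exact this

lemma integral_mollify {ρ : ContDiffBump (0 : Euc N)} {ψ : Euc N → ℝ} (hψ : Integrable ψ) :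
    ∫ x, mollify ρ ψ x = ∫ x, ψ x := by
  have := integral_convolution (μ := volume) (ν := volume) (ContinuousLinearMap.lsmul ℝ ℝ)
    (ρ.integrable_normed (μ := volume)) hψ
  simp only [ContinuousLinearMap.lsmul_apply, ρ.integral_normed, one_smul] at this
  exact this

/-- The hypothesis of Fubini for `form_mollify`. The energy of a translate does not depend on the
shift, which bounds the inner integrals uniformly. -/
lemma integrable_prod_formDensity {s m : ℝ} (hm : 2 ≤ m) {u ψ : Euc N → ℝ} {c : Euc N} {r R : ℝ}
    {ρ : ContDiffBump (0 : Euc N)} (hρ : r + ρ.rOut ≤ R) (hu : Measurable u) (hψ : Measurable ψ)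
    (h0 : ∀ x ∉ ball c r, ψ x = 0)
    (hue : IntegrableOn (energyDensity s m u) (cross (ball c R)))
    (hψe : Integrable (energyDensity s m ψ)) :
    Integrable (fun w : (Euc N × Euc N) × Euc N =>
      ρ.normed volume w.2 * formDensity s m u (fun x => ψ (x - w.2)) w.1)
      ((volume : Measure (Euc N × Euc N)).prod volume) := by
  have hmeas : Measurable fun w : (Euc N × Euc N) × Euc N =>
      ρ.normed volume w.2 * formDensity s m u (fun x => ψ (x - w.2)) w.1 := by
    have h1 := measurable_J m
    have h2 : Measurable (ρ.normed volume) := ρ.continuous_normed.measurable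
    unfold formDensity
    fun_prop
  set Eu := ∫ z in cross (ball c R), energyDensity s m u z
  set Eψ := ∫ z, energyDensity s m ψ z
  have hz : ∀ h ∈ ball (0 : Euc N) ρ.rOut, ∀ x ∉ ball c R, ψ (x - h) = 0 := by
    intro h hh x hx
    refine h0 _ fun hxr => hx ?_
    rw [mem_ball, dist_eq_norm] at hxr ⊢
    rw [mem_ball_zero_iff] at hh
    calc ‖x - c‖ = ‖(x - h - c) + h‖ := by congr 1; abel
      _ ≤ ‖x - h - c‖ + ‖h‖ := norm_add_le _ _
      _ < R := by linarith
  have hi : ∀ h ∈ ball (0 : Euc N) ρ.rOut, Integrable (formDensity s m u fun x => ψ (x - h)) :=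
    fun h hh => integrable_formDensity hm measurableSet_ball hu (by fun_prop) (hz h hh) hue
      (integrable_energyDensity_translate h hψe)
  refine (integrable_prod_iff' hmeas.aestronglyMeasurable).2 ⟨ae_of_all _ fun h => ?_, ?_⟩
  · by_cases hh : h ∈ ball (0 : Euc N) ρ.rOut
    · exact (hi h hh).const_mul (ρ.normed volume h)
    · simp [normed_eq_zero hh]
  · refine Integrable.mono' ((ρ.integrable_normed (μ := volume)).mul_const (Eu + Eψ))
      (hmeas.norm.stronglyMeasurable.integral_prod_left').aestronglyMeasurable
      (ae_of_all _ fun h => ?_)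
    rw [Real.norm_of_nonneg (integral_nonneg fun _ => norm_nonneg _)]
    by_cases hh : h ∈ ball (0 : Euc N) ρ.rOut
    · simp_rw [norm_mul, Real.norm_of_nonneg (ρ.nonneg_normed (μ := volume) h)]
      rw [integral_const_mul]
      refine mul_le_mul_of_nonneg_left ?_ (ρ.nonneg_normed _)
      have hcr := hue.integrable_indicator (measurableSet_cross (measurableSet_ball (x := c)
        (ε := R)))
      have hte := integrable_energyDensity_translate h hψe
      calc ∫ z, ‖formDensity s m u (fun x => ψ (x - h)) z‖
          ≤ ∫ z, ((cross (ball c R)).indicator (energyDensity s m u) z +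
              energyDensity s m (fun x => ψ (x - h)) z) := by
            refine integral_mono (hi h hh).norm (hcr.add hte) fun z => ?_
            have := abs_formDensity_le_indicator hm one_pos u (s := s) (hz h hh) z
            simpa using this
        _ = Eu + Eψ := by
            rw [integral_add hcr hte, integral_indicator (measurableSet_cross measurableSet_ball),
              integral_energyDensity_translate]
    · simp [normed_eq_zero hh]

/-- The form is linear in its test function and only that function is mollified, so the average over
shifts can be taken outside. -/
lemma form_mollify {s m : ℝ} (hm : 2 ≤ m) {u ψ : Euc N → ℝ} {c : Euc N} {B r R : ℝ}
    {ρ : ContDiffBump (0 : Euc N)} (hρ : r + ρ.rOut ≤ R) (hu : Measurable u) (hψ : Measurable ψ)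
    (hB : ∀ x, |ψ x| ≤ B) (h0 : ∀ x ∉ ball c r, ψ x = 0)
    (hue : IntegrableOn (energyDensity s m u) (cross (ball c R)))
    (hψe : Integrable (energyDensity s m ψ)) :
    Integrable (fun h => ρ.normed volume h * form s m u (fun x => ψ (x - h))) ∧
    form s m u (mollify ρ ψ) =
      ∫ h, ρ.normed volume h * form s m u (fun x => ψ (x - h)) := by
  have hint := integrable_prod_formDensity hm hρ hu hψ h0 hue hψe
  have e : ∀ h, ∫ z, ρ.normed volume h * formDensity s m u (fun x => ψ (x - h)) z =
      ρ.normed volume h * form s m u (fun x => ψ (x - h)) := fun h => integral_const_mul _ _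
  constructor
  · have := hint.integral_prod_right
    simpa only [e] using this
  · simp_rw [← e]
    rw [← integral_integral_swap hint]
    unfold form
    congr 1; ext z
    rw [mollify_sub hψ hB]
    simp only [formDensity]
    rw [← integral_const_mul, ← integral_div]
    congr 1; ext h
    ring

/-- A bounded weak supersolution in a ball of the equation with right-hand side `-K`. -/
structure IsSupersol (s p q K : ℝ) (c : Euc N) (R : ℝ) (u : Euc N → ℝ) : Prop where
  measurable : Measurable u
  bounded : ∃ M, ∀ x, |u x| ≤ M
  energy_p : IntegrableOn (energyDensity s p u) (cross (ball c R))
  energy_q : IntegrableOn (energyDensity s q u) (cross (ball c R))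
  weak : ∀ φ, IsTest (ball c R) φ → (∀ x, 0 ≤ φ x) →
    -K * ∫ x, φ x ≤ form s p u φ + form s q u φ

/-- The weak inequality extends to bounded test functions of finite energy supported in a smaller
ball. -/
lemma IsSupersol.le_form {s p q K : ℝ} (hp : 2 ≤ p) (hq : 2 ≤ q) {c : Euc N} {R : ℝ}
    {u : Euc N → ℝ} (hS : IsSupersol s p q K c R u) {ψ : Euc N → ℝ} {B r : ℝ} (hrR : r < R)
    (hψ : Measurable ψ) (hψ0 : ∀ x, 0 ≤ ψ x) (hB : ∀ x, |ψ x| ≤ B)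
    (h0 : ∀ x ∉ ball c r, ψ x = 0) (hep : Integrable (energyDensity s p ψ))
    (heq : Integrable (energyDensity s q ψ)) :
    -K * ∫ x, ψ x ≤ form s p u ψ + form s q u ψ := by
  have ht := (tendsto_form_translate hp hrR hS.measurable hψ h0 hS.energy_p hep).add
    (tendsto_form_translate hq hrR hS.measurable hψ h0 hS.energy_q heq)
  refine le_of_forall_pos_le_add fun ε hε => ?_
  -- All translates by small shifts have a form at most ε larger, hence so has any average of them;
  -- the outer radius d/2 below also keeps the support inside the larger ball.
  have hev := ht.eventually_lt_const (lt_add_of_pos_right _ hε)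
  obtain ⟨δ, hδ, hball⟩ := Metric.eventually_nhds_iff_ball.1 hev
  set d := min δ (R - r) with hd
  have hd0 : 0 < d := lt_min hδ (sub_pos.2 hrR)
  let ρ : ContDiffBump (0 : Euc N) := ⟨d / 4, d / 2, by positivity, by linarith⟩
  have hout : ρ.rOut = d / 2 := rfl
  have hdR : d ≤ R - r := min_le_right _ _
  have hρR : r + ρ.rOut < R := by rw [hout]; linarith
  obtain ⟨ip, fp⟩ := form_mollify hp hρR.le hS.measurable hψ hB h0 hS.energy_p hep
  obtain ⟨iq, fq⟩ := form_mollify hq hρR.le hS.measurable hψ hB h0 hS.energy_q heq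
  have hw := hS.weak (mollify ρ ψ) (isTest_mollify hψ hB h0 hρR)
    (fun x => integral_nonneg fun h => mul_nonneg (ρ.nonneg_normed h) (hψ0 _))
  rw [integral_mollify (integrable_of_bdd_of_support hψ hB h0), fp, fq, ← integral_add ip iq] at hw
  refine hw.trans ?_
  calc ∫ h, (ρ.normed volume h * form s p u (fun x => ψ (x - h)) +
          ρ.normed volume h * form s q u (fun x => ψ (x - h)))
      ≤ ∫ h, ρ.normed volume h * (form s p u ψ + form s q u ψ + ε) := by
        refine integral_mono (ip.add iq) ((ρ.integrable_normed (μ := volume)).mul_const _)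
          fun h => ?_
        simp only
        rw [← mul_add]
        by_cases hh : h ∈ ball (0 : Euc N) ρ.rOut
        · refine mul_le_mul_of_nonneg_left ?_ (ρ.nonneg_normed _)
          refine (hball h (ball_subset_ball ?_ hh)).le
          rw [hout]
          have : d ≤ δ := min_le_left _ _
          linarith
        · simp [normed_eq_zero hh]
    _ = form s p u ψ + form s q u ψ + ε := by
        rw [integral_mul_const, ρ.integral_normed, one_mul]

end Mollify

/-! ### Integrability of convolution-type kernels on pairs that meet a ball. -/

section Kernel

variable {N : ℕ}

lemma integrable_prod_of_sub {f G : Euc N → ℝ} (hf : Integrable f) (hG : Integrable G) :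
    Integrable (fun z : Euc N × Euc N => f z.1 * G (z.1 - z.2)) := by
  have hG' : Integrable (fun h => G (-h)) := hG.comp_neg
  have := (hf.convolution_integrand (ContinuousLinearMap.lsmul ℝ ℝ) hG').swap
  refine this.congr (ae_of_all _ fun z => ?_)
  simp

lemma integrable_prod_of_sub' {f G : Euc N → ℝ} (hf : Integrable f) (hG : Integrable G) :
    Integrable (fun z : Euc N × Euc N => f z.2 * G (z.1 - z.2)) :=
  hf.convolution_integrand (ContinuousLinearMap.lsmul ℝ ℝ) hG

lemma integrableOn_cross_of_sub {G : Euc N → ℝ} (hG : Integrable G) (c : Euc N) (r : ℝ) :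
    IntegrableOn (fun z : Euc N × Euc N => G (z.1 - z.2)) (cross (ball c r)) := by
  have h1 : Integrable ((ball c r).indicator fun _ => (1 : ℝ)) :=
    (integrable_indicator_iff measurableSet_ball).2 (integrableOn_const measure_ball_lt_top.ne)
  have e : cross (ball c r) = Prod.fst ⁻¹' ball c r ∪ Prod.snd ⁻¹' ball c r := rfl
  rw [e]
  refine IntegrableOn.union ?_ ?_
  · rw [← integrable_indicator_iff (measurable_fst measurableSet_ball)]
    refine (integrable_prod_of_sub h1 hG).congr (ae_of_all _ fun z => ?_)
    by_cases h : z.1 ∈ ball c r <;> simp only [indicator, h, mem_preimage] <;> simp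
  · rw [← integrable_indicator_iff (measurable_snd measurableSet_ball)]
    refine (integrable_prod_of_sub' h1 hG).congr (ae_of_all _ fun z => ?_)
    by_cases h : z.2 ∈ ball c r <;> simp only [indicator, h, mem_preimage] <;> simp

lemma norm_rpow_div_eq {s m t : ℝ} (ht : 0 < t) :
    t ^ m / t ^ ((N : ℝ) + s * m) = t ^ ((m - s * m) - N) := by
  rw [← Real.rpow_sub ht]; congr 1; ring

lemma one_div_rpow_eq {b t : ℝ} (ht : 0 ≤ t) : 1 / t ^ b = t ^ (-b) := by
  rw [Real.rpow_neg ht, one_div]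

/-- The model for a bounded Lipschitz function: the linear bound beats the singularity since m - sm
> 0, and the constant bound is integrable at infinity since sm > 0. -/
lemma integrable_min_rpow_div [NeZero N] {s m L T : ℝ} (hs0 : 0 < s) (hs1 : s < 1) (hm : 2 ≤ m)
    (hL : 0 ≤ L) (hT : 0 ≤ T) :
    Integrable (fun h : Euc N => (min (L * ‖h‖) T) ^ m / ‖h‖ ^ ((N : ℝ) + s * m)) := by
  have hmeas : Measurable (fun h : Euc N => (min (L * ‖h‖) T) ^ m / ‖h‖ ^ ((N : ℝ) + s * m)) := by
    fun_prop
  have hnn : ∀ h : Euc N, 0 ≤ min (L * ‖h‖) T := fun h => le_min (by positivity) hT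
  have hsm : 0 < m - s * m := by nlinarith
  rw [← integrableOn_univ, ← union_compl_self (ball (0 : Euc N) 1)]
  refine IntegrableOn.union ?_ ?_
  · refine Integrable.mono' ((integrableOn_norm_rpow_near hsm one_pos).const_mul (L ^ m))
      hmeas.aestronglyMeasurable (ae_of_all _ fun h => ?_)
    rw [Real.norm_of_nonneg (div_nonneg (Real.rpow_nonneg (hnn h) _) (by positivity))]
    rcases (norm_nonneg h).eq_or_lt with h0 | h0
    · rw [← h0, mul_zero, min_eq_left hT, Real.zero_rpow (by linarith), zero_div]
      positivity
    · rw [← norm_rpow_div_eq h0, ← mul_div_assoc, ← Real.mul_rpow hL h0.le]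
      exact div_le_div_of_nonneg_right (Real.rpow_le_rpow (hnn h) (min_le_left _ _) (by linarith))
        (by positivity)
  · refine Integrable.mono' ((integrableOn_norm_rpow_far (a := s * m) (by positivity)
      one_pos).const_mul (T ^ m)) hmeas.aestronglyMeasurable (ae_of_all _ fun h => ?_)
    rw [Real.norm_of_nonneg (div_nonneg (Real.rpow_nonneg (hnn h) _) (by positivity)),
      ← one_div_rpow_eq (norm_nonneg h), mul_one_div]
    exact div_le_div_of_nonneg_right (Real.rpow_le_rpow (hnn h) (min_le_right _ _) (by linarith))
      (by positivity)

end Kernel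

/-! ### The paraboloid barrier and the test function built from it. -/

section Barrier

variable {N : ℕ}

/-- A paraboloid, positive exactly in the ball of radius `R / 4`. -/
noncomputable def barrier (c : Euc N) (R τ : ℝ) (x : Euc N) : ℝ := τ * (1 - 16 * ‖x - c‖ ^ 2 / R ^ 2)

/-- The part of the barrier above `u - μ`. -/
noncomputable def barrierExcess (c : Euc N) (R τ μ : ℝ) (u : Euc N → ℝ) (x : Euc N) : ℝ :=
  (ball c (R / 4)).indicator (fun x => max (barrier c R τ x - (u x - μ)) 0) x

lemma measurable_barrier (c : Euc N) (R τ : ℝ) : Measurable (barrier c R τ) := by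
  unfold barrier; fun_prop

lemma barrier_le {c : Euc N} {R τ : ℝ} (hτ : 0 ≤ τ) (x : Euc N) : barrier c R τ x ≤ τ := by
  unfold barrier
  have : 0 ≤ 16 * ‖x - c‖ ^ 2 / R ^ 2 := by positivity
  nlinarith

lemma barrier_nonpos {c : Euc N} {R τ : ℝ} (hR : 0 < R) (hτ : 0 ≤ τ) {x : Euc N}
    (hx : x ∉ ball c (R / 4)) : barrier c R τ x ≤ 0 := by
  unfold barrier
  rw [mem_ball, dist_eq_norm, not_lt] at hx
  have h1 : (R / 4) ^ 2 ≤ ‖x - c‖ ^ 2 := pow_le_pow_left₀ (by positivity) hx 2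
  have : 1 ≤ 16 * ‖x - c‖ ^ 2 / R ^ 2 := by
    rw [le_div_iff₀ (by positivity)]; nlinarith
  nlinarith

lemma le_barrier {c : Euc N} {R τ : ℝ} (hR : 0 < R) (hτ : 0 ≤ τ) {x : Euc N}
    (hx : x ∈ ball c (R / 8)) : 3 / 4 * τ ≤ barrier c R τ x := by
  unfold barrier
  rw [mem_ball, dist_eq_norm] at hx
  have h1 : ‖x - c‖ ^ 2 ≤ (R / 8) ^ 2 := pow_le_pow_left₀ (norm_nonneg _) hx.le 2
  have : 16 * ‖x - c‖ ^ 2 / R ^ 2 ≤ 1 / 4 := by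
    rw [div_le_iff₀ (by positivity)]; nlinarith
  nlinarith

lemma abs_barrier_sub_le {c : Euc N} {R τ : ℝ} (hR : 0 < R) (hτ : 0 ≤ τ) {x y : Euc N}
    (hx : ‖x - c‖ ≤ R) (hy : ‖y - c‖ ≤ R) :
    |barrier c R τ x - barrier c R τ y| ≤ min (32 * τ / R * ‖x - y‖) (16 * τ) := by
  have e : barrier c R τ x - barrier c R τ y =
      16 * τ / R ^ 2 * (‖y - c‖ ^ 2 - ‖x - c‖ ^ 2) := by
    unfold barrier; field_simp; ring
  rw [e, abs_mul, abs_of_nonneg (by positivity : 0 ≤ 16 * τ / R ^ 2)]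
  have hk : 0 ≤ 16 * τ / R ^ 2 := by positivity
  have hx0 := norm_nonneg (x - c)
  have hy0 := norm_nonneg (y - c)
  refine le_min ?_ ?_
  · have h1 : |‖y - c‖ - ‖x - c‖| ≤ ‖x - y‖ := by
      have := abs_norm_sub_norm_le (y - c) (x - c)
      rwa [sub_sub_sub_cancel_right, norm_sub_rev y x] at this
    have h2 : |‖y - c‖ ^ 2 - ‖x - c‖ ^ 2| ≤ 2 * R * ‖x - y‖ := by
      rw [sq_sub_sq, abs_mul, abs_of_nonneg (by positivity)]
      exact mul_le_mul (by linarith) h1 (abs_nonneg _) (by positivity)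
    calc 16 * τ / R ^ 2 * |‖y - c‖ ^ 2 - ‖x - c‖ ^ 2| ≤ 16 * τ / R ^ 2 * (2 * R * ‖x - y‖) :=
          mul_le_mul_of_nonneg_left h2 hk
      _ = 32 * τ / R * ‖x - y‖ := by field_simp; ring
  · have h2 : |‖y - c‖ ^ 2 - ‖x - c‖ ^ 2| ≤ R ^ 2 := by
      rw [abs_le]
      have := pow_le_pow_left₀ hx0 hx 2
      have := pow_le_pow_left₀ hy0 hy 2
      constructor <;> nlinarith
    calc 16 * τ / R ^ 2 * |‖y - c‖ ^ 2 - ‖x - c‖ ^ 2| ≤ 16 * τ / R ^ 2 * R ^ 2 :=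
          mul_le_mul_of_nonneg_left h2 hk
      _ = 16 * τ := by field_simp

/-- The reason for choosing a paraboloid: by the parallelogram law its second difference is
independent of x, so no Taylor expansion is needed. -/
lemma barrier_second_difference {c : Euc N} {R τ : ℝ} (x h : Euc N) :
    (barrier c R τ x - barrier c R τ (x - h)) - (barrier c R τ (x + h) - barrier c R τ x) =
      32 * τ * ‖h‖ ^ 2 / R ^ 2 := by
  have := parallelogram_law_with_norm ℝ (x - c) h
  unfold barrier
  rw [show x - h - c = x - c - h by abel, show x + h - c = x - c + h by abel]
  have e : ‖x - c - h‖ ^ 2 = 2 * (‖x - c‖ ^ 2 + ‖h‖ ^ 2) - ‖x - c + h‖ ^ 2 := by nlinarith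
  rw [e]; ring

variable {c : Euc N} {R τ μ : ℝ} {u : Euc N → ℝ}

lemma measurable_barrierExcess (hu : Measurable u) : Measurable (barrierExcess c R τ μ u) := by
  unfold barrierExcess
  have := measurable_barrier c R τ
  exact Measurable.indicator (by fun_prop) measurableSet_ball

lemma barrierExcess_nonneg (x : Euc N) : 0 ≤ barrierExcess c R τ μ u x :=
  indicator_nonneg (fun _ _ => le_max_right _ _) x

lemma barrierExcess_eq_zero {x : Euc N} (hx : x ∉ ball c (R / 4)) :
    barrierExcess c R τ μ u x = 0 := indicator_of_notMem hx _

/-- The cut-off at R/4 creates no jump: between R/4 and R the barrier is nonpositive and u - μ is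
nonnegative. -/
lemma barrierExcess_eq (hR : 0 < R) (hτ : 0 ≤ τ) (hu0 : ∀ x ∈ ball c R, μ ≤ u x) {x : Euc N}
    (hx : x ∈ ball c R) :
    barrierExcess c R τ μ u x = max (barrier c R τ x - (u x - μ)) 0 := by
  by_cases h : x ∈ ball c (R / 4)
  · exact indicator_of_mem h _
  · rw [barrierExcess_eq_zero h, max_eq_right]
    have := barrier_nonpos hR hτ h
    have := hu0 x hx
    linarith

lemma barrierExcess_le (hR : 0 < R) (hτ : 0 ≤ τ) (hu0 : ∀ x ∈ ball c R, μ ≤ u x) (x : Euc N) :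
    barrierExcess c R τ μ u x ≤ τ := by
  by_cases h : x ∈ ball c R
  · rw [barrierExcess_eq hR hτ hu0 h]
    have := barrier_le (c := c) (R := R) hτ x
    have := hu0 x h
    exact max_le (by linarith) hτ
  · rw [barrierExcess_eq_zero fun h' => h (ball_subset_ball (by linarith) h')]
    exact hτ

/-- Inside B_R this is the 1-Lipschitz property of the positive part. A partner outside B_R is at
distance at least 3R/4, and then the barrier term alone exceeds the maximum τ of the test function.
-/
lemma abs_barrierExcess_sub_le (hR : 0 < R) (hτ : 0 ≤ τ) (hu0 : ∀ x ∈ ball c R, μ ≤ u x)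
    {z : Euc N × Euc N} (hz : z ∈ cross (ball c (R / 4))) :
    |barrierExcess c R τ μ u z.1 - barrierExcess c R τ μ u z.2| ≤
      |u z.1 - u z.2| + min (32 * τ / R * ‖z.1 - z.2‖) (16 * τ) := by
  obtain ⟨x, y⟩ := z
  simp only
  have aux : ∀ x y : Euc N, x ∈ ball c (R / 4) →
      |barrierExcess c R τ μ u x - barrierExcess c R τ μ u y| ≤
      |u x - u y| + min (32 * τ / R * ‖x - y‖) (16 * τ) := by
    intro x y hx
    have hxR : x ∈ ball c R := ball_subset_ball (by linarith) hx
    by_cases hy : y ∈ ball c R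
    · rw [barrierExcess_eq hR hτ hu0 hxR, barrierExcess_eq hR hτ hu0 hy]
      rw [mem_ball, dist_eq_norm] at hxR hy
      refine (abs_max_sub_max_le_abs _ _ _).trans ?_
      have h1 := abs_barrier_sub_le hR hτ hxR.le hy.le
      have h2 := abs_sub (barrier c R τ x - barrier c R τ y) (u x - u y)
      rw [show barrier c R τ x - (u x - μ) - (barrier c R τ y - (u y - μ)) =
        (barrier c R τ x - barrier c R τ y) - (u x - u y) by ring]
      linarith
    · rw [barrierExcess_eq_zero fun h' => hy (ball_subset_ball (by linarith) h'), sub_zero,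
        abs_of_nonneg (barrierExcess_nonneg _)]
      have h1 := barrierExcess_le hR hτ hu0 x
      have hd : 3 / 4 * R ≤ ‖x - y‖ := by
        rw [mem_ball, dist_eq_norm] at hx hy
        have : ‖y - c‖ ≤ ‖x - c‖ + ‖x - y‖ := by
          have := norm_sub_le (x - c) (x - y)
          rwa [sub_sub_sub_cancel_left] at this
        linarith
      have h2 : τ ≤ 32 * τ / R * ‖x - y‖ := by
        calc τ ≤ 32 * τ / R * (3 / 4 * R) := by field_simp; linarith
          _ ≤ _ := mul_le_mul_of_nonneg_left hd (by positivity)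
      have h3 : τ ≤ min (32 * τ / R * ‖x - y‖) (16 * τ) := le_min h2 (by linarith)
      have := abs_nonneg (u x - u y)
      linarith
  rcases hz with hz | hz
  · exact aux x y hz
  · rw [abs_sub_comm, abs_sub_comm (u x), norm_sub_rev]
    exact aux y x hz

/-- Admissibility of the test function in `IsSupersol.le_form`. -/
lemma integrable_energyDensity_barrierExcess [NeZero N] {s m R₀ : ℝ} (hs0 : 0 < s) (hs1 : s < 1)
    (hm : 2 ≤ m) (hR : 0 < R) (hRR : R ≤ R₀) (hτ : 0 ≤ τ) (hu : Measurable u)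
    (hu0 : ∀ x ∈ ball c R, μ ≤ u x)
    (hue : IntegrableOn (energyDensity s m u) (cross (ball c R₀))) :
    Integrable (energyDensity s m (barrierExcess c R τ μ u)) := by
  have hsub : cross (ball c (R / 4)) ⊆ cross (ball c R₀) := by
    rintro z (h | h)
    · exact Or.inl (ball_subset_ball (by linarith) h)
    · exact Or.inr (ball_subset_ball (by linarith) h)
  have hG := integrableOn_cross_of_sub (integrable_min_rpow_div (N := N) (L := 32 * τ / R)
    (T := 16 * τ) hs0 hs1 hm (by positivity) (by positivity)) c (R / 4)
  have hon : IntegrableOn (energyDensity s m (barrierExcess c R τ μ u)) (cross (ball c (R / 4))) := by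
    refine Integrable.mono' (((hue.mono_set hsub).add hG).const_mul (2 ^ m))
      (measurable_energyDensity s m (measurable_barrierExcess hu)).aestronglyMeasurable
      ((ae_restrict_iff' (measurableSet_cross measurableSet_ball)).2 (ae_of_all _ fun z hz => ?_))
    rw [Real.norm_of_nonneg (energyDensity_nonneg _ _ _ _)]
    simp only [Pi.add_apply, energyDensity]
    rw [← add_div, ← mul_div_assoc]
    refine div_le_div_of_nonneg_right ?_ (by positivity)
    exact (Real.rpow_le_rpow (abs_nonneg _) (abs_barrierExcess_sub_le hR hτ hu0 hz)
      (by linarith)).trans (add_rpow_le (by linarith) (abs_nonneg _)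
        (le_min (by positivity) (by positivity)))
  rwa [integrableOn_iff_integrable_of_support_subset] at hon
  intro z hz
  by_contra h
  simp only [cross, mem_ofPred_eq, not_or] at h
  refine hz ?_
  simp only [energyDensity, barrierExcess_eq_zero h.1, barrierExcess_eq_zero h.2, sub_self, abs_zero]
  rw [Real.zero_rpow (by linarith), zero_div]

end Barrier

/-! ### The weak form tested with the barrier excess: nearby and distant pairs. -/

section FormEstimates

variable {N : ℕ} {c : Euc N} {R τ μ : ℝ} {u : Euc N → ℝ}

/-- Pairs of points at distance less than `δ`. -/
def nearDiag (N : ℕ) (δ : ℝ) : Set (Euc N × Euc N) := {z | ‖z.1 - z.2‖ < δ}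

lemma measurableSet_nearDiag (δ : ℝ) : MeasurableSet (nearDiag N δ) :=
  measurableSet_lt (by fun_prop) measurable_const

lemma mem_ball_of_near (hR : 0 < R) {z : Euc N × Euc N} (hz : z ∈ nearDiag N (R / 8))
    (hc : z ∈ cross (ball c (R / 4))) : z.1 ∈ ball c R ∧ z.2 ∈ ball c R := by
  obtain ⟨x, y⟩ := z
  simp only [nearDiag, mem_ofPred_eq, cross, mem_ball, dist_eq_norm] at hz hc ⊢
  have h1 : ‖x - c‖ ≤ ‖y - c‖ + ‖x - y‖ := by
    have := norm_add_le (y - c) (x - y)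
    rwa [show y - c + (x - y) = x - c by abel] at this
  have h2 : ‖y - c‖ ≤ ‖x - c‖ + ‖x - y‖ := by
    have := norm_sub_le (x - c) (x - y)
    rwa [sub_sub_sub_cancel_left] at this
  rcases hc with h | h <;> constructor <;> linarith

/-- The comparison step: nearby pairs that matter lie in B_R, where the test function is a genuine
positive part, so `J_mul_posPart_le` replaces u by the smooth barrier. -/
lemma formDensity_near_le {s m : ℝ} (hm : 2 ≤ m) (hR : 0 < R) (hτ : 0 ≤ τ)
    (hu0 : ∀ x ∈ ball c R, μ ≤ u x) {z : Euc N × Euc N} (hz : z ∈ nearDiag N (R / 8)) :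
    formDensity s m u (barrierExcess c R τ μ u) z ≤
      formDensity s m (barrier c R τ) (barrierExcess c R τ μ u) z := by
  by_cases hc : z ∈ cross (ball c (R / 4))
  · obtain ⟨h1, h2⟩ := mem_ball_of_near hR hz hc
    unfold formDensity
    rw [barrierExcess_eq hR hτ hu0 h1, barrierExcess_eq hR hτ hu0 h2]
    refine div_le_div_of_nonneg_right ?_ (by positivity)
    have := J_mul_posPart_le (m := m) (a := u z.1 - μ) (b := u z.2 - μ) (c := barrier c R τ z.1)
      (d := barrier c R τ z.2) hm
    rwa [sub_sub_sub_cancel_right] at this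
  · rw [formDensity_eq_zero (fun x => barrierExcess_eq_zero) s m _ hc,
      formDensity_eq_zero (fun x => barrierExcess_eq_zero) s m _ hc]

lemma integrableOn_formDensity_barrier [NeZero N] {s m : ℝ} (hs0 : 0 < s) (hs1 : s < 1)
    (hm : 2 ≤ m) (hR : 0 < R) (hτ : 0 ≤ τ) (hu : Measurable u)
    (hψe : Integrable (energyDensity s m (barrierExcess c R τ μ u))) :
    IntegrableOn (formDensity s m (barrier c R τ) (barrierExcess c R τ μ u))
      (nearDiag N (R / 8)) := by
  have hG := (integrable_indicator_iff (measurableSet_cross measurableSet_ball)).2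
    (integrableOn_cross_of_sub (integrable_min_rpow_div (N := N) (L := 32 * τ / R)
    (T := 16 * τ) hs0 hs1 hm (by positivity) (by positivity)) c (R / 4))
  have hfm := measurable_formDensity s m (measurable_barrier c R τ)
    (measurable_barrierExcess (c := c) (R := R) (τ := τ) (μ := μ) hu)
  refine Integrable.mono' (hG.add hψe).integrableOn hfm.aestronglyMeasurable
    ((ae_restrict_iff' (measurableSet_nearDiag _)).2 (ae_of_all _ fun z hz => ?_))
  simp only [Pi.add_apply]
  by_cases hc : z ∈ cross (ball c (R / 4))
  · obtain ⟨h1, h2⟩ := mem_ball_of_near hR hz hc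
    rw [mem_ball, dist_eq_norm] at h1 h2
    rw [indicator_of_mem hc]
    have := abs_formDensity_le hm one_pos (barrier c R τ) (barrierExcess c R τ μ u) (s := s) z
    rw [one_mul, Real.one_rpow, one_mul] at this
    refine this.trans (add_le_add_left ?_ _)
    unfold energyDensity
    refine div_le_div_of_nonneg_right ?_ (by positivity)
    exact Real.rpow_le_rpow (abs_nonneg _) (abs_barrier_sub_le hR hτ h1.le h2.le) (by linarith)
  · rw [formDensity_eq_zero (fun x => barrierExcess_eq_zero) s m _ hc, norm_zero,
      indicator_of_notMem hc, zero_add]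
    exact energyDensity_nonneg _ _ _ _

/-- The second-order estimate: for a fixed increment, the difference quotient terms of the barrier
are of order `‖h‖^m`. -/
lemma integral_J_barrier_le {m : ℝ} (hm : 2 ≤ m) (hR : 0 < R) (hτ : 0 ≤ τ) (hu : Measurable u)
    (hu0 : ∀ x ∈ ball c R, μ ≤ u x) {h : Euc N} (hh : ‖h‖ < R / 8) :
    ∫ y, J m (barrier c R τ (h + y) - barrier c R τ y) *
        (barrierExcess c R τ μ u (h + y) - barrierExcess c R τ μ u y) ≤
      (m - 1) * (32 * τ) ^ (m - 1) * R ^ (-m) * ‖h‖ ^ m * ∫ y, barrierExcess c R τ μ u y := by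
  set w := barrier c R τ with hw
  set ψ := barrierExcess c R τ μ u with hψ
  have hwm : Measurable w := measurable_barrier c R τ
  have hψm : Measurable ψ := measurable_barrierExcess hu
  have hJm := measurable_J m
  have hψB : ∀ y, |ψ y| ≤ τ := fun y => by
    rw [abs_of_nonneg (barrierExcess_nonneg _)]; exact barrierExcess_le hR hτ hu0 y
  have hψ0 : ∀ y ∉ ball c (R / 4), ψ y = 0 := fun y => barrierExcess_eq_zero
  have hψi : Integrable ψ := integrable_of_bdd_of_support hψm hψB hψ0
  have hL : ∀ k : Euc N, ‖k‖ < R / 8 → ∀ y ∈ ball c (R / 4),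
      |w (y + k) - w y| ≤ 32 * τ / R * ‖k‖ := by
    intro k hk y hy
    rw [mem_ball, dist_eq_norm] at hy
    have h1 : ‖y + k - c‖ ≤ R := by
      calc ‖y + k - c‖ = ‖(y - c) + k‖ := by congr 1; abel
        _ ≤ ‖y - c‖ + ‖k‖ := norm_add_le _ _
        _ ≤ R := by linarith
    have := (abs_barrier_sub_le hR hτ h1 (by linarith : ‖y - c‖ ≤ R)).trans (min_le_left _ _)
    rwa [add_sub_cancel_left] at this
  have hint : ∀ k : Euc N, ‖k‖ < R / 8 → Integrable fun y => ψ y * J m (w (y + k) - w y) := by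
    intro k hk
    refine integrable_of_bdd_of_support (c := c) (r := R / 4)
      (B := τ * (32 * τ / R * ‖k‖) ^ (m - 1)) (by fun_prop) (fun y => ?_)
      (fun y hy => by rw [hψ0 y hy, zero_mul])
    by_cases hy : y ∈ ball c (R / 4)
    · rw [abs_mul, abs_J hm]
      exact mul_le_mul (hψB y) (Real.rpow_le_rpow (abs_nonneg _) (hL k hk y hy) (by linarith))
        (by positivity) hτ
    · rw [hψ0 y hy, zero_mul, abs_zero]; positivity
  have hneg : ‖-h‖ < R / 8 := by rwa [norm_neg]
  have e1 : Integrable fun y => ψ (h + y) * J m (w (h + y) - w y) := by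
    have := ((hint (-h) hneg).neg).comp_add_left h
    refine this.congr (ae_of_all _ fun y => ?_)
    simp only [Pi.neg_apply]
    rw [show h + y + -h = y by abel, ← mul_neg, ← J_neg, neg_sub]
  have e2 : ∫ y, ψ (h + y) * J m (w (h + y) - w y) = ∫ y, ψ y * J m (w y - w (y - h)) := by
    rw [← integral_add_left_eq_self (fun y => ψ y * J m (w y - w (y - h))) h]
    congr 1; ext y
    rw [add_sub_cancel_left]
  have e3 : Integrable fun y => ψ y * J m (w y - w (y - h)) := by
    refine ((hint (-h) hneg).neg).congr (ae_of_all _ fun y => ?_)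
    simp only [Pi.neg_apply]
    rw [← mul_neg, ← J_neg, neg_sub, sub_eq_add_neg y h]
  calc ∫ y, J m (w (h + y) - w y) * (ψ (h + y) - ψ y)
      = ∫ y, (ψ (h + y) * J m (w (h + y) - w y) - ψ y * J m (w (y + h) - w y)) := by
        congr 1; ext y; rw [add_comm y h]; ring
    -- Summation by parts: translating the first half by h moves the difference from ψ onto
    -- consecutive increments of w.
    _ = ∫ y, (ψ y * J m (w y - w (y - h)) - ψ y * J m (w (y + h) - w y)) := by
        rw [integral_sub e1 (hint h hh), e2, integral_sub e3 (hint h hh)]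
    _ ≤ ∫ y, ((m - 1) * (32 * τ) ^ (m - 1) * R ^ (-m) * ‖h‖ ^ m) * ψ y := by
        refine integral_mono (e3.sub (hint h hh)) (hψi.const_mul _) fun y => ?_
        simp only
        rw [← mul_sub, mul_comm _ (ψ y)]
        by_cases hy : y ∈ ball c (R / 4)
        · refine mul_le_mul_of_nonneg_left ?_ (barrierExcess_nonneg y)
          -- Both increments are at most 32τ‖h‖/R and differ by 32τ‖h‖²/R². The local Lipschitz
          -- bound for J_m therefore yields the order ‖h‖^m, which is integrable against the kernel
          -- at the origin.
          have hb := hL h hh y hy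
          have ha := hL (-h) hneg y hy
          rw [norm_neg, abs_sub_comm, ← sub_eq_add_neg] at ha
          have hk := abs_J_sub_le hm (by positivity) ha hb
          rw [hw, barrier_second_difference, ← hw] at hk
          refine (le_abs_self _).trans (hk.trans (le_of_eq ?_))
          rw [abs_of_nonneg (by positivity)]
          rcases (norm_nonneg h).eq_or_lt with h0 | h0
          · rw [← h0, Real.zero_rpow (by linarith)]; ring
          · rcases hτ.eq_or_lt with t0 | t0
            · rw [← t0]; simp [Real.zero_rpow (by linarith : m - 1 ≠ 0)]
            · have q1 : 32 * τ * ‖h‖ ^ 2 / R ^ 2 = (32 * τ) * (‖h‖ / R) ^ (2 : ℝ) := by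
                rw [Real.rpow_two]; field_simp
              have q2 : 32 * τ / R * ‖h‖ = (32 * τ) * (‖h‖ / R) := by ring
              rw [q1, q2, Real.mul_rpow (by positivity) (by positivity), Real.rpow_neg hR.le]
              have q3 : (32 * τ) ^ (m - 2) * (32 * τ) = (32 * τ) ^ (m - 1) := by
                rw [← Real.rpow_add_one (by positivity)]; congr 1; ring
              have q4 : (‖h‖ / R) ^ (m - 2) * (‖h‖ / R) ^ (2 : ℝ) = ‖h‖ ^ m * (R ^ m)⁻¹ := by
                rw [← Real.rpow_add (by positivity), sub_add_cancel,
                  Real.div_rpow h0.le hR.le, div_eq_mul_inv]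
              calc _ = (m - 1) * ((32 * τ) ^ (m - 2) * (32 * τ)) *
                    ((‖h‖ / R) ^ (m - 2) * (‖h‖ / R) ^ (2 : ℝ)) := by ring
                _ = _ := by rw [q3, q4]; ring
        · rw [hψ0 y hy, zero_mul, zero_mul]
    _ = _ := integral_const_mul _ _

/-- Fixes the increment and integrates over the base point first, because the cancellation between h
and -h appears only after that integration. -/
lemma integral_eq_integral_add_prod {F : Euc N × Euc N → ℝ} (hF : Integrable F) :
    Integrable (fun h => ∫ y, F (h + y, y)) ∧ ∫ z, F z = ∫ h, ∫ y, F (h + y, y) := by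
  have hmp := measurePreserving_add_prod (volume : Measure (Euc N)) (volume : Measure (Euc N))
  have hFi := hmp.integrable_comp_of_integrable hF
  refine ⟨hFi.integral_prod_left, ?_⟩
  have := integral_map (μ := (volume : Measure (Euc N)).prod volume) hmp.measurable.aemeasurable
    (f := F) (by rw [hmp.map_eq]; exact hF.aestronglyMeasurable)
  rw [hmp.map_eq] at this
  exact this.trans (integral_prod _ hFi)

/-- The contribution of nearby points to the form of the barrier. -/
lemma integral_near_barrier_le [NeZero N] {s m : ℝ} (hs0 : 0 < s) (hs1 : s < 1)
    (hm : 2 ≤ m) (hR : 0 < R) (hτ : 0 ≤ τ) (hu : Measurable u) (hu0 : ∀ x ∈ ball c R, μ ≤ u x)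
    (hψe : Integrable (energyDensity s m (barrierExcess c R τ μ u))) :
    ∫ z in nearDiag N (R / 8), formDensity s m (barrier c R τ) (barrierExcess c R τ μ u) z ≤
      (m - 1) * 32 ^ (m - 1) * (sphereConst N / (m - s * m)) * τ ^ (m - 1) * R ^ (-(s * m)) *
        ∫ y, barrierExcess c R τ μ u y := by
  set w := barrier c R τ with hw
  set ψ := barrierExcess c R τ μ u with hψ
  set I := ∫ y, ψ y with hI
  have hI0 : 0 ≤ I := integral_nonneg fun y => barrierExcess_nonneg y
  have hsm : 0 < m - s * m := by nlinarith
  have hon := integrableOn_formDensity_barrier hs0 hs1 hm hR hτ hu hψe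
  rw [← integral_indicator (measurableSet_nearDiag _)]
  obtain ⟨hi, he⟩ := integral_eq_integral_add_prod
    ((integrable_indicator_iff (measurableSet_nearDiag _)).2 hon)
  rw [he]
  set A := (m - 1) * (32 * τ) ^ (m - 1) * R ^ (-m) with hA
  have hA0 : 0 ≤ A := mul_nonneg (mul_nonneg (by linarith) (by positivity)) (by positivity)
  have hker := (integrable_indicator_iff measurableSet_ball).2
    (integrableOn_norm_rpow_near (N := N) hsm (by positivity : 0 < R / 8))
  calc _ ≤ ∫ h : Euc N, A * I * (ball (0 : Euc N) (R / 8)).indicator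
          (fun h => ‖h‖ ^ ((m - s * m) - N)) h := by
        refine integral_mono hi (hker.const_mul _) fun h => ?_
        simp only
        by_cases hh : ‖h‖ < R / 8
        · have hmem : ∀ y, (h + y, y) ∈ nearDiag N (R / 8) := fun y => by
            simpa [nearDiag] using hh
          simp_rw [indicator_of_mem (hmem _)]
          rw [indicator_of_mem (by simpa using hh)]
          simp only [formDensity, add_sub_cancel_right]
          rw [integral_div]
          rcases (norm_nonneg h).eq_or_lt with h0 | h0
          · rw [norm_eq_zero.1 h0.symm]
            simp only [zero_add, sub_self, J_zero, zero_mul, integral_zero, zero_div]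
            positivity
          · rw [← norm_rpow_div_eq h0, ← mul_div_assoc]
            refine div_le_div_of_nonneg_right ?_ (by positivity)
            refine (integral_J_barrier_le hm hR hτ hu hu0 hh).trans (le_of_eq ?_)
            ring
        · have hmem : ∀ y, (h + y, y) ∉ nearDiag N (R / 8) := fun y => by
            simpa [nearDiag] using hh
          simp_rw [indicator_of_notMem (hmem _)]
          rw [indicator_of_notMem (by simpa using hh)]
          simp
    _ = A * I * (sphereConst N / (m - s * m) * (R / 8) ^ (m - s * m)) := by
        rw [integral_const_mul, integral_indicator measurableSet_ball,
          integral_norm_rpow_near hsm (by positivity)]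
    _ ≤ A * I * (sphereConst N / (m - s * m) * R ^ (m - s * m)) := by
        have := sphereConst_pos (N := N)
        have : (R / 8) ^ (m - s * m) ≤ R ^ (m - s * m) :=
          Real.rpow_le_rpow (by positivity) (by linarith) hsm.le
        gcongr
    _ = _ := by
        rw [hA, Real.mul_rpow (by norm_num) hτ]
        have : R ^ (-m) * R ^ (m - s * m) = R ^ (-(s * m)) := by
          rw [← Real.rpow_add hR]; congr 1; ring
        rw [← this]; ring

/-- The contribution of distant points, reduced to the points of positivity of the test function. -/
lemma integral_far_le [NeZero N] {s m M b δ : ℝ} {ψ : Euc N → ℝ} (hs0 : 0 < s) (hm : 2 ≤ m)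
    (hδ : 0 < δ) (hu : Measurable u) (hM : ∀ x, |u x| ≤ M) (hψ : Measurable ψ)
    (hψi : Integrable ψ) (hψ0 : ∀ x, 0 ≤ ψ x)
    (hb : ∀ x, 0 < ψ x → ∫ y in (ball x δ)ᶜ, J m (u x - u y) / ‖x - y‖ ^ ((N : ℝ) + s * m) ≤ b) :
    ∫ z in (nearDiag N δ)ᶜ, formDensity s m u ψ z ≤ 2 * b * ∫ x, ψ x := by
  let F : Euc N × Euc N → ℝ := (nearDiag N δ)ᶜ.indicator
    fun z => ψ z.1 * (J m (u z.1 - u z.2) / ‖z.1 - z.2‖ ^ ((N : ℝ) + s * m))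
  have hJm := measurable_J m
  have hFm : Measurable F := Measurable.indicator (by fun_prop) (measurableSet_nearDiag _).compl
  have hker := (integrable_indicator_iff measurableSet_ball.compl).2
    (integrableOn_norm_rpow_far (N := N) (a := s * m) (by positivity) hδ)
  have hJb : ∀ x y, |J m (u x - u y)| ≤ (2 * M) ^ (m - 1) := fun x y => by
    rw [abs_J hm]
    refine Real.rpow_le_rpow (abs_nonneg _) ?_ (by linarith)
    have := abs_sub (u x) (u y)
    have := hM x
    have := hM y
    linarith
  have hF : Integrable F := by
    refine Integrable.mono' ((integrable_prod_of_sub hψi hker).const_mul ((2 * M) ^ (m - 1)))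
      hFm.aestronglyMeasurable (ae_of_all _ fun z => ?_)
    by_cases hz : z ∈ nearDiag N δ
    · have h1 : F z = 0 := indicator_of_notMem (by simpa using hz) _
      have h2 : z.1 - z.2 ∉ (ball (0 : Euc N) δ)ᶜ := by simpa [nearDiag] using hz
      rw [h1, indicator_of_notMem h2]; simp
    · have h1 : F z = ψ z.1 * (J m (u z.1 - u z.2) / ‖z.1 - z.2‖ ^ ((N : ℝ) + s * m)) :=
        indicator_of_mem (by simpa using hz) _
      have h2 : z.1 - z.2 ∈ (ball (0 : Euc N) δ)ᶜ := by simpa [nearDiag] using hz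
      rw [h1, indicator_of_mem h2, norm_mul, Real.norm_of_nonneg (hψ0 _), norm_div,
        Real.norm_of_nonneg (Real.rpow_nonneg (norm_nonneg _) _), ← one_div_rpow_eq (norm_nonneg _)]
      calc ψ z.1 * (‖J m (u z.1 - u z.2)‖ / ‖z.1 - z.2‖ ^ ((N : ℝ) + s * m))
          ≤ ψ z.1 * ((2 * M) ^ (m - 1) / ‖z.1 - z.2‖ ^ ((N : ℝ) + s * m)) := by
            refine mul_le_mul_of_nonneg_left (div_le_div_of_nonneg_right (hJb _ _) ?_) (hψ0 _)
            positivity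
        _ = _ := by ring
  -- Oddness of J_m splits the density into two mirror halves. This gives the factor 2 and leaves ψ
  -- evaluated at one point only.
  have hswap : ∀ z, (nearDiag N δ)ᶜ.indicator (formDensity s m u ψ) z = F z + F z.swap := by
    intro z
    by_cases hz : z ∈ nearDiag N δ
    · have hz' : z.swap ∈ nearDiag N δ := by
        simp only [nearDiag, mem_ofPred_eq, Prod.fst_swap, Prod.snd_swap] at hz ⊢
        rwa [norm_sub_rev]
      simp only [F]
      rw [indicator_of_notMem (by simpa using hz), indicator_of_notMem (by simpa using hz),
        indicator_of_notMem (by simpa using hz'), add_zero]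
    · have hz' : z.swap ∉ nearDiag N δ := by
        simp only [nearDiag, mem_ofPred_eq, Prod.fst_swap, Prod.snd_swap] at hz ⊢
        rwa [norm_sub_rev]
      simp only [F]
      rw [indicator_of_mem (by simpa using hz), indicator_of_mem (by simpa using hz),
        indicator_of_mem (by simpa using hz')]
      simp only [Prod.fst_swap, Prod.snd_swap, formDensity]
      rw [norm_sub_rev z.2 z.1, ← neg_sub (u z.1) (u z.2), J_neg]
      ring
  rw [← integral_indicator (measurableSet_nearDiag _).compl]
  simp_rw [hswap]
  have esum : ∫ z, (F z + F z.swap) = (∫ z, F z) + ∫ z : Euc N × Euc N, F z.swap :=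
    integral_add hF hF.swap
  rw [esum]
  have e1 : ∫ z : Euc N × Euc N, F z.swap = ∫ z, F z :=
    integral_prod_swap (μ := volume) (ν := volume) F
  have e2 : ∫ z, F z ≤ b * ∫ x, ψ x := by
    calc ∫ z, F z = ∫ x, ∫ y, F (x, y) := integral_prod _ hF
      _ ≤ ∫ x, b * ψ x := by
        refine integral_mono hF.integral_prod_left (hψi.const_mul b) fun x => ?_
        have hFx : ∀ y, F (x, y) = ψ x * (ball x δ)ᶜ.indicator
            (fun y => J m (u x - u y) / ‖x - y‖ ^ ((N : ℝ) + s * m)) y := by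
          intro y
          by_cases hz : ‖x - y‖ < δ
          · have h1 : (x, y) ∉ (nearDiag N δ)ᶜ := by simpa [nearDiag] using hz
            have h2 : y ∉ (ball x δ)ᶜ := by
              rw [norm_sub_rev] at hz
              simpa [dist_eq_norm] using hz
            simp only [F]
            rw [indicator_of_notMem h1, indicator_of_notMem h2, mul_zero]
          · have h1 : (x, y) ∈ (nearDiag N δ)ᶜ := by simpa [nearDiag] using hz
            have h2 : y ∈ (ball x δ)ᶜ := by
              rw [norm_sub_rev] at hz
              simpa [dist_eq_norm] using hz
            simp only [F]
            rw [indicator_of_mem h1, indicator_of_mem h2]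
        simp only
        simp_rw [hFx]
        rw [integral_const_mul, integral_indicator measurableSet_ball.compl, mul_comm b]
        rcases (hψ0 x).eq_or_lt with h0 | h0
        · rw [← h0, zero_mul, zero_mul]
        · exact mul_le_mul_of_nonneg_left (hb x h0) h0.le
      _ = b * ∫ x, ψ x := integral_const_mul _ _
  rw [e1]
  linarith

/-- The weak form tested with the excess of the barrier. -/
lemma form_barrierExcess_le [NeZero N] {s m M b R₀ : ℝ} (hs0 : 0 < s) (hs1 : s < 1)
    (hm : 2 ≤ m) (hR : 0 < R) (hRR : R ≤ R₀) (hτ : 0 ≤ τ) (hu : Measurable u)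
    (hM : ∀ x, |u x| ≤ M) (hu0 : ∀ x ∈ ball c R, μ ≤ u x)
    (hue : IntegrableOn (energyDensity s m u) (cross (ball c R₀)))
    (hb : ∀ x ∈ ball c (R / 4), u x - μ < τ →
      ∫ y in (ball x (R / 8))ᶜ, J m (u x - u y) / ‖x - y‖ ^ ((N : ℝ) + s * m) ≤ b) :
    form s m u (barrierExcess c R τ μ u) ≤
      ((m - 1) * 32 ^ (m - 1) * (sphereConst N / (m - s * m)) * τ ^ (m - 1) * R ^ (-(s * m)) +
        2 * b) * ∫ y, barrierExcess c R τ μ u y := by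
  have hψm : Measurable (barrierExcess c R τ μ u) := measurable_barrierExcess hu
  have hψB : ∀ y, |barrierExcess c R τ μ u y| ≤ τ := fun y => by
    rw [abs_of_nonneg (barrierExcess_nonneg _)]; exact barrierExcess_le hR hτ hu0 y
  have hψi := integrable_of_bdd_of_support hψm hψB fun y => barrierExcess_eq_zero
  have hψe := integrable_energyDensity_barrierExcess hs0 hs1 hm hR hRR hτ hu hu0 hue
  have hf := integrable_formDensity hm measurableSet_ball hu hψm
    (fun x hx => barrierExcess_eq_zero fun h => hx (ball_subset_ball (by linarith) h)) hue hψe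
  have hsplit := integral_add_compl (measurableSet_nearDiag (N := N) (R / 8)) hf
  have hfar := integral_far_le hs0 hm (by positivity : 0 < R / 8) hu hM hψm hψi
    barrierExcess_nonneg (b := b) (s := s) (fun x hx => by
      have hxb : x ∈ ball c (R / 4) := by
        by_contra h
        rw [barrierExcess_eq_zero h] at hx
        exact lt_irrefl _ hx
      refine hb x hxb ?_
      rw [barrierExcess_eq hR hτ hu0 (ball_subset_ball (by linarith) hxb), lt_max_iff] at hx
      have := barrier_le (c := c) (R := R) hτ x
      rcases hx with hx | hx
      · linarith
      · exact absurd hx (lt_irrefl _))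
  have hnear : ∫ z in nearDiag N (R / 8), formDensity s m u (barrierExcess c R τ μ u) z ≤
      ∫ z in nearDiag N (R / 8), formDensity s m (barrier c R τ) (barrierExcess c R τ μ u) z :=
    setIntegral_mono_on hf.integrableOn
      (integrableOn_formDensity_barrier hs0 hs1 hm hR hτ hu hψe) (measurableSet_nearDiag _)
      fun z hz => formDensity_near_le hm hR hτ hu0 hz
  have hnear2 := integral_near_barrier_le hs0 hs1 hm hR hτ hu hu0 hψe
  have : form s m u (barrierExcess c R τ μ u) =
    ∫ z, formDensity s m u (barrierExcess c R τ μ u) z := rfl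
  rw [this, ← hsplit, add_mul]
  exact add_le_add (hnear.trans hnear2) hfar

end FormEstimates

/-! ### The growth lemma: gain from the large set against losses from the barrier and the tails. -/

section Growth

variable {N : ℕ}

lemma integrableOn_norm_sub_rpow_far [NeZero N] {a r : ℝ} (ha : 0 < a) (hr : 0 < r) (x : Euc N) :
    IntegrableOn (fun y => ‖x - y‖ ^ (-((N : ℝ) + a))) (ball x r)ᶜ := by
  rw [← integrable_indicator_iff measurableSet_ball.compl]
  have := ((integrable_indicator_iff measurableSet_ball.compl).2
    (integrableOn_norm_rpow_far (N := N) ha hr)).comp_sub_left x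
  refine this.congr (ae_of_all _ fun y => ?_)
  simp [indicator, dist_eq_norm, norm_sub_rev]

lemma integral_norm_sub_rpow_far [NeZero N] {a r : ℝ} (ha : 0 < a) (hr : 0 < r) (x : Euc N) :
    ∫ y in (ball x r)ᶜ, ‖x - y‖ ^ (-((N : ℝ) + a)) = sphereConst N / a * r ^ (-a) := by
  rw [← integral_norm_rpow_far ha hr, ← integral_indicator measurableSet_ball.compl,
    ← integral_indicator measurableSet_ball.compl, ← integral_sub_left_eq_self _ volume x]
  congr 1; ext y
  simp [indicator, dist_eq_norm']

/-- The `(m-1)`-st power of the tail of order `m`, without the scaling factor. -/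
noncomputable def rawTail (s m : ℝ) (u : Euc N → ℝ) (c : Euc N) (R : ℝ) : ℝ :=
  ∫ y in (ball c R)ᶜ, |u y| ^ (m - 1) / ‖c - y‖ ^ ((N : ℝ) + s * m)

lemma rawTail_nonneg (s m : ℝ) (u : Euc N → ℝ) (c : Euc N) (R : ℝ) : 0 ≤ rawTail s m u c R :=
  integral_nonneg fun y => by positivity

lemma integrableOn_rawTail [NeZero N] {s m M R : ℝ} (hs0 : 0 < s) (hm : 2 ≤ m) (hR : 0 < R)
    {u : Euc N → ℝ} (hu : Measurable u) (hM : ∀ x, |u x| ≤ M) (c : Euc N) :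
    IntegrableOn (fun y => |u y| ^ (m - 1) / ‖c - y‖ ^ ((N : ℝ) + s * m)) (ball c R)ᶜ := by
  refine Integrable.mono' ((integrableOn_norm_sub_rpow_far (a := s * m) (by positivity) hR
    c).const_mul (M ^ (m - 1)))
    (Measurable.aestronglyMeasurable (by fun_prop)) (ae_of_all _ fun y => ?_)
  rw [Real.norm_of_nonneg (by positivity), ← one_div_rpow_eq (norm_nonneg _), mul_one_div]
  exact div_le_div_of_nonneg_right (Real.rpow_le_rpow (abs_nonneg _) (hM y) (by linarith))
    (by positivity)

/-- The constant of the gain from the set where `u` is large. -/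
noncomputable def gainConst (N : ℕ) (s m g : ℝ) : ℝ := (1 / 4) ^ (m - 1) * g * 2 ^ (-((N : ℝ) + s * m))

/-- The constant of the losses from the barrier and from intermediate distances. -/
noncomputable def lossConst (N : ℕ) (s m : ℝ) : ℝ :=
  (m - 1) * 32 ^ (m - 1) * (sphereConst N / (m - s * m)) + 2 * (8 ^ (s * m) * (sphereConst N / s))

/-- The losses from large distances. -/
noncomputable def remoteLoss (s m : ℝ) (u : Euc N → ℝ) (c : Euc N) (R₀ A : ℝ) : ℝ :=
  2 ^ (m - 1) * 2 ^ ((N : ℝ) + s * m) *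
    ((2 * A) ^ (m - 1) * (sphereConst N / (s * m)) * R₀ ^ (-(s * m)) + rawTail s m u c R₀)

variable {c : Euc N} {R R₀ σ ω δ μ A M g : ℝ} {u : Euc N → ℝ}

/-- The set of points of the annulus at which `u` is large. -/
def largeSet (c : Euc N) (R μ ω : ℝ) (u : Euc N → ℝ) : Set (Euc N) :=
  (ball c R \ ball c (R / 2)) ∩ {y | μ + ω / 2 ≤ u y}

lemma measurableSet_largeSet (hu : Measurable u) : MeasurableSet (largeSet c R μ ω u) :=
  (measurableSet_ball.diff measurableSet_ball).inter (measurableSet_le measurable_const hu)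

/-- One summand per region: the large set, the rest of B_{R₀}, and the exterior. In the middle
region u may drop below μ like the power s of the distance; then s(m-1) - (N+sm) = -(N+s) for every
m, still integrable at infinity. -/
lemma J_far_pointwise_le {s m : ℝ} (hs0 : 0 < s) (hm : 2 ≤ m) (hR : 0 < R)
    (hRR : R ≤ R₀) (hω : 0 ≤ ω) (hσ : 0 ≤ σ) (hσ4 : σ ≤ 1 / 4) (hδ : 0 ≤ δ)
    (hu0 : ∀ x ∈ ball c R, μ ≤ u x)
    (hu1 : ∀ y ∈ ball c R₀, y ∉ ball c R → μ - ω * δ * (‖y - c‖ / R) ^ s ≤ u y)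
    (hμ : |μ| ≤ A) (hωA : ω ≤ A) {x : Euc N} (hx : x ∈ ball c (R / 4)) (hxσ : u x - μ < σ * ω)
    {y : Euc N} (hy : y ∈ (ball x (R / 8))ᶜ) :
    J m (u x - u y) / ‖x - y‖ ^ ((N : ℝ) + s * m) ≤
      (largeSet c R μ ω u).indicator (fun _ => -((ω / 4) ^ (m - 1) * (2 * R) ^ (-((N : ℝ) + s * m)))) y
      + (ω * (σ + δ)) ^ (m - 1) * (8 / R) ^ (s * (m - 1)) * ‖x - y‖ ^ (-((N : ℝ) + s))
      + (ball c R₀)ᶜ.indicator (fun y => 2 ^ (m - 1) * 2 ^ ((N : ℝ) + s * m) *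
          ((2 * A) ^ (m - 1) * ‖c - y‖ ^ (-((N : ℝ) + s * m)) +
            |u y| ^ (m - 1) / ‖c - y‖ ^ ((N : ℝ) + s * m))) y := by
  set ν : ℝ := (N : ℝ) + s * m with hν
  have hν0 : 0 ≤ ν := by positivity
  have hA : 0 ≤ A := hω.trans hωA
  set d := ‖x - y‖ with hd
  have hyd : R / 8 ≤ d := by
    rw [mem_compl_iff, mem_ball, dist_eq_norm, not_lt, norm_sub_rev] at hy; exact hy
  have hd0 : 0 < d := by linarith
  rw [mem_ball, dist_eq_norm] at hx
  have htri : ‖y - c‖ ≤ d + ‖x - c‖ := by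
    have := norm_sub_le (x - c) (x - y)
    rw [sub_sub_sub_cancel_left] at this
    linarith
  have htri2 : d ≤ ‖y - c‖ + ‖x - c‖ := by
    have := norm_sub_le (x - c) (y - c)
    rw [sub_sub_sub_cancel_right] at this
    linarith
  have hsecond : 0 ≤ (ω * (σ + δ)) ^ (m - 1) * (8 / R) ^ (s * (m - 1)) * d ^ (-((N : ℝ) + s)) := by
    positivity
  by_cases hy0 : y ∈ ball c R₀
  · rw [indicator_of_notMem (by simpa using hy0) (s := (ball c R₀)ᶜ), add_zero]
    by_cases hG : y ∈ largeSet c R μ ω u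
    · rw [indicator_of_mem hG]
      have h1 : u x - u y ≤ -(ω / 4) := by
        have := hG.2
        simp only [mem_ofPred_eq] at this
        nlinarith
      have h2 : J m (u x - u y) ≤ -(ω / 4) ^ (m - 1) := by
        rw [← J_of_nonneg hm (by positivity), ← J_neg]
        exact monotone_J hm h1
      have h3 : d ≤ 2 * R := by
        have := hG.1.1
        rw [mem_ball, dist_eq_norm] at this
        linarith
      have h4 : (2 * R) ^ (-ν) ≤ d ^ (-ν) :=
        Real.rpow_le_rpow_of_nonpos hd0 h3 (by linarith)
      have h5 : J m (u x - u y) / d ^ ν ≤ -((ω / 4) ^ (m - 1) * (2 * R) ^ (-ν)) := by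
        rw [div_eq_mul_inv, ← Real.rpow_neg hd0.le]
        have h6 : (ω / 4) ^ (m - 1) * (2 * R) ^ (-ν) ≤ (ω / 4) ^ (m - 1) * d ^ (-ν) :=
          mul_le_mul_of_nonneg_left h4 (by positivity)
        have h7 : J m (u x - u y) * d ^ (-ν) ≤ -(ω / 4) ^ (m - 1) * d ^ (-ν) :=
          mul_le_mul_of_nonneg_right h2 (by positivity)
        linarith
      linarith
    · rw [indicator_of_notMem hG, zero_add]
      -- The excluded ball has radius R/8, so constants can be absorbed into powers of 8d/R; this
      -- merges the σ and δ contributions.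
      have hone : 1 ≤ 8 / R * d := by
        rw [div_mul_eq_mul_div, le_div_iff₀ hR]; linarith
      have hones : 1 ≤ (8 / R * d) ^ s := Real.one_le_rpow hone hs0.le
      have h1 : u x - u y ≤ ω * (σ + δ) * (8 / R * d) ^ s := by
        have hσω : 0 ≤ σ * ω := by positivity
        have hδω : 0 ≤ ω * δ := by positivity
        have k1 : σ * ω ≤ σ * ω * (8 / R * d) ^ s := le_mul_of_one_le_right hσω hones
        by_cases hyR : y ∈ ball c R
        · have := hu0 y hyR
          have : 0 ≤ ω * δ * (8 / R * d) ^ s := by positivity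
          linarith
        · have := hu1 y hy0 hyR
          have k2 : ‖y - c‖ / R ≤ 8 / R * d := by
            rw [div_mul_eq_mul_div]
            exact div_le_div_of_nonneg_right (by linarith) hR.le
          have k3 : ω * δ * (‖y - c‖ / R) ^ s ≤ ω * δ * (8 / R * d) ^ s :=
            mul_le_mul_of_nonneg_left (Real.rpow_le_rpow (by positivity) k2 hs0.le) hδω
          linarith
      have h2 : J m (u x - u y) ≤ (ω * (σ + δ) * (8 / R * d) ^ s) ^ (m - 1) := by
        rw [← J_of_nonneg hm (by positivity)]
        exact monotone_J hm h1
      refine (div_le_div_of_nonneg_right h2 (by positivity)).trans (le_of_eq ?_)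
      rw [Real.mul_rpow (by positivity) (by positivity), ← Real.rpow_mul (by positivity),
        Real.mul_rpow (by positivity) hd0.le, div_eq_mul_inv, ← Real.rpow_neg hd0.le]
      have : d ^ (s * (m - 1)) * d ^ (-ν) = d ^ (-((N : ℝ) + s)) := by
        rw [← Real.rpow_add hd0]; congr 1; rw [hν]; ring
      rw [← this]; ring
  · rw [indicator_of_mem (by simpa using hy0) (s := (ball c R₀)ᶜ)]
    have hG : y ∉ largeSet c R μ ω u := fun h => hy0 (ball_subset_ball hRR h.1.1)
    rw [indicator_of_notMem hG, zero_add]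
    rw [mem_ball, dist_eq_norm, not_lt] at hy0
    have hc0 : 0 < ‖c - y‖ := by rw [norm_sub_rev]; linarith
    -- Here ‖y - c‖ ≥ R₀ ≥ R while ‖x - c‖ < R/4.
    have hcd : ‖c - y‖ / 2 ≤ d := by rw [norm_sub_rev]; linarith
    have h1 : u x - u y ≤ 2 * A + |u y| := by
      have := neg_abs_le (u y)
      have := le_abs_self μ
      nlinarith
    have h2 : J m (u x - u y) ≤ 2 ^ (m - 1) * ((2 * A) ^ (m - 1) + |u y| ^ (m - 1)) := by
      calc J m (u x - u y) ≤ (2 * A + |u y|) ^ (m - 1) := by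
            rw [← J_of_nonneg hm (by positivity)]
            exact monotone_J hm h1
        _ ≤ _ := add_rpow_le (by linarith) (by positivity) (abs_nonneg _)
    have h3 : d ^ (-ν) ≤ 2 ^ ν * ‖c - y‖ ^ (-ν) := by
      calc d ^ (-ν) ≤ (‖c - y‖ / 2) ^ (-ν) :=
            Real.rpow_le_rpow_of_nonpos (by positivity) hcd (by linarith)
        _ = 2 ^ ν * ‖c - y‖ ^ (-ν) := by
            rw [Real.div_rpow hc0.le (by norm_num), Real.rpow_neg (by norm_num : (0 : ℝ) ≤ 2),
              div_inv_eq_mul, mul_comm]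
    have h4 : J m (u x - u y) / d ^ ν ≤
        2 ^ (m - 1) * ((2 * A) ^ (m - 1) + |u y| ^ (m - 1)) * (2 ^ ν * ‖c - y‖ ^ (-ν)) := by
      rw [div_eq_mul_inv, ← Real.rpow_neg hd0.le]
      exact mul_le_mul h2 h3 (by positivity) (by positivity)
    refine h4.trans ?_
    rw [div_eq_mul_inv (|u y| ^ (m - 1)), ← Real.rpow_neg hc0.le]
    refine le_trans (le_of_eq ?_) (le_add_of_nonneg_left hsecond)
    ring

/-- All three contributions but the last scale like ω^{m-1} R^{-sm}, so the first two can be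
compared through constants alone. -/
lemma integral_J_far_le [NeZero N] {s m : ℝ} (hs0 : 0 < s) (hm : 2 ≤ m) (hR : 0 < R)
    (hRR : R ≤ R₀) (hω : 0 ≤ ω) (hσ : 0 ≤ σ) (hσ4 : σ ≤ 1 / 4) (hδ : 0 ≤ δ)
    (hu : Measurable u) (hM : ∀ x, |u x| ≤ M)
    (hu0 : ∀ x ∈ ball c R, μ ≤ u x)
    (hu1 : ∀ y ∈ ball c R₀, y ∉ ball c R → μ - ω * δ * (‖y - c‖ / R) ^ s ≤ u y)
    (hμ : |μ| ≤ A) (hωA : ω ≤ A) (hg : g * R ^ N ≤ volume.real (largeSet c R μ ω u))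
    {x : Euc N} (hx : x ∈ ball c (R / 4)) (hxσ : u x - μ < σ * ω) :
    ∫ y in (ball x (R / 8))ᶜ, J m (u x - u y) / ‖x - y‖ ^ ((N : ℝ) + s * m) ≤
      -(gainConst N s m g * (ω ^ (m - 1) * R ^ (-(s * m)))) +
      8 ^ (s * m) * (sphereConst N / s) * (σ + δ) ^ (m - 1) * (ω ^ (m - 1) * R ^ (-(s * m))) +
      remoteLoss s m u c R₀ A := by
  have hR0 : 0 < R₀ := hR.trans_le hRR
  have hsm : 0 < s * m := by positivity
  set ν : ℝ := (N : ℝ) + s * m with hν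
  have hJm := measurable_J m
  have hA : 0 ≤ A := hω.trans hωA
  set a₁ := (ω / 4) ^ (m - 1) * (2 * R) ^ (-ν) with ha₁
  have ha₁0 : 0 ≤ a₁ := by positivity
  set a₂ := (ω * (σ + δ)) ^ (m - 1) * (8 / R) ^ (s * (m - 1)) with ha₂
  set f₃ : Euc N → ℝ := fun y => 2 ^ (m - 1) * 2 ^ ν *
          ((2 * A) ^ (m - 1) * ‖c - y‖ ^ (-ν) + |u y| ^ (m - 1) / ‖c - y‖ ^ ν) with hf₃
  have hf₃0 : ∀ y, 0 ≤ f₃ y := fun y => by simp only [hf₃]; positivity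
  have hD : MeasurableSet (ball x (R / 8))ᶜ := measurableSet_ball.compl
  have hGm := measurableSet_largeSet (c := c) (R := R) (μ := μ) (ω := ω) hu
  have hGfin : volume (largeSet c R μ ω u) ≠ ∞ :=
    ((measure_mono (inter_subset_left.trans sdiff_subset)).trans_lt measure_ball_lt_top).ne
  -- This is why the large set is sought in an annulus: it stays at distance at least R/4 from x, so
  -- the whole gain is counted.
  have hGD : largeSet c R μ ω u ⊆ (ball x (R / 8))ᶜ := by
    intro y hy hyx
    have h1 := hy.1.2
    rw [mem_ball, dist_eq_norm] at h1 hx hyx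
    have : ‖y - c‖ ≤ ‖y - x‖ + ‖x - c‖ := by
      have := norm_add_le (y - x) (x - c)
      rwa [sub_add_sub_cancel] at this
    exact h1 (by linarith)
  have i₁ : Integrable ((largeSet c R μ ω u).indicator fun _ => -a₁) :=
    (integrable_indicator_iff hGm).2 (integrableOn_const hGfin)
  have i₂ := (integrableOn_norm_sub_rpow_far hs0 (by positivity : 0 < R / 8) x).const_mul a₂
  have i₃' : IntegrableOn (fun y => (2 * A) ^ (m - 1) * ‖c - y‖ ^ (-ν)) (ball c R₀)ᶜ :=
    (integrableOn_norm_sub_rpow_far hsm hR0 c).const_mul _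
  have i₃'' := integrableOn_rawTail hs0 hm hR0 hu hM c
  have i₃ : Integrable ((ball c R₀)ᶜ.indicator f₃) :=
    (integrable_indicator_iff measurableSet_ball.compl).2 ((i₃'.add i₃'').const_mul _)
  have iL : IntegrableOn (fun y => J m (u x - u y) / ‖x - y‖ ^ ν) (ball x (R / 8))ᶜ := by
    refine Integrable.mono' ((integrableOn_norm_sub_rpow_far hsm (by positivity : 0 < R / 8)
      x).const_mul ((2 * M) ^ (m - 1)))
      (Measurable.aestronglyMeasurable (by fun_prop)) (ae_of_all _ fun y => ?_)
    rw [norm_div, Real.norm_of_nonneg (Real.rpow_nonneg (norm_nonneg _) _),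
      ← one_div_rpow_eq (norm_nonneg _), mul_one_div]
    refine div_le_div_of_nonneg_right ?_ (by positivity)
    rw [Real.norm_eq_abs, abs_J hm]
    refine Real.rpow_le_rpow (abs_nonneg _) ?_ (by linarith)
    have := abs_sub (u x) (u y)
    have := hM x
    have := hM y
    linarith
  have v₁ : ∫ y in (ball x (R / 8))ᶜ, (largeSet c R μ ω u).indicator (fun _ => -a₁) y =
      -(volume.real (largeSet c R μ ω u) * a₁) := by
    rw [setIntegral_indicator hGm, inter_eq_self_of_subset_right hGD, setIntegral_const,
      smul_eq_mul, mul_neg]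
  have v₂ : ∫ y in (ball x (R / 8))ᶜ, a₂ * ‖x - y‖ ^ (-((N : ℝ) + s)) =
      a₂ * (sphereConst N / s * (R / 8) ^ (-s)) := by
    rw [integral_const_mul, integral_norm_sub_rpow_far hs0 (by positivity)]
  have v₃ : ∫ y in (ball x (R / 8))ᶜ, (ball c R₀)ᶜ.indicator f₃ y ≤ remoteLoss s m u c R₀ A := by
    refine (setIntegral_le_integral i₃ (ae_of_all _ fun y =>
      indicator_nonneg (fun y _ => hf₃0 y) y)).trans (le_of_eq ?_)
    rw [integral_indicator measurableSet_ball.compl, integral_const_mul, integral_add i₃' i₃'',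
      integral_const_mul, integral_norm_sub_rpow_far hsm hR0, remoteLoss, rawTail]
    ring
  have hmain : ∫ y in (ball x (R / 8))ᶜ, J m (u x - u y) / ‖x - y‖ ^ ν ≤
      ∫ y in (ball x (R / 8))ᶜ, ((largeSet c R μ ω u).indicator (fun _ => -a₁) y +
        a₂ * ‖x - y‖ ^ (-((N : ℝ) + s)) + (ball c R₀)ᶜ.indicator f₃ y) :=
    setIntegral_mono_on iL ((i₁.integrableOn.add i₂).add i₃.integrableOn) hD fun y hy =>
      J_far_pointwise_le hs0 hm hR hRR hω hσ hσ4 hδ hu0 hu1 hμ hωA hx hxσ hy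
  have hsplit : ∫ y in (ball x (R / 8))ᶜ, ((largeSet c R μ ω u).indicator (fun _ => -a₁) y +
        a₂ * ‖x - y‖ ^ (-((N : ℝ) + s)) + (ball c R₀)ᶜ.indicator f₃ y) =
      -(volume.real (largeSet c R μ ω u) * a₁) + a₂ * (sphereConst N / s * (R / 8) ^ (-s)) +
        ∫ y in (ball x (R / 8))ᶜ, (ball c R₀)ᶜ.indicator f₃ y := by
    have e1 := integral_add (μ := volume.restrict (ball x (R / 8))ᶜ)
      (i₁.integrableOn.add i₂) i₃.integrableOn
    have e2 := integral_add (μ := volume.restrict (ball x (R / 8))ᶜ) i₁.integrableOn i₂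
    rw [← v₁, ← v₂, ← e2]
    exact e1
  rw [hsplit] at hmain
  refine hmain.trans (add_le_add (add_le_add ?_ (le_of_eq ?_)) v₃)
  · refine neg_le_neg ?_
    refine le_trans (le_of_eq ?_) (mul_le_mul_of_nonneg_right hg ha₁0)
    rw [ha₁, gainConst, div_eq_mul_one_div ω 4, Real.mul_rpow hω (by norm_num),
      Real.mul_rpow (by norm_num) hR.le]
    have : R ^ N * R ^ (-ν) = R ^ (-(s * m)) := by
      rw [← Real.rpow_natCast, ← Real.rpow_add hR]; congr 1; rw [hν]; ring
    rw [← this]; ring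
  · rw [ha₂, Real.mul_rpow hω (by positivity)]
    have e1 : (R / 8) ^ (-s) = (8 / R) ^ s := by
      rw [← inv_div, Real.inv_rpow (by positivity), ← Real.rpow_neg (by positivity), neg_neg]
    have e2 : (8 / R) ^ (s * (m - 1)) * (8 / R) ^ s = 8 ^ (s * m) * R ^ (-(s * m)) := by
      rw [← Real.rpow_add (by positivity), show s * (m - 1) + s = s * m by ring,
        Real.div_rpow (by norm_num) hR.le, Real.rpow_neg hR.le, div_eq_mul_inv]
    rw [e1]
    calc _ = ω ^ (m - 1) * (σ + δ) ^ (m - 1) * (sphereConst N / s) *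
          ((8 / R) ^ (s * (m - 1)) * (8 / R) ^ s) := by ring
      _ = _ := by rw [e2]; ring

/-- Growth lemma: a supersolution that is large on a substantial part of an annulus is large in a
small ball. -/
lemma IsSupersol.growth [NeZero N] {s p q K : ℝ} (hs0 : 0 < s) (hs1 : s < 1) (hp : 2 ≤ p)
    (hq : 2 ≤ q) (hS : IsSupersol s p q K c R₀ u) (hR : 0 < R) (hRR : R ≤ R₀) (hω : 0 ≤ ω)
    (hσ : 0 ≤ σ) (hσ4 : σ ≤ 1 / 4) (hδ : 0 ≤ δ) (hu0 : ∀ x ∈ ball c R, μ ≤ u x)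
    (hu1 : ∀ y ∈ ball c R₀, y ∉ ball c R → μ - ω * δ * (‖y - c‖ / R) ^ s ≤ u y)
    (hμ : |μ| ≤ A) (hωA : ω ≤ A) (hg : g * R ^ N ≤ volume.real (largeSet c R μ ω u))
    (hlp : lossConst N s p * (σ + δ) ^ (p - 1) ≤ gainConst N s p g)
    (hlq : lossConst N s q * (σ + δ) ^ (q - 1) ≤ gainConst N s q g)
    (hK : K + 2 * remoteLoss s p u c R₀ A + 2 * remoteLoss s q u c R₀ A <
      gainConst N s p g * (ω ^ (p - 1) * R ^ (-(s * p))) +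
      gainConst N s q g * (ω ^ (q - 1) * R ^ (-(s * q)))) :
    ∀ᵐ x, x ∈ ball c (R / 8) → μ + 3 / 4 * (σ * ω) ≤ u x := by
  obtain ⟨M, hM⟩ := hS.bounded
  have hu := hS.measurable
  set τ := σ * ω with hτdef
  have hτ : 0 ≤ τ := by positivity
  set ψ := barrierExcess c R τ μ u with hψ
  have hψB : ∀ y, |ψ y| ≤ τ := fun y => by
    rw [abs_of_nonneg (barrierExcess_nonneg _)]; exact barrierExcess_le hR hτ hu0 y
  have hψm : Measurable ψ := measurable_barrierExcess hu
  have hψz : ∀ x ∉ ball c (R / 4), ψ x = 0 := fun x => barrierExcess_eq_zero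
  have hψi : Integrable ψ := integrable_of_bdd_of_support hψm hψB hψz
  have hweak := hS.le_form hp hq (by linarith : R / 4 < R₀) hψm barrierExcess_nonneg hψB hψz
    (integrable_energyDensity_barrierExcess hs0 hs1 hp hR hRR hτ hu hu0 hS.energy_p)
    (integrable_energyDensity_barrierExcess hs0 hs1 hq hR hRR hτ hu hu0 hS.energy_q)
  -- The distant pairs supply the gain twice; one copy pays for the losses by hypothesis, the other
  -- remains.
  have key : ∀ m, 2 ≤ m → IntegrableOn (energyDensity s m u) (cross (ball c R₀)) →
      lossConst N s m * (σ + δ) ^ (m - 1) ≤ gainConst N s m g →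
      form s m u ψ ≤ (-(gainConst N s m g * (ω ^ (m - 1) * R ^ (-(s * m)))) +
        2 * remoteLoss s m u c R₀ A) * ∫ y, ψ y := by
    intro m hm hme hl
    have hsm : 0 < m - s * m := by nlinarith
    refine (form_barrierExcess_le hs0 hs1 hm hR hRR hτ hu hM hu0 hme fun x hx hxτ =>
      integral_J_far_le hs0 hm hR hRR hω hσ hσ4 hδ hu hM hu0 hu1 hμ hωA hg hx hxτ).trans ?_
    refine mul_le_mul_of_nonneg_right ?_ (integral_nonneg barrierExcess_nonneg)
    set X := ω ^ (m - 1) * R ^ (-(s * m)) with hX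
    have hX0 : 0 ≤ X := by positivity
    have hn : (m - 1) * 32 ^ (m - 1) * (sphereConst N / (m - s * m)) * τ ^ (m - 1) *
        R ^ (-(s * m)) ≤
        (m - 1) * 32 ^ (m - 1) * (sphereConst N / (m - s * m)) * (σ + δ) ^ (m - 1) * X := by
      rw [hτdef, Real.mul_rpow hσ hω, hX]
      have h1 : σ ^ (m - 1) ≤ (σ + δ) ^ (m - 1) :=
        Real.rpow_le_rpow hσ (by linarith) (by linarith)
      have h2 : 0 ≤ (m - 1) * 32 ^ (m - 1) * (sphereConst N / (m - s * m)) :=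
        mul_nonneg (mul_nonneg (by linarith) (by positivity))
          (div_nonneg sphereConst_pos.le hsm.le)
      calc _ = (m - 1) * 32 ^ (m - 1) * (sphereConst N / (m - s * m)) *
            (σ ^ (m - 1) * (ω ^ (m - 1) * R ^ (-(s * m)))) := by ring
        _ ≤ (m - 1) * 32 ^ (m - 1) * (sphereConst N / (m - s * m)) *
            ((σ + δ) ^ (m - 1) * (ω ^ (m - 1) * R ^ (-(s * m)))) := by gcongr
        _ = _ := by ring
    have hl' := mul_le_mul_of_nonneg_right hl hX0
    rw [lossConst] at hl'
    linarith
  have kp := key p hp hS.energy_p hlp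
  have kq := key q hq hS.energy_q hlq
  have hI0 : 0 ≤ ∫ y, ψ y := integral_nonneg barrierExcess_nonneg
  -- Otherwise the weak inequality bounds the form below by -K∫ψ, while `kp`, `kq` and `hK` put it
  -- strictly below.
  have hI : ∫ y, ψ y = 0 := by
    by_contra hne
    have hpos : 0 < ∫ y, ψ y := lt_of_le_of_ne hI0 (Ne.symm hne)
    have := mul_lt_mul_of_pos_right hK hpos
    linarith
  have hae := (integral_eq_zero_iff_of_nonneg barrierExcess_nonneg hψi).1 hI
  filter_upwards [hae] with x hx hxb
  have hxR : x ∈ ball c R := ball_subset_ball (by linarith) hxb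
  have h1 := le_barrier hR hτ hxb
  have h2 : 0 = max (barrier c R τ x - (u x - μ)) 0 :=
    hx.symm.trans (barrierExcess_eq hR hτ hu0 hxR)
  have h3 := le_max_left (barrier c R τ x - (u x - μ)) 0
  rw [← h2] at h3
  linarith

end Growth

/-! ### Invariance under modification on null sets. -/

section Congr

variable {N : ℕ} {c : Euc N} {R R₀ σ ω δ μ A M g : ℝ} {u u' : Euc N → ℝ}

lemma ae_prod_of_ae {P : Euc N → Prop} (h : ∀ᵐ x, P x) :
    ∀ᵐ z : Euc N × Euc N, P z.1 ∧ P z.2 :=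
  (Measure.quasiMeasurePreserving_fst.ae h).and (Measure.quasiMeasurePreserving_snd.ae h)

lemma form_congr_ae (h : u =ᵐ[volume] u') (s m : ℝ) (φ : Euc N → ℝ) :
    form s m u φ = form s m u' φ := by
  refine integral_congr_ae ?_
  filter_upwards [ae_prod_of_ae h] with z hz
  rw [hz.1, hz.2]

lemma energyDensity_congr_ae (h : u =ᵐ[volume] u') (s m : ℝ) :
    energyDensity s m u =ᵐ[volume] energyDensity s m u' := by
  filter_upwards [ae_prod_of_ae h] with z hz
  simp only [energyDensity]
  rw [hz.1, hz.2]

lemma rawTail_congr_ae (h : u =ᵐ[volume] u') (s m : ℝ) (c : Euc N) (R : ℝ) :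
    rawTail s m u c R = rawTail s m u' c R := by
  refine integral_congr_ae (ae_restrict_of_ae ?_)
  filter_upwards [h] with z hz
  rw [hz]

lemma rawTail_neg (s m : ℝ) (u : Euc N → ℝ) (c : Euc N) (R : ℝ) :
    rawTail s m (fun x => -u x) c R = rawTail s m u c R := by
  simp [rawTail]

lemma remoteLoss_congr_ae (h : u =ᵐ[volume] u') (s m : ℝ) (c : Euc N) (R A : ℝ) :
    remoteLoss s m u c R A = remoteLoss s m u' c R A := by
  rw [remoteLoss, remoteLoss, rawTail_congr_ae h]

lemma IsSupersol.congr_ae {s p q K : ℝ} (hS : IsSupersol s p q K c R u) (hu' : Measurable u')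
    (hb : ∃ M, ∀ x, |u' x| ≤ M) (h : u =ᵐ[volume] u') : IsSupersol s p q K c R u' where
  measurable := hu'
  bounded := hb
  energy_p := hS.energy_p.congr (ae_restrict_of_ae (energyDensity_congr_ae h s p))
  energy_q := hS.energy_q.congr (ae_restrict_of_ae (energyDensity_congr_ae h s q))
  weak φ hφ h0 := by
    rw [← form_congr_ae h, ← form_congr_ae h]
    exact hS.weak φ hφ h0

/-- The growth lemma with hypotheses up to null sets. -/
lemma IsSupersol.growth_ae [NeZero N] {s p q K : ℝ} (hs0 : 0 < s) (hs1 : s < 1) (hp : 2 ≤ p)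
    (hq : 2 ≤ q) (hS : IsSupersol s p q K c R₀ u) (hR : 0 < R) (hRR : R ≤ R₀) (hω : 0 ≤ ω)
    (hσ : 0 ≤ σ) (hσ4 : σ ≤ 1 / 4) (hδ : 0 ≤ δ) (hu0 : ∀ᵐ x, x ∈ ball c R → μ ≤ u x)
    (hu1 : ∀ᵐ y, y ∈ ball c R₀ → y ∉ ball c R → μ - ω * δ * (‖y - c‖ / R) ^ s ≤ u y)
    (hμ : |μ| ≤ A) (hωA : ω ≤ A) (hg : g * R ^ N ≤ volume.real (largeSet c R μ ω u))
    (hlp : lossConst N s p * (σ + δ) ^ (p - 1) ≤ gainConst N s p g)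
    (hlq : lossConst N s q * (σ + δ) ^ (q - 1) ≤ gainConst N s q g)
    (hK : K + 2 * remoteLoss s p u c R₀ A + 2 * remoteLoss s q u c R₀ A <
      gainConst N s p g * (ω ^ (p - 1) * R ^ (-(s * p))) +
      gainConst N s q g * (ω ^ (q - 1) * R ^ (-(s * q)))) :
    ∀ᵐ x, x ∈ ball c (R / 8) → μ + 3 / 4 * (σ * ω) ≤ u x := by
  classical
  obtain ⟨M, hM⟩ := hS.bounded
  have hboth := hu0.and hu1
  set Z := toMeasurable volume {x | ¬ ((x ∈ ball c R → μ ≤ u x) ∧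
    (x ∈ ball c R₀ → x ∉ ball c R → μ - ω * δ * (‖x - c‖ / R) ^ s ≤ u x))} with hZ
  have hZ0 : volume Z = 0 := by rw [hZ, measure_toMeasurable]; exact hboth
  have hZm : MeasurableSet Z := measurableSet_toMeasurable _ _
  have hnot : ∀ x ∉ Z, (x ∈ ball c R → μ ≤ u x) ∧
      (x ∈ ball c R₀ → x ∉ ball c R → μ - ω * δ * (‖x - c‖ / R) ^ s ≤ u x) := by
    intro x hx
    by_contra h
    exact hx (subset_toMeasurable _ _ h)
  -- The value μ satisfies both lower bounds, so the modified function obeys them at every point.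
  set v : Euc N → ℝ := Z.piecewise (fun _ => μ) u with hv
  have huv : u =ᵐ[volume] v := by
    filter_upwards [measure_eq_zero_iff_ae_notMem.1 hZ0] with x hx
    exact (piecewise_eq_of_notMem Z _ _ hx).symm
  have hvZ : ∀ x ∈ Z, v x = μ := fun x hx => piecewise_eq_of_mem Z _ _ hx
  have hvZ' : ∀ x ∉ Z, v x = u x := fun x hx => piecewise_eq_of_notMem Z _ _ hx
  have hvS : IsSupersol s p q K c R₀ v := by
    refine hS.congr_ae (Measurable.piecewise hZm measurable_const hS.measurable)
      ⟨max |μ| M, fun x => ?_⟩ huv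
    by_cases hx : x ∈ Z
    · rw [hvZ x hx]; exact le_max_left _ _
    · rw [hvZ' x hx]; exact (hM x).trans (le_max_right _ _)
  have hres := hvS.growth hs0 hs1 hp hq hR hRR hω hσ hσ4 hδ (μ := μ) (A := A) (g := g)
    (fun x hx => by
      by_cases hxZ : x ∈ Z
      · rw [hvZ x hxZ]
      · rw [hvZ' x hxZ]; exact (hnot x hxZ).1 hx)
    (fun y hy hyR => by
      by_cases hxZ : y ∈ Z
      · rw [hvZ y hxZ]
        have : 0 ≤ ω * δ * (‖y - c‖ / R) ^ s := by positivity
        linarith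
      · rw [hvZ' y hxZ]; exact (hnot y hxZ).2 hy hyR)
    hμ hωA (hg.trans (le_of_eq (measureReal_congr (by
      filter_upwards [huv] with x hx
      refine propext ?_
      change x ∈ largeSet c R μ ω u ↔ x ∈ largeSet c R μ ω v
      simp only [largeSet, mem_inter_iff, mem_ofPred_eq, hx]))))
    hlp hlq (by rwa [← remoteLoss_congr_ae huv, ← remoteLoss_congr_ae huv])
  filter_upwards [hres, huv] with x hx he hxb
  rw [he]; exact hx hxb

end Congr

/-! ### Scales, oscillation bounds and the invariant of the iteration. -/

section Decay

variable {N : ℕ} {c : Euc N} {R R₀ a A K : ℝ} {u : Euc N → ℝ}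

lemma measureReal_ball_eq [NeZero N] (c : Euc N) {r : ℝ} (hr : 0 ≤ r) :
    volume.real (ball c r) = r ^ N * volume.real (ball (0 : Euc N) 1) := by
  rw [measureReal_def, Measure.addHaar_ball _ _ hr, finrank_euclideanSpace_fin, ENNReal.toReal_mul,
    ENNReal.toReal_ofReal (by positivity), measureReal_def]

/-- One of the two halves of the range occupies a substantial part of the annulus. -/
lemma largeSet_or_largeSet_neg [NeZero N] (u : Euc N → ℝ) (hR : 0 < R) (a ω : ℝ) :
    volume.real (ball (0 : Euc N) 1) / 4 * R ^ N ≤ volume.real (largeSet c R a ω u) ∨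
    volume.real (ball (0 : Euc N) 1) / 4 * R ^ N ≤
      volume.real (largeSet c R (-(a + ω)) ω fun x => -u x) := by
  set V := volume.real (ball (0 : Euc N) 1)
  have hV : 0 ≤ V := measureReal_nonneg
  -- The inner ball has at most half the volume because 2^N ≥ 2; the two alternatives share the
  -- remaining half, whence the quarter.
  have hann : V / 2 * R ^ N ≤ volume.real (ball c R \ ball c (R / 2)) := by
    rw [measureReal_sdiff (ball_subset_ball (by linarith)) measurableSet_ball
      measure_ball_lt_top.ne, measureReal_ball_eq c hR.le, measureReal_ball_eq c (by positivity)]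
    have h1 : (R / 2) ^ N ≤ R ^ N / 2 := by
      rw [div_pow]
      refine div_le_div_of_nonneg_left (by positivity) (by norm_num) ?_
      calc (2 : ℝ) = 2 ^ 1 := by norm_num
        _ ≤ 2 ^ N := pow_le_pow_right₀ (by norm_num) (Nat.one_le_iff_ne_zero.2 (NeZero.ne N))
    have := mul_le_mul_of_nonneg_right h1 hV
    linarith
  have hsub : ball c R \ ball c (R / 2) ⊆
      largeSet c R a ω u ∪ largeSet c R (-(a + ω)) ω fun x => -u x := by
    intro x hx
    rcases le_total (a + ω / 2) (u x) with h | h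
    · exact Or.inl ⟨hx, h⟩
    · refine Or.inr ⟨hx, ?_⟩
      simp only [mem_ofPred_eq]
      linarith
  have hfin : ∀ (μ : ℝ) (v : Euc N → ℝ), volume (largeSet c R μ ω v) ≠ ∞ := fun μ v =>
    ((measure_mono (inter_subset_left.trans sdiff_subset)).trans_lt measure_ball_lt_top).ne
  have hle := (measureReal_mono hsub (measure_union_lt_top (hfin _ _).lt_top
    (hfin _ _).lt_top).ne).trans (measureReal_union_le _ _)
  by_contra hcon
  rw [not_or, not_le, not_le] at hcon
  linarith [hcon.1, hcon.2]

/-- Radii of the iteration. -/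
noncomputable def iterRadius (R₀ : ℝ) (k : ℕ) : ℝ := R₀ * 8 ^ (-(k : ℝ))

/-- Oscillation bounds of the iteration. -/
noncomputable def iterOsc (A α : ℝ) (k : ℕ) : ℝ := A * 8 ^ (-(α * k))

lemma iterRadius_succ (R₀ : ℝ) (k : ℕ) : iterRadius R₀ (k + 1) = iterRadius R₀ k / 8 := by
  rw [iterRadius, iterRadius, Nat.cast_add, Nat.cast_one, neg_add, Real.rpow_add (by norm_num),
    Real.rpow_neg_one]
  ring

lemma iterRadius_pos (hR : 0 < R₀) (k : ℕ) : 0 < iterRadius R₀ k := by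
  unfold iterRadius; positivity

lemma iterRadius_anti (hR : 0 < R₀) {j k : ℕ} (h : j ≤ k) : iterRadius R₀ k ≤ iterRadius R₀ j := by
  unfold iterRadius
  refine mul_le_mul_of_nonneg_left (Real.rpow_le_rpow_of_exponent_le (by norm_num) ?_) hR.le
  exact neg_le_neg (by exact_mod_cast h)

lemma iterRadius_zero (R₀ : ℝ) : iterRadius R₀ 0 = R₀ := by simp [iterRadius]

lemma exists_iterRadius (hR : 0 < R₀) {t : ℝ} (ht : 0 < t) (htR : t ≤ R₀) :
    ∃ k, iterRadius R₀ (k + 1) < t ∧ t ≤ iterRadius R₀ k := by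
  have hlim : ∃ k, iterRadius R₀ k < t := by
    obtain ⟨k, hk⟩ := exists_pow_lt_of_lt_one (div_pos ht hR) (by norm_num : (1 / 8 : ℝ) < 1)
    refine ⟨k, ?_⟩
    rw [lt_div_iff₀ hR] at hk
    rw [iterRadius, Real.rpow_neg (by norm_num), Real.rpow_natCast]
    rw [one_div, inv_pow] at hk
    linarith
  classical
  have hpos : Nat.find hlim ≠ 0 := by
    intro h0
    have := Nat.find_spec hlim
    rw [h0, iterRadius_zero] at this
    linarith
  obtain ⟨k, hk⟩ := Nat.exists_eq_succ_of_ne_zero hpos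
  refine ⟨k, ?_, ?_⟩
  · have := Nat.find_spec hlim
    rwa [hk] at this
  · exact not_lt.1 (Nat.find_min hlim (by omega))

lemma iterOsc_pos {α : ℝ} (hA : 0 < A) (k : ℕ) : 0 < iterOsc A α k := by
  unfold iterOsc; positivity

lemma iterOsc_anti {α : ℝ} (hα : 0 ≤ α) (hA : 0 ≤ A) {j k : ℕ} (h : j ≤ k) :
    iterOsc A α k ≤ iterOsc A α j := by
  unfold iterOsc
  refine mul_le_mul_of_nonneg_left (Real.rpow_le_rpow_of_exponent_le (by norm_num) ?_) hA
  exact neg_le_neg (mul_le_mul_of_nonneg_left (by exact_mod_cast h) hα)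

lemma iterOsc_succ (A α : ℝ) (k : ℕ) : iterOsc A α (k + 1) = iterOsc A α k * 8 ^ (-α) := by
  rw [iterOsc, iterOsc, mul_assoc, ← Real.rpow_add (by norm_num)]
  congr 2; push_cast; ring

lemma iterOsc_le_rpow {α r : ℝ} (hα : 0 ≤ α) (hA : 0 ≤ A) (hR : 0 < R₀) {k : ℕ}
    (hr : iterRadius R₀ (k + 1) < r) : iterOsc A α k ≤ 8 ^ α * A * (r / R₀) ^ α := by
  have h1 : (8 : ℝ) ^ (-((k : ℝ) + 1)) ≤ r / R₀ := by
    rw [le_div_iff₀ hR]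
    rw [iterRadius] at hr
    push_cast at hr
    linarith
  calc iterOsc A α k = 8 ^ α * A * (8 ^ (-((k : ℝ) + 1))) ^ α := by
        rw [iterOsc, ← Real.rpow_mul (by norm_num), mul_comm (8 ^ α) A, mul_assoc,
          ← Real.rpow_add (by norm_num)]
        congr 2; ring
    _ ≤ _ := mul_le_mul_of_nonneg_left (Real.rpow_le_rpow (by positivity) h1 hα) (by positivity)

/-- The growth of the oscillation bounds at coarser scales is slower than a small multiple of
`t ^ s`. -/
lemma iterOsc_sub_le {α s t : ℝ} (hα : 0 < α) (hαs : α ≤ s) (hA : 0 < A) (hR : 0 < R₀) {j k : ℕ}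
    (hjk : j ≤ k) (ht : iterRadius R₀ (j + 1) ≤ t) :
    iterOsc A α j - iterOsc A α k ≤
      iterOsc A α k * (α * 8 ^ s / s) * (t / iterRadius R₀ k) ^ s := by
  have hs : 0 < s := hα.trans_le hαs
  set n : ℝ := (k : ℝ) - j with hn
  have hn0 : 0 ≤ n := by
    have : (j : ℝ) ≤ k := by exact_mod_cast hjk
    linarith
  have e1 : iterOsc A α j = iterOsc A α k * 8 ^ (α * n) := by
    rw [iterOsc, iterOsc, mul_assoc, ← Real.rpow_add (by norm_num)]
    congr 2; rw [hn]; ring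
  have h8 : (1 : ℝ) ≤ 8 ^ (s * n) := Real.one_le_rpow (by norm_num) (by positivity)
  -- Bernoulli with exponent α/s ≤ 1; the factor α/s is what makes the drop δ small with α.
  have h2 : (8 : ℝ) ^ (α * n) ≤ 1 + α / s * (8 ^ (s * n) - 1) := by
    have := rpow_one_add_le_one_add_mul_self (s := (8 : ℝ) ^ (s * n) - 1) (by linarith)
      (p := α / s) (by positivity) ((div_le_one hs).2 hαs)
    rw [add_sub_cancel, ← Real.rpow_mul (by norm_num)] at this
    rwa [show s * n * (α / s) = α * n by field_simp] at this
  have h3 : (8 : ℝ) ^ (n - 1) ≤ t / iterRadius R₀ k := by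
    rw [le_div_iff₀ (iterRadius_pos hR k)]
    refine le_trans (le_of_eq ?_) ht
    rw [iterRadius, iterRadius, mul_left_comm, ← Real.rpow_add (by norm_num)]
    congr 2; rw [hn]; push_cast; ring
  have h4 : (8 : ℝ) ^ (s * n) ≤ 8 ^ s * (t / iterRadius R₀ k) ^ s := by
    calc (8 : ℝ) ^ (s * n) = 8 ^ s * (8 ^ (n - 1)) ^ s := by
          rw [← Real.rpow_mul (by norm_num), ← Real.rpow_add (by norm_num)]
          congr 1; ring
      _ ≤ _ := mul_le_mul_of_nonneg_left (Real.rpow_le_rpow (by positivity) h3 hs.le)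
          (by positivity)
  have h5 : (8 : ℝ) ^ (α * n) - 1 ≤ α * 8 ^ s / s * (t / iterRadius R₀ k) ^ s := by
    have : α / s * (8 ^ (s * n) - 1) ≤ α / s * (8 ^ s * (t / iterRadius R₀ k) ^ s) :=
      mul_le_mul_of_nonneg_left (by linarith) (by positivity)
    calc (8 : ℝ) ^ (α * n) - 1 ≤ α / s * (8 ^ s * (t / iterRadius R₀ k) ^ s) := by linarith
      _ = _ := by ring
  have h6 := mul_le_mul_of_nonneg_left h5 (iterOsc_pos (α := α) hA k).le
  rw [e1]
  linarith

/-- The invariant of the iteration: at the scales up to `k`, the values of `u` lie in intervals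
around `[a, a + ω_k]` of the prescribed lengths. -/
def IterInv (c : Euc N) (R₀ A α : ℝ) (u : Euc N → ℝ) (k : ℕ) (a : ℝ) : Prop :=
  -A ≤ a ∧ a + iterOsc A α k ≤ A ∧ ∀ j ≤ k, ∀ᵐ x, x ∈ ball c (iterRadius R₀ j) →
    a - (iterOsc A α j - iterOsc A α k) ≤ u x ∧ u x ≤ a + iterOsc A α j

/-- The invariant is symmetric under reflection of the current interval, so only improvements from
below need an argument. -/
lemma IterInv.neg {α : ℝ} {k : ℕ} (h : IterInv c R₀ A α u k a) :
    IterInv c R₀ A α (fun x => -u x) k (-(a + iterOsc A α k)) := by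
  refine ⟨neg_le_neg h.2.1, by linarith [h.1], fun j hj => ?_⟩
  filter_upwards [h.2.2 j hj] with x hx hxb
  have := hx hxb
  constructor <;> linarith

/-- Turns the bounds at coarser scales into the power-type lower bound that `IsSupersol.growth_ae`
requires outside B_{R_k}. -/
lemma IterInv.ae_lower {α : ℝ} {k : ℕ} {s : ℝ} (h : IterInv c R₀ A α u k a) (hα : 0 < α)
    (hαs : α ≤ s) (hA : 0 < A) (hR : 0 < R₀) :
    ∀ᵐ y, y ∈ ball c R₀ → y ∉ ball c (iterRadius R₀ k) →
      a - iterOsc A α k * (α * 8 ^ s / s) * (‖y - c‖ / iterRadius R₀ k) ^ s ≤ u y := by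
  have hall : ∀ᵐ y, ∀ j, j ≤ k → y ∈ ball c (iterRadius R₀ j) →
      a - (iterOsc A α j - iterOsc A α k) ≤ u y ∧ u y ≤ a + iterOsc A α j := by
    rw [ae_all_iff]
    intro j
    by_cases hj : j ≤ k
    · filter_upwards [h.2.2 j hj] with y hy _ using hy
    · exact ae_of_all _ fun y hj' => absurd hj' hj
  filter_upwards [hall] with y hy hy0 hyk
  rw [mem_ball, dist_eq_norm] at hy0 hyk
  rw [not_lt] at hyk
  classical
  -- The least such i is the successor of the index j of the shell R_{j+1} ≤ ‖y - c‖ < R_j; it is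
  -- nonzero since y lies in B_{R₀}.
  have hex : ∃ i, iterRadius R₀ i ≤ ‖y - c‖ := ⟨k, hyk⟩
  have hpos : Nat.find hex ≠ 0 := by
    intro h0
    have := Nat.find_spec hex
    rw [h0, iterRadius_zero] at this
    linarith
  obtain ⟨j, hj⟩ := Nat.exists_eq_succ_of_ne_zero hpos
  have hjk : j ≤ k := by
    have := Nat.find_min' hex hyk
    omega
  have h1 : iterRadius R₀ (j + 1) ≤ ‖y - c‖ := by
    have := Nat.find_spec hex
    rwa [hj] at this
  have h2 : ‖y - c‖ < iterRadius R₀ j := not_le.1 (Nat.find_min hex (by omega))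
  have h3 := (hy j hjk (by rwa [mem_ball, dist_eq_norm])).1
  have h4 := iterOsc_sub_le hα hαs hA hR hjk h1
  linarith

/-- The upper endpoint is kept and the lower one is raised by ω_k - ω_{k+1}. At older scales the
increments telescope, so their lower bound is unchanged. -/
lemma IterInv.succ_of_lower {α θ : ℝ} {k : ℕ} (h : IterInv c R₀ A α u k a) (hα : 0 ≤ α)
    (hA : 0 < A) (hR : 0 < R₀) (hθ : 1 - 8 ^ (-α) ≤ θ)
    (hl : ∀ᵐ x, x ∈ ball c (iterRadius R₀ (k + 1)) → a + θ * iterOsc A α k ≤ u x) :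
    IterInv c R₀ A α u (k + 1) (a + (iterOsc A α k - iterOsc A α (k + 1))) := by
  have hmono : iterOsc A α (k + 1) ≤ iterOsc A α k := iterOsc_anti hα hA.le (Nat.le_succ k)
  refine ⟨by linarith [h.1], by linarith [h.2.1], fun j hj => ?_⟩
  rcases Nat.lt_or_ge k j with hkj | hkj
  · have hj' : j = k + 1 := by omega
    subst hj'
    filter_upwards [hl, h.2.2 k le_rfl] with x hx hxk hxb
    have h1 := hx hxb
    have h2 := (hxk (ball_subset_ball (iterRadius_anti hR (Nat.le_succ k)) hxb)).2
    have h3 : iterOsc A α k - iterOsc A α (k + 1) ≤ θ * iterOsc A α k := by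
      rw [iterOsc_succ]
      have := mul_le_mul_of_nonneg_right hθ (iterOsc_pos (α := α) hA k).le
      linarith
    constructor <;> linarith
  · filter_upwards [h.2.2 j hkj] with x hx hxb
    have := hx hxb
    constructor <;> linarith

lemma IterInv.succ_of_upper {α θ : ℝ} {k : ℕ} (h : IterInv c R₀ A α u k a) (hα : 0 ≤ α)
    (hA : 0 < A) (hR : 0 < R₀) (hθ : 1 - 8 ^ (-α) ≤ θ)
    (hl : ∀ᵐ x, x ∈ ball c (iterRadius R₀ (k + 1)) →
      -(a + iterOsc A α k) + θ * iterOsc A α k ≤ -u x) :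
    IterInv c R₀ A α u (k + 1) a := by
  have := (h.neg.succ_of_lower hα hA hR hθ hl).neg
  simpa using this

end Decay

/-! ### Choice of the exponent and proof of oscillation decay. -/

section DecayTheorem

variable {N : ℕ} {c : Euc N} {R R₀ a A K : ℝ} {u : Euc N → ℝ}

lemma gainConst_pos {s m g : ℝ} (hg : 0 < g) : 0 < gainConst N s m g := by
  unfold gainConst; positivity

lemma lossConst_pos [NeZero N] {s m : ℝ} (hs0 : 0 < s) (hs1 : s < 1) (hm : 2 ≤ m) :
    0 < lossConst N s m := by
  have := sphereConst_pos (N := N)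
  have h1 : 0 < m - s * m := by nlinarith
  have h2 : 0 < m - 1 := by linarith
  unfold lossConst; positivity

/-- The exponent sm - α(m-1) is at least s when α ≤ s/2, so the gain grows geometrically while the
remote losses stay fixed. -/
lemma iter_gain_ge {s m α : ℝ} (hm : 2 ≤ m) (hα : 0 < α) (hαs : α ≤ s / 2) (hA : 0 < A)
    (hR : 0 < R₀) (k : ℕ) :
    (8 ^ s) ^ k * (A ^ (m - 1) * R₀ ^ (-(s * m))) ≤
      iterOsc A α k ^ (m - 1) * iterRadius R₀ k ^ (-(s * m)) := by
  have e : iterOsc A α k ^ (m - 1) * iterRadius R₀ k ^ (-(s * m)) =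
      8 ^ (k * (s * m - α * (m - 1))) * (A ^ (m - 1) * R₀ ^ (-(s * m))) := by
    rw [iterOsc, iterRadius, Real.mul_rpow hA.le (by positivity), Real.mul_rpow hR.le
      (by positivity), ← Real.rpow_mul (by norm_num), ← Real.rpow_mul (by norm_num)]
    rw [show (k : ℝ) * (s * m - α * (m - 1)) = -(α * k) * (m - 1) + -(k : ℝ) * -(s * m) by ring,
      Real.rpow_add (by norm_num)]
    ring
  rw [e, ← Real.rpow_natCast, ← Real.rpow_mul (by norm_num)]
  refine mul_le_mul_of_nonneg_right (Real.rpow_le_rpow_of_exponent_le (by norm_num) ?_)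
    (by positivity)
  rw [mul_comm s]
  refine mul_le_mul_of_nonneg_left ?_ (Nat.cast_nonneg k)
  nlinarith

lemma exists_small_exponent [NeZero N] {s m g : ℝ} (hs0 : 0 < s) (hs1 : s < 1) (hm : 2 ≤ m)
    (hg : 0 < g) : ∃ ε₀ : ℝ, 0 < ε₀ ∧ ∀ ε, 0 ≤ ε → ε ≤ ε₀ → ε ≤ 1 →
      lossConst N s m * ε ^ (m - 1) ≤ gainConst N s m g := by
  have hl := lossConst_pos (N := N) hs0 hs1 hm
  refine ⟨gainConst N s m g / lossConst N s m, div_pos (gainConst_pos hg) hl, fun ε h0 h1 h2 => ?_⟩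
  have h3 : ε ^ (m - 1) ≤ ε := by
    rcases h0.eq_or_lt with h | h
    · rw [← h, Real.zero_rpow (by linarith)]
    · calc ε ^ (m - 1) ≤ ε ^ (1 : ℝ) :=
            Real.rpow_le_rpow_of_exponent_ge h h2 (by linarith)
        _ = ε := Real.rpow_one _
  rw [le_div_iff₀ hl] at h1
  have := mul_le_mul_of_nonneg_left h3 hl.le
  linarith

lemma one_sub_le_rpow_neg {α : ℝ} (hα : 0 ≤ α) : 1 - 8 ^ (-α) ≤ 3 * α := by
  have h1 : Real.log 8 ≤ 3 := by
    have : Real.log 8 = 3 * Real.log 2 := by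
      rw [show (8 : ℝ) = 2 ^ (3 : ℕ) by norm_num, Real.log_pow]; norm_num
    have := Real.log_two_lt_d9
    linarith
  rw [Real.rpow_def_of_pos (by norm_num)]
  have := Real.add_one_le_exp (Real.log 8 * -α)
  have := mul_le_mul_of_nonneg_right h1 hα
  linarith

/-- Control of the losses at large distances by the scale-invariant quantities. -/
lemma remoteLoss_le {s m M : ℝ} {H : ℝ} (ht : rawTail s m u c R₀ ≤ H * M) (hA : 0 < A) :
    2 * remoteLoss s m u c R₀ A ≤
      2 * (2 ^ (m - 1) * 2 ^ ((N : ℝ) + s * m)) * H * M +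
      2 * (2 ^ (m - 1) * 2 ^ ((N : ℝ) + s * m)) * (2 ^ (m - 1) * (sphereConst N / (s * m))) *
        (A ^ (m - 1) * R₀ ^ (-(s * m))) := by
  unfold remoteLoss
  rw [Real.mul_rpow (by norm_num) hA.le]
  have hD : (0 : ℝ) ≤ 2 * (2 ^ (m - 1) * 2 ^ ((N : ℝ) + s * m)) := by positivity
  have := mul_le_mul_of_nonneg_left ht hD
  linarith

/-- Decay of the oscillation for bounded functions that are super- and subsolutions. -/
theorem exists_osc_decay (N : ℕ) [NeZero N] {s p q : ℝ} (hs0 : 0 < s) (hs1 : s < 1) (hp : 2 ≤ p)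
    (hq : 2 ≤ q) :
    ∃ α B : ℝ, 0 < α ∧ α < 1 ∧ 2 ≤ B ∧ ∀ (c : Euc N) (R₀ K A : ℝ) (u : Euc N → ℝ), 0 < R₀ → 0 < A →
      IsSupersol s p q K c R₀ u → IsSupersol s p q K c R₀ (fun x => -u x) →
      (∀ᵐ x, x ∈ ball c R₀ → |u x| ≤ A / B) →
      K ≤ A ^ (p - 1) * R₀ ^ (-(s * p)) →
      rawTail s p u c R₀ ≤ A ^ (p - 1) * R₀ ^ (-(s * p)) →
      rawTail s q u c R₀ ≤ sphereConst N / (s * q) * (A ^ (p - 1) * R₀ ^ (-(s * p))) →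
      ∀ r, 0 < r → r ≤ R₀ → ∃ a : ℝ, ∀ᵐ x, x ∈ ball c r →
        a ≤ u x ∧ u x ≤ a + 8 ^ α * A * (r / R₀) ^ α := by
  set V := (volume : Measure (Euc N)).real (ball 0 1) with hV
  have hVpos : 0 < V := ENNReal.toReal_pos (measure_ball_pos _ _ one_pos).ne' measure_ball_lt_top.ne
  set g := V / 4 with hg
  have hgpos : 0 < g := by positivity
  have hκ := sphereConst_pos (N := N)
  obtain ⟨εp, hεp, hlp⟩ := exists_small_exponent (N := N) hs0 hs1 hp hgpos
  obtain ⟨εq, hεq, hlq⟩ := exists_small_exponent (N := N) hs0 hs1 hq hgpos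
  -- Budget for σ + δ: below it each gain pays for its loss, and 1/4 is the bound on σ in the growth
  -- lemma.
  set ε := min (1 / 4) (min εp εq) with hε
  have hε0 : 0 < ε := by positivity
  have hε4 : ε ≤ 1 / 4 := min_le_left _ _
  have hεεp : ε ≤ εp := (min_le_right _ _).trans (min_le_left _ _)
  have hεεq : ε ≤ εq := (min_le_right _ _).trans (min_le_right _ _)
  -- In order: geometric growth of the gain; 1 - 8^{-α} ≤ 3α ≤ 3σ/4, so that growth achieves the
  -- required decrease; and δ ≤ ε/2.
  set α := min (s / 2) (min (ε / 8) (ε / 2 * s / 8 ^ s)) with hα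
  have hα0 : 0 < α := by positivity
  have hαs : α ≤ s / 2 := min_le_left _ _
  have hαε : α ≤ ε / 8 := (min_le_right _ _).trans (min_le_left _ _)
  have hαδ : α * 8 ^ s / s ≤ ε / 2 := by
    have : α ≤ ε / 2 * s / 8 ^ s := (min_le_right _ _).trans (min_le_right _ _)
    rw [le_div_iff₀ (by positivity)] at this
    rwa [div_le_iff₀ hs0]
  set σ := ε / 2 with hσ
  set δ := α * 8 ^ s / s with hδ
  have hσ0 : 0 ≤ σ := by positivity
  have hδ0 : 0 ≤ δ := by positivity
  have hσδ : σ + δ ≤ ε := by linarith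
  set D : ℝ → ℝ := fun m => 2 * (2 ^ (m - 1) * 2 ^ ((N : ℝ) + s * m)) with hD
  have hD0 : ∀ m, 0 < D m := fun m => by simp only [hD]; positivity
  set F : ℝ → ℝ := fun m => D m * (2 ^ (m - 1) * (sphereConst N / (s * m))) with hF
  have hF0 : ∀ m, 2 ≤ m → 0 < F m := fun m hm => by
    have := hD0 m
    have : 0 < m := by linarith
    simp only [hF]; positivity
  have hFp := hF0 p hp
  have hFq := hF0 q hq
  have hDp := hD0 p
  have hDq := hD0 q
  set L := 1 + D p * 1 + F p + D q * (sphereConst N / (s * q)) + F q with hL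
  have hq0 : 0 < q := by linarith
  have hDκ : 0 < D q * (sphereConst N / (s * q)) := by positivity
  set γ := min (gainConst N s p g) (gainConst N s q g) with hγ
  have hγ0 : 0 < γ := lt_min (gainConst_pos hgpos) (gainConst_pos hgpos)
  -- From scale k₀ on the gain exceeds all fixed losses. The constant B = 2·8^{αk₀} is chosen so
  -- that A/B = ω_{k₀}/2, which makes the earlier scales trivial.
  obtain ⟨k₀, hk₀⟩ := pow_unbounded_of_one_lt (L / γ)
    (Real.one_lt_rpow (by norm_num : (1 : ℝ) < 8) hs0)
  rw [div_lt_iff₀ hγ0] at hk₀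
  have hB1 : (1 : ℝ) ≤ 8 ^ (α * k₀) := Real.one_le_rpow (by norm_num) (by positivity)
  refine ⟨α, 2 * 8 ^ (α * k₀), hα0, by linarith, by linarith, ?_⟩
  intro c R₀ K A u hR hA hS hS' hsup hK hTp hTq
  have hAB : A / (2 * 8 ^ (α * k₀)) = iterOsc A α k₀ / 2 := by
    rw [iterOsc, Real.rpow_neg (by norm_num)]; field_simp
  rw [hAB] at hsup
  set P := A ^ (p - 1) * R₀ ^ (-(s * p)) with hP
  set P' := A ^ (q - 1) * R₀ ^ (-(s * q)) with hP'
  have hP0 : 0 < P := by positivity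
  have hP'0 : 0 < P' := by positivity
  have hsum : K + 2 * remoteLoss s p u c R₀ A + 2 * remoteLoss s q u c R₀ A ≤ L * (P + P') := by
    have h1 := remoteLoss_le (s := s) (m := p) (H := 1) (M := P) (by rwa [one_mul]) hA
    have h2 := remoteLoss_le (s := s) (m := q) hTq hA
    have h1' : 2 * remoteLoss s p u c R₀ A ≤ D p * 1 * P + F p * P := h1
    have h2' : 2 * remoteLoss s q u c R₀ A ≤ D q * (sphereConst N / (s * q)) * P + F q * P' := h2
    have : K + 2 * remoteLoss s p u c R₀ A + 2 * remoteLoss s q u c R₀ A ≤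
        (1 + D p * 1 + F p + D q * (sphereConst N / (s * q))) * P + F q * P' := by linarith
    have e1 : 0 ≤ F q * P := by positivity
    have e2 : 0 ≤ (1 + D p * 1 + F p + D q * (sphereConst N / (s * q))) * P' := by positivity
    rw [hL]
    linarith
  have hbig : ∀ k, k₀ ≤ k →
      K + 2 * remoteLoss s p u c R₀ A + 2 * remoteLoss s q u c R₀ A <
      gainConst N s p g * (iterOsc A α k ^ (p - 1) * iterRadius R₀ k ^ (-(s * p))) +
      gainConst N s q g * (iterOsc A α k ^ (q - 1) * iterRadius R₀ k ^ (-(s * q))) := by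
    intro k hk
    have hpow : (8 ^ s : ℝ) ^ k₀ ≤ (8 ^ s) ^ k :=
      pow_le_pow_right₀ (Real.one_le_rpow (by norm_num) hs0.le) hk
    have gp := iter_gain_ge (s := s) hp hα0 hαs hA hR k
    have gq := iter_gain_ge (s := s) hq hα0 hαs hA hR k
    have hpk : (0 : ℝ) ≤ (8 ^ s) ^ k := by positivity
    calc _ ≤ L * (P + P') := hsum
      _ < ((8 ^ s) ^ k₀ * γ) * (P + P') := mul_lt_mul_of_pos_right hk₀ (by positivity)
      _ ≤ ((8 ^ s) ^ k * γ) * (P + P') := by gcongr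
      _ = γ * ((8 ^ s) ^ k * P) + γ * ((8 ^ s) ^ k * P') := by ring
      _ ≤ _ := by
        refine add_le_add ?_ ?_
        · exact mul_le_mul (min_le_left _ _) gp (by positivity) (gainConst_pos hgpos).le
        · exact mul_le_mul (min_le_right _ _) gq (by positivity) (gainConst_pos hgpos).le
  have hω0 : ∀ k, 0 < iterOsc A α k := fun k => iterOsc_pos hA k
  have hωA : ∀ k, iterOsc A α k ≤ A := fun k => by
    have := iterOsc_anti hα0.le hA.le (Nat.zero_le k)
    simpa [iterOsc] using this
  have hθ : 1 - 8 ^ (-α) ≤ 3 / 4 * σ := by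
    have := one_sub_le_rpow_neg hα0.le
    linarith
  have hneg : ∀ m, remoteLoss s m (fun x => -u x) c R₀ A = remoteLoss s m u c R₀ A := fun m => by
    rw [remoteLoss, remoteLoss, rawTail_neg]
  have hLp := hlp (σ + δ) (by positivity) (by linarith) (by linarith)
  have hLq := hlq (σ + δ) (by positivity) (by linarith) (by linarith)
  have hstep : ∀ v : Euc N → ℝ, IsSupersol s p q K c R₀ v →
      (∀ m, remoteLoss s m v c R₀ A = remoteLoss s m u c R₀ A) → ∀ k b, k₀ ≤ k →
      IterInv c R₀ A α v k b →
      g * iterRadius R₀ k ^ N ≤ volume.real (largeSet c (iterRadius R₀ k) b (iterOsc A α k) v) →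
      ∀ᵐ x, x ∈ ball c (iterRadius R₀ (k + 1)) → b + 3 / 4 * σ * iterOsc A α k ≤ v x := by
    intro v hv hvr k b hk hb hbg
    have hRk : iterRadius R₀ k ≤ R₀ := by
      have := iterRadius_anti hR (Nat.zero_le k)
      rwa [iterRadius_zero] at this
    have hb0 : ∀ᵐ x, x ∈ ball c (iterRadius R₀ k) → b ≤ v x := by
      filter_upwards [hb.2.2 k le_rfl] with x hx hxb
      have := (hx hxb).1
      linarith
    have hres := hv.growth_ae hs0 hs1 hp hq (iterRadius_pos hR k) hRk (hω0 k).le hσ0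
      (by linarith) hδ0 hb0 (hb.ae_lower hα0 (by linarith) hA hR)
      (abs_le.2 ⟨hb.1, by linarith [hb.2.1, hω0 k]⟩) (hωA k) hbg hLp hLq
      (by rw [hvr, hvr]; exact hbig k hk)
    rw [iterRadius_succ]
    filter_upwards [hres] with x hx hxb
    have := hx hxb
    linarith
  have hinv : ∀ k, k₀ ≤ k → ∃ a, IterInv c R₀ A α u k a := by
    intro k hk
    induction k, hk using Nat.le_induction with
    | base =>
      -- The symmetric interval of length ω_{k₀} contains the values of u on all of B_{R₀}, hence
      -- serves every scale up to k₀.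
      refine ⟨-(iterOsc A α k₀ / 2), ?_, ?_, fun j hj => ?_⟩
      · linarith [hωA k₀, hω0 k₀]
      · linarith [hωA k₀, hω0 k₀]
      · have hmono := iterOsc_anti hα0.le hA.le hj
        have hRj : iterRadius R₀ j ≤ R₀ := by
          have := iterRadius_anti hR (Nat.zero_le j)
          rwa [iterRadius_zero] at this
        filter_upwards [hsup] with x hx hxb
        have := abs_le.1 (hx (ball_subset_ball hRj hxb))
        constructor <;> linarith [this.1, this.2]
    | succ k hk ih =>
      obtain ⟨a, ha⟩ := ih
      rcases largeSet_or_largeSet_neg (c := c) u (iterRadius_pos hR k) a (iterOsc A α k)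
        with h | h
      · exact ⟨_, ha.succ_of_lower hα0.le hA hR hθ (hstep u hS (fun _ => rfl) k a hk ha h)⟩
      · exact ⟨_, ha.succ_of_upper hα0.le hA hR hθ (hstep _ hS' hneg k _ hk ha.neg h)⟩
  intro r hr hrR
  obtain ⟨k, hk1, hk2⟩ := exists_iterRadius hR hr hrR
  have hωr := iterOsc_le_rpow (α := α) hα0.le hA.le hR hk1
  rcases le_total k₀ k with hk | hk
  · obtain ⟨a, ha⟩ := hinv k hk
    refine ⟨a, ?_⟩
    filter_upwards [ha.2.2 k le_rfl] with x hx hxb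
    have := hx (ball_subset_ball hk2 hxb)
    constructor <;> linarith [this.1, this.2]
  · refine ⟨-(iterOsc A α k₀ / 2), ?_⟩
    have hmono := iterOsc_anti hα0.le hA.le hk
    filter_upwards [hsup] with x hx hxb
    have := abs_le.1 (hx (ball_subset_ball hrR hxb))
    constructor <;> linarith [this.1, this.2]

end DecayTheorem

/-! ### From the function spaces and weak solutions to the setting of the decay theorem. -/

section Bridge

variable {N : ℕ} {c c' x₀ : Euc N} {r R R₀ ρ K M X : ℝ} {u u' : Euc N → ℝ}

lemma ae_abs_le_supNorm (hu : MemLp u ∞) (A : Set (Euc N)) (hA : MeasurableSet A) :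
    ∀ᵐ x, x ∈ A → |u x| ≤ supNorm A u := by
  have hA' : MemLp u ∞ (volume.restrict A) := hu.restrict A
  have h := ae_le_eLpNormEssSup (f := u) (μ := volume.restrict A)
  rw [ae_restrict_iff' hA] at h
  filter_upwards [h] with x hx hxA
  have h1 := hx hxA
  rw [← eLpNorm_exponent_top] at h1
  have := ENNReal.toReal_mono hA'.2.ne h1
  simpa [supNorm] using this

lemma supNorm_nonneg (A : Set (Euc N)) (u : Euc N → ℝ) : 0 ≤ supNorm A u := ENNReal.toReal_nonneg

lemma supNorm_mono (hu : MemLp u ∞) {A B : Set (Euc N)} (h : A ⊆ B) :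
    supNorm A u ≤ supNorm B u :=
  ENNReal.toReal_mono (hu.restrict B).2.ne (eLpNorm_mono_measure u (Measure.restrict_mono_set _ h))

lemma exists_measurable_bounded_rep (hu : MemLp u ∞) :
    ∃ u' : Euc N → ℝ, u =ᵐ[volume] u' ∧ Measurable u' ∧ ∀ x, |u' x| ≤ supNorm univ u := by
  classical
  set f := hu.1.mk u
  have hf : Measurable f := hu.1.stronglyMeasurable_mk.measurable
  set S := {x | |f x| ≤ supNorm univ u} with hS
  have hSm : MeasurableSet S := measurableSet_le (by fun_prop) measurable_const
  refine ⟨S.piecewise f fun _ => 0, ?_, hf.piecewise hSm measurable_const, fun x => ?_⟩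
  · filter_upwards [hu.1.ae_eq_mk, ae_abs_le_supNorm hu univ MeasurableSet.univ] with x hx hxb
    have hxS : x ∈ S := by
      have := hxb (mem_univ x)
      rwa [hx] at this
    rw [piecewise_eq_of_mem _ _ _ hxS, hx]
  · by_cases hx : x ∈ S
    · rw [piecewise_eq_of_mem _ _ _ hx]; exact hx
    · rw [piecewise_eq_of_notMem _ _ _ hx, abs_zero]; exact supNorm_nonneg _ _

lemma gagliardo_congr_ae (h : u =ᵐ[volume] u') (s m : ℝ) (U : Set (Euc N)) :
    gagliardo s m U u = gagliardo s m U u' := by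
  refine lintegral_congr_ae ?_
  filter_upwards [ae_restrict_of_ae h] with x hx
  refine lintegral_congr_ae ?_
  filter_upwards [ae_restrict_of_ae h] with y hy
  rw [hx, hy]

lemma integrableOn_energyDensity_prod {s m : ℝ} {U : Set (Euc N)} (hu : Measurable u)
    (h : gagliardo s m U u < ∞) : IntegrableOn (energyDensity s m u) (U ×ˢ U) := by
  have hm := measurable_energyDensity s m hu
  refine ⟨hm.aestronglyMeasurable, ?_⟩
  rw [hasFiniteIntegral_iff_ofReal (ae_of_all _ fun z => energyDensity_nonneg _ _ _ _)]
  have e : (volume : Measure (Euc N × Euc N)).restrict (U ×ˢ U) =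
      (volume.restrict U).prod (volume.restrict U) := (Measure.prod_restrict U U).symm
  rw [e, lintegral_prod _ hm.ennreal_ofReal.aemeasurable]
  exact h

/-- Pairs closer than the gap between the ball and the complement of U lie in U × U; for the others
boundedness and integrability of the kernel away from the diagonal suffice. -/
lemma MemWTilde.integrableOn_energyDensity [NeZero N] {s m : ℝ} (hs0 : 0 < s) (hm : 2 ≤ m)
    (hW : MemWTilde s m (ball c ρ) u) (h : u =ᵐ[volume] u') (hu' : Measurable u')
    (hM : ∀ x, |u' x| ≤ M) : IntegrableOn (energyDensity s m u') (cross (ball c ρ)) := by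
  obtain ⟨-, ⟨U, hUo, hcpt, hUsub, -, hgag⟩, -⟩ := hW
  obtain ⟨d, hd, hdU⟩ := hcpt.exists_thickening_subset_open hUo hUsub
  rw [gagliardo_congr_ae h] at hgag
  have h1 := integrableOn_energyDensity_prod hu' hgag
  have hker := (integrable_indicator_iff measurableSet_ball.compl).2
    (integrableOn_norm_rpow_far (N := N) (a := s * m) (by positivity) hd)
  have h2 : IntegrableOn (energyDensity s m u') (cross (ball c ρ) ∩ (nearDiag N d)ᶜ) := by
    refine Integrable.mono' (((integrableOn_cross_of_sub hker c ρ).mono_set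
      inter_subset_left).const_mul ((2 * M) ^ m))
      (measurable_energyDensity s m hu').aestronglyMeasurable
      ((ae_restrict_iff' ((measurableSet_cross measurableSet_ball).inter
        (measurableSet_nearDiag _).compl)).2 (ae_of_all _ fun z hz => ?_))
    have hz2 : z.1 - z.2 ∈ (ball (0 : Euc N) d)ᶜ := by simpa [nearDiag] using hz.2
    rw [indicator_of_mem hz2, Real.norm_of_nonneg (energyDensity_nonneg _ _ _ _),
      ← one_div_rpow_eq (norm_nonneg _), mul_one_div]
    refine div_le_div_of_nonneg_right (Real.rpow_le_rpow (abs_nonneg _) ?_ (by linarith))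
      (by positivity)
    have := abs_sub (u' z.1) (u' z.2)
    have := hM z.1
    have := hM z.2
    linarith
  refine (h1.union h2).mono_set fun z hz => ?_
  by_cases hzd : z ∈ nearDiag N d
  · left
    have hmem : ∀ x y : Euc N, x ∈ ball c ρ → ‖x - y‖ < d → y ∈ U := fun x y hx hxy =>
      hdU (mem_thickening_iff.2 ⟨x, subset_closure hx, by rwa [dist_comm, dist_eq_norm]⟩)
    have hsub : ∀ x ∈ ball c ρ, x ∈ U := fun x hx => hUsub (subset_closure hx)
    simp only [nearDiag, mem_ofPred_eq] at hzd
    rcases hz with hz | hz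
    · exact ⟨hsub _ hz, hmem _ _ hz hzd⟩
    · exact ⟨hmem _ _ hz (by rwa [norm_sub_rev]), hsub _ hz⟩
  · exact Or.inr ⟨hz, hzd⟩

lemma cross_mono {A B : Set (Euc N)} (h : A ⊆ B) : cross A ⊆ cross B :=
  fun _ hz => hz.imp (fun h' => h h') (fun h' => h h')

lemma form_neg (s m : ℝ) (u φ : Euc N → ℝ) : form s m (fun x => -u x) φ = -form s m u φ := by
  unfold form
  rw [← integral_neg]
  congr 1; ext z
  rw [show -u z.1 - -u z.2 = -(u z.1 - u z.2) by ring, J_neg]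
  ring

lemma energyDensity_neg (s m : ℝ) (u : Euc N → ℝ) :
    energyDensity s m (fun x => -u x) = energyDensity s m u := by
  ext z
  unfold energyDensity
  rw [show -u z.1 - -u z.2 = -(u z.1 - u z.2) by ring, abs_neg]

lemma IsTest.mono {A B : Set (Euc N)} {φ : Euc N → ℝ} (hφ : IsTest A φ) (h : A ⊆ B) :
    IsTest B φ := ⟨hφ.1, hφ.2.1, hφ.2.2.trans h⟩

lemma IsTest.setIntegral_const_mul {A : Set (Euc N)} {φ : Euc N → ℝ} (hφ : IsTest A φ) (k : ℝ) :
    ∫ x in A, k * φ x = k * ∫ x, φ x := by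
  rw [integral_const_mul, setIntegral_eq_integral_of_forall_compl_eq_zero]
  intro x hx
  exact image_eq_zero_of_notMem_tsupport fun h => hx (hφ.2.2 h)

/-- A bounded weak solution has a representative to which the supersolution theory applies. -/
lemma exists_supersol_rep [NeZero N] {s p q : ℝ} (hs0 : 0 < s) (hp : 2 ≤ p) (hq : 2 ≤ q)
    (hW : MemWpq s p q (ball c ρ) u) (hu : MemLp u ∞) (hK : WeakAbsLE s p q (ball c ρ) u K) :
    ∃ u' : Euc N → ℝ, u =ᵐ[volume] u' ∧ Measurable u' ∧ (∀ x, |u' x| ≤ supNorm univ u) ∧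
      ∀ c' R, ball c' R ⊆ ball c ρ → IsSupersol s p q K c' R u' ∧
        IsSupersol s p q K c' R (fun x => -u' x) := by
  obtain ⟨u', he, hm, hb⟩ := exists_measurable_bounded_rep hu
  refine ⟨u', he, hm, hb, fun c' R hsub => ?_⟩
  have hep := (hW.1.integrableOn_energyDensity hs0 hp he hm hb).mono_set (cross_mono hsub)
  have heq := (hW.2.integrableOn_energyDensity hs0 hq he hm hb).mono_set (cross_mono hsub)
  refine ⟨⟨hm, ⟨_, hb⟩, hep, heq, fun φ hφ h0 => ?_⟩,
    ⟨hm.neg, ⟨supNorm univ u, fun x => by rw [abs_neg]; exact hb x⟩, ?_, ?_, fun φ hφ h0 => ?_⟩⟩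
  · have := hK.2 φ (hφ.mono hsub) h0
    rwa [(hφ.mono hsub).setIntegral_const_mul, form_congr_ae he, form_congr_ae he] at this
  · rwa [energyDensity_neg]
  · rwa [energyDensity_neg]
  · have := hK.1 φ (hφ.mono hsub) h0
    rw [(hφ.mono hsub).setIntegral_const_mul, form_congr_ae he, form_congr_ae he] at this
    rw [form_neg, form_neg]
    linarith

lemma rawTail_le [NeZero N] {s m : ℝ} (hs0 : 0 < s) (hm : 2 ≤ m) (hR : 0 < R) (hu : Measurable u)
    (hM : ∀ x, |u x| ≤ M) (c : Euc N) :
    rawTail s m u c R ≤ M ^ (m - 1) * (sphereConst N / (s * m) * R ^ (-(s * m))) := by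
  have hsm : 0 < s * m := by positivity
  rw [← integral_norm_sub_rpow_far hsm hR c, ← integral_const_mul]
  refine integral_mono (integrableOn_rawTail hs0 hm hR hu hM c)
    ((integrableOn_norm_sub_rpow_far hsm hR c).const_mul _) fun y => ?_
  simp only
  rw [← one_div_rpow_eq (norm_nonneg _), mul_one_div]
  exact div_le_div_of_nonneg_right (Real.rpow_le_rpow (abs_nonneg _) (hM y) (by linarith))
    (by positivity)

lemma osc_le_of_ae {A : Set (Euc N)} (hA : MeasurableSet A) (hA0 : volume A ≠ 0) {a w : ℝ}
    (h : ∀ᵐ x, x ∈ A → a ≤ u x ∧ u x ≤ a + w) : osc A u ≤ w := by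
  rw [← ae_restrict_iff' hA] at h
  have : (ae (volume.restrict A)).NeBot := by
    rw [ae_neBot]; simpa using hA0
  have h1 : ∀ᵐ x ∂volume.restrict A, u x ≤ a + w := h.mono fun x hx => hx.2
  have h2 : ∀ᵐ x ∂volume.restrict A, a ≤ u x := h.mono fun x hx => hx.1
  have b1 : Filter.IsBoundedUnder (· ≤ ·) (ae (volume.restrict A)) u := ⟨a + w, h1⟩
  have b2 : Filter.IsBoundedUnder (· ≥ ·) (ae (volume.restrict A)) u := ⟨a, h2⟩
  have k1 : essSup u (volume.restrict A) ≤ a + w :=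
    Filter.limsup_le_of_le b2.isCoboundedUnder_le h1
  have k2 : a ≤ essInf u (volume.restrict A) :=
    Filter.le_liminf_of_le b1.isCoboundedUnder_ge h2
  unfold osc
  linarith

lemma ae_mem_essInf_essSup (hu : MemLp u ∞) {A : Set (Euc N)} (hA : MeasurableSet A) :
    ∀ᵐ x, x ∈ A → essInf u (volume.restrict A) ≤ u x ∧ u x ≤ essSup u (volume.restrict A) := by
  have h := ae_abs_le_supNorm hu A hA
  rw [← ae_restrict_iff' hA] at h ⊢
  have b1 : Filter.IsBoundedUnder (· ≤ ·) (ae (volume.restrict A)) u :=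
    ⟨supNorm A u, h.mono fun x hx => (abs_le.1 hx).2⟩
  have b2 : Filter.IsBoundedUnder (· ≥ ·) (ae (volume.restrict A)) u :=
    ⟨-supNorm A u, h.mono fun x hx => (abs_le.1 hx).1⟩
  exact (ae_essInf_le b2).and (ae_le_essSup b1)

/-- The scale-invariant oscillation estimate on balls inside the domain of the equation. -/
theorem exists_osc_le (N : ℕ) [NeZero N] {s p q : ℝ} (hs0 : 0 < s) (hs1 : s < 1) (hp : 2 ≤ p)
    (hq : 2 ≤ q) :
    ∃ α B : ℝ, 0 < α ∧ α < 1 ∧ 2 ≤ B ∧ ∀ (u : Euc N → ℝ) (c c' : Euc N) (ρ R K X : ℝ),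
      0 ≤ K → MemWpq s p q (ball c ρ) u → MemLp u ∞ → WeakAbsLE s p q (ball c ρ) u K →
      ball c' R ⊆ ball c ρ → 0 < R → R ≤ 1 → 0 ≤ X → supNorm (ball c' R) u ≤ X →
      K0 q K u * R ^ (s * (p - q)) ≤ X ^ (p - 1) →
      R ^ (s * p) * rawTail s p u c' R ≤ X ^ (p - 1) →
      ∀ r, 0 < r → r ≤ R → osc (ball c' r) u ≤ 8 ^ α * (B * X) * (r / R) ^ α := by
  obtain ⟨α, B, hα0, hα1, hB, hmain⟩ := exists_osc_decay N hs0 hs1 hp hq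
  refine ⟨α, B, hα0, hα1, hB, ?_⟩
  intro u c c' ρ R K X hK0 hW hu hK hsub hR hR1 hX hsup hKX hTX r hr hrR
  obtain ⟨u', he, hm, hb, hS⟩ := exists_supersol_rep hs0 hp hq hW hu hK
  obtain ⟨hS1, hS2⟩ := hS c' R hsub
  have hκ := sphereConst_pos (N := N)
  have hsp : R ^ (s * p) * R ^ (-(s * p)) = 1 := by
    rw [← Real.rpow_add hR, add_neg_cancel, Real.rpow_zero]
  have hMK : supNorm univ u ^ (q - 1) ≤ K0 q K u := le_add_of_nonneg_left hK0
  have hM0 : 0 ≤ supNorm univ u ^ (q - 1) := Real.rpow_nonneg (supNorm_nonneg _ _) _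
  have hKK : K ≤ K0 q K u := le_add_of_nonneg_right hM0
  have hscale : R ^ (s * (p - q)) * R ^ (-(s * p)) = R ^ (-(s * q)) := by
    rw [← Real.rpow_add hR]; congr 1; ring
  have hone : 1 ≤ R ^ (-(s * q)) :=
    Real.one_le_rpow_of_pos_of_le_one_of_nonpos hR hR1 (by
      have : 0 ≤ s * q := by positivity
      linarith)
  have hRp : 0 ≤ R ^ (-(s * p)) := by positivity
  have hy : 0 < 8 ^ α * (r / R) ^ α := by positivity
  -- The decay theorem needs A > 0, whereas X may vanish; the bound for A = BX is recovered as a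
  -- limit.
  have key : ∀ A, B * X < A → osc (ball c' r) u ≤ 8 ^ α * A * (r / R) ^ α := by
    intro A hA
    have hXA : X ≤ A / B := by rw [le_div_iff₀ (by linarith)]; linarith
    have hBX : 0 ≤ B * X := mul_nonneg (by linarith) hX
    have hA0 : 0 < A := hBX.trans_lt hA
    have hXA' : X ≤ A := by nlinarith
    have hpow : X ^ (p - 1) ≤ A ^ (p - 1) := Real.rpow_le_rpow hX hXA' (by linarith)
    have hKA : K0 q K u * R ^ (-(s * q)) ≤ A ^ (p - 1) * R ^ (-(s * p)) := by
      rw [← hscale, ← mul_assoc]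
      exact mul_le_mul_of_nonneg_right (hKX.trans hpow) hRp
    obtain ⟨a, ha⟩ := hmain c' R K A u' hR hA0 hS1 hS2 (by
        filter_upwards [ae_abs_le_supNorm hu _ measurableSet_ball, he] with x hx hxe hxb
        rw [← hxe]
        exact (hx hxb).trans (hsup.trans hXA))
      (by
        refine le_trans ?_ hKA
        exact hKK.trans (le_mul_of_one_le_right (hK0.trans hKK) hone))
      (by
        rw [← rawTail_congr_ae he]
        have := mul_le_mul_of_nonneg_right (hTX.trans hpow) hRp
        rwa [mul_right_comm, hsp, one_mul] at this)
      (by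
        -- The q-tail is estimated by the global sup norm; R^{s(p-q)} R^{-sp} = R^{-sq} converts
        -- this into the K₀ term.
        refine (rawTail_le hs0 hq hR hm hb c').trans ?_
        have h1 := mul_le_mul_of_nonneg_right hMK (zero_le_one.trans hone)
        calc _ = sphereConst N / (s * q) * (supNorm univ u ^ (q - 1) * R ^ (-(s * q))) := by ring
          _ ≤ _ := mul_le_mul_of_nonneg_left (h1.trans hKA) (by positivity))
      r hr hrR
    refine osc_le_of_ae measurableSet_ball (measure_ball_pos _ _ hr).ne' (a := a) ?_
    filter_upwards [ha, he] with x hx hxe hxb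
    rw [hxe]; exact hx hxb
  have hdiv : osc (ball c' r) u / (8 ^ α * (r / R) ^ α) ≤ B * X := by
    refine le_of_forall_gt_imp_ge_of_dense fun A hA => ?_
    rw [div_le_iff₀ hy]
    have := key A hA
    linarith
  rw [div_le_iff₀ hy] at hdiv
  linarith

end Bridge

/-! ### Hölder representatives and recentring of the tail. -/

section Holder

lemma abs_rpow_add_le {α a b t : ℝ} (hα0 : 0 < α) (hα1 : α ≤ 1) (ha : 0 ≤ a) (hb : 0 ≤ b)
    (ht : t ≤ a + b) (ht0 : 0 ≤ t) : t ^ α ≤ a ^ α + b ^ α :=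
  (Real.rpow_le_rpow ht0 ht hα0.le).trans (Real.rpow_add_le_add_rpow ha hb hα0.le hα1)

/-- McShane extension of a bounded Hölder continuous function. -/
lemma exists_holder_extension {E : Type*} [NormedAddCommGroup E] {T : Set E} {f : E → ℝ}
    {H α X : ℝ} (hα0 : 0 < α) (hα1 : α ≤ 1) (hH : 0 ≤ H) (hX : ∀ y ∈ T, |f y| ≤ X)
    (hf : ∀ x ∈ T, ∀ y ∈ T, |f x - f y| ≤ H * ‖x - y‖ ^ α) :
    ∃ v : E → ℝ, (∀ x ∈ T, v x = f x) ∧ ∀ x y, |v x - v y| ≤ H * ‖x - y‖ ^ α := by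
  rcases T.eq_empty_or_nonempty with rfl | hT
  · exact ⟨0, by simp, fun x y => by simp; positivity⟩
  have : Nonempty T := hT.to_subtype
  have hbdd : ∀ x : E, BddBelow (range fun y : T => f y + H * ‖x - y‖ ^ α) := by
    refine fun x => ⟨-X, ?_⟩
    rintro _ ⟨y, rfl⟩
    have := (abs_le.1 (hX y y.2)).1
    have : 0 ≤ H * ‖x - y‖ ^ α := by positivity
    simp only
    linarith
  have hle : ∀ x x' : E, (⨅ y : T, (f y + H * ‖x - y‖ ^ α)) - H * ‖x - x'‖ ^ α ≤
      ⨅ y : T, (f y + H * ‖x' - y‖ ^ α) := by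
    intro x x'
    refine le_ciInf fun y => ?_
    have h1 := ciInf_le (hbdd x) y
    have h2 : ‖x - y‖ ^ α ≤ ‖x - x'‖ ^ α + ‖x' - y‖ ^ α :=
      abs_rpow_add_le hα0 hα1 (norm_nonneg _) (norm_nonneg _)
        (norm_sub_le_norm_sub_add_norm_sub _ _ _) (norm_nonneg _)
    have := mul_le_mul_of_nonneg_left h2 hH
    linarith
  refine ⟨fun x : E => ⨅ y : T, (f y + H * ‖x - y‖ ^ α), fun x hx => ?_, fun x x' => ?_⟩
  · refine le_antisymm ?_ (le_ciInf fun y => ?_)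
    · refine (ciInf_le (hbdd x) ⟨x, hx⟩).trans (le_of_eq ?_)
      simp [Real.zero_rpow hα0.ne']
    · have := (abs_le.1 (hf x hx y y.2)).2
      linarith
  · rw [abs_le]
    have h1 := hle x x'
    have h2 := hle x' x
    rw [norm_sub_rev x' x] at h2
    constructor <;> linarith

variable {N : ℕ} {x₀ : Euc N} {R X α C : ℝ} {u : Euc N → ℝ}

/-- Uniform power decay of the oscillation on small balls gives a Hölder representative. -/
lemma exists_holder_rep (hu : MemLp u ∞) (hα0 : 0 < α) (hα1 : α ≤ 1) (hR : 0 < R)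
    (hsup : supNorm (ball x₀ R) u ≤ X) (hXC : 2 * X ≤ C)
    (hosc : ∀ c ∈ ball x₀ R, ∀ r, 0 < r → r ≤ R → osc (ball c r) u ≤ C * (r / R) ^ α) :
    ∃ v : Euc N → ℝ, v =ᵐ[volume] u ∧
      holderSeminorm α (ball x₀ R) v ≤ ENNReal.ofReal (C * 3 ^ α * R ^ (-α)) := by
  classical
  have hX0 : 0 ≤ X := (supNorm_nonneg _ _).trans hsup
  have hC0 : 0 ≤ C := by linarith
  set d := TopologicalSpace.denseSeq (Euc N)
  set H := C * 3 ^ α * R ^ (-α) with hH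
  have hH0 : 0 ≤ H := by positivity
  -- Only countably many balls occur, so almost every point of B_R(x₀) obeys all their essential
  -- bounds at once.
  set T : Set (Euc N) := {x | x ∈ ball x₀ R ∧ |u x| ≤ X ∧ ∀ (n : ℕ) (ρ : ℚ), x ∈ ball (d n) ρ →
    essInf u (volume.restrict (ball (d n) (ρ : ℝ))) ≤ u x ∧
      u x ≤ essSup u (volume.restrict (ball (d n) (ρ : ℝ)))} with hT
  have hTae : ∀ᵐ x, x ∈ ball x₀ R → x ∈ T := by
    have h1 : ∀ᵐ x, ∀ (n : ℕ) (ρ : ℚ), x ∈ ball (d n) (ρ : ℝ) →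
        essInf u (volume.restrict (ball (d n) (ρ : ℝ))) ≤ u x ∧
        u x ≤ essSup u (volume.restrict (ball (d n) (ρ : ℝ))) :=
      ae_all_iff.2 fun n => ae_all_iff.2 fun ρ => ae_mem_essInf_essSup hu measurableSet_ball
    filter_upwards [h1, ae_abs_le_supNorm hu _ (measurableSet_ball (x := x₀) (ε := R))]
      with x hx1 hx2 hxb
    exact ⟨hxb, (hx2 hxb).trans hsup, hx1⟩
  have hscale : ∀ t, 0 ≤ t → C * (3 * t / R) ^ α = H * t ^ α := by
    intro t ht
    rw [hH, mul_div_assoc, Real.mul_rpow (by norm_num) (by positivity), Real.div_rpow ht hR.le,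
      Real.rpow_neg hR.le]
    field_simp
  have hTH : ∀ x ∈ T, ∀ y ∈ T, |u x - u y| ≤ H * ‖x - y‖ ^ α := by
    intro x hx y hy
    rcases (norm_nonneg (x - y)).eq_or_lt with h0 | h0
    · have : x = y := by rwa [eq_comm, norm_sub_eq_zero_iff] at h0
      rw [this]; simp; positivity
    rw [← hscale _ h0.le]
    rcases le_or_gt (3 * ‖x - y‖) R with hle | hgt
    · obtain ⟨ρ, hρ1, hρ2⟩ := exists_rat_btwn (show 2 * ‖x - y‖ < 3 * ‖x - y‖ by linarith)
      have hopen : IsOpen (ball x₀ R ∩ ball x ‖x - y‖) := isOpen_ball.inter isOpen_ball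
      obtain ⟨n, hn⟩ := (TopologicalSpace.denseRange_denseSeq (Euc N)).exists_mem_open hopen
        ⟨x, hx.1, mem_ball_self h0⟩
      have hn2 := hn.2
      rw [mem_ball, dist_comm, dist_eq_norm] at hn2
      have hxm : x ∈ ball (d n) (ρ : ℝ) := by
        rw [mem_ball, dist_eq_norm]
        change ‖x - d n‖ < _ at hn2
        linarith
      have hym : y ∈ ball (d n) (ρ : ℝ) := by
        rw [mem_ball, dist_eq_norm]
        change ‖x - d n‖ < _ at hn2
        have := norm_sub_le_norm_sub_add_norm_sub y x (d n)
        rw [norm_sub_rev y x] at this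
        linarith
      have h1 := hx.2.2 n ρ hxm
      have h2 := hy.2.2 n ρ hym
      have h3 := hosc (d n) hn.1 ρ (by linarith) (by linarith)
      have h4 : C * ((ρ : ℝ) / R) ^ α ≤ C * (3 * ‖x - y‖ / R) ^ α := by
        refine mul_le_mul_of_nonneg_left (Real.rpow_le_rpow ?_ ?_ hα0.le) hC0
        · exact div_nonneg (by linarith) hR.le
        · exact div_le_div_of_nonneg_right hρ2.le hR.le
      unfold osc at h3
      rw [abs_le]
      constructor <;> linarith [h1.1, h1.2, h2.1, h2.2]
    -- For points far apart the bound 2X ≤ C on the difference is enough.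
    · have h1 : 1 ≤ (3 * ‖x - y‖ / R) ^ α :=
        Real.one_le_rpow ((one_le_div hR).2 hgt.le) hα0.le
      have h2 := abs_sub (u x) (u y)
      have h3 := hx.2.1
      have h4 := hy.2.1
      have h5 := mul_le_mul_of_nonneg_left h1 hC0
      linarith
  obtain ⟨w, hw1, hw2⟩ := exists_holder_extension hα0 hα1 hH0 (fun y hy => hy.2.1) hTH
  refine ⟨(ball x₀ R).piecewise w u, ?_, ?_⟩
  · filter_upwards [hTae] with x hx
    by_cases hxb : x ∈ ball x₀ R
    · rw [piecewise_eq_of_mem _ _ _ hxb, hw1 x (hx hxb)]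
    · rw [piecewise_eq_of_notMem _ _ _ hxb]
  · refine iSup₂_le fun x hx => iSup₂_le fun y hy => iSup_le fun hxy => ?_
    rw [piecewise_eq_of_mem _ _ _ hx, piecewise_eq_of_mem _ _ _ hy]
    refine ENNReal.ofReal_le_ofReal ?_
    rw [div_le_iff₀ (Real.rpow_pos_of_pos (norm_pos_iff.2 (sub_ne_zero.2 hxy)) _)]
    exact hw2 x y

/-- Change of centre in the tail. -/
lemma rawTail_center_le [NeZero N] {s m : ℝ} (hs0 : 0 < s) (hm : 2 ≤ m) (hu : MemLp u ∞)
    {c : Euc N} (hR : 0 < R) (hc : c ∈ ball x₀ R) :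
    R ^ (s * m) * rawTail s m u c R ≤
      sphereConst N / (s * m) * supNorm (ball x₀ (2 * R)) u ^ (m - 1) +
      2 ^ ((N : ℝ) + s * m) * ((2 * R) ^ (s * m) * rawTail s m u x₀ (2 * R)) := by
  have hsm : 0 < s * m := by positivity
  set ν : ℝ := (N : ℝ) + s * m with hν
  have hν0 : 0 ≤ ν := by positivity
  obtain ⟨u', he, hum, hb⟩ := exists_measurable_bounded_rep hu
  set S := supNorm (ball x₀ (2 * R)) u
  have hS0 : 0 ≤ S := supNorm_nonneg _ _
  have i1 := integrableOn_rawTail hs0 hm hR hum hb c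
  have i2 := (integrable_indicator_iff measurableSet_ball.compl).2
    (integrableOn_rawTail hs0 hm (by positivity : 0 < 2 * R) hum hb x₀)
  have i3 := integrableOn_norm_sub_rpow_far hsm hR c
  have hpt : ∀ᵐ y ∂volume.restrict (ball c R)ᶜ, |u' y| ^ (m - 1) / ‖c - y‖ ^ ν ≤
      S ^ (m - 1) * ‖c - y‖ ^ (-ν) + 2 ^ ν * (ball x₀ (2 * R))ᶜ.indicator
        (fun y => |u' y| ^ (m - 1) / ‖x₀ - y‖ ^ ν) y := by
    refine ae_restrict_of_ae ?_
    filter_upwards [he, ae_abs_le_supNorm hu _ (measurableSet_ball (x := x₀) (ε := 2 * R))]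
      with y hye hyb
    by_cases hy : y ∈ ball x₀ (2 * R)
    · rw [indicator_of_notMem (by simpa using hy), mul_zero, add_zero,
        ← one_div_rpow_eq (norm_nonneg _), mul_one_div, ← hye]
      exact div_le_div_of_nonneg_right (Real.rpow_le_rpow (abs_nonneg _) (hyb hy) (by linarith))
        (by positivity)
    · rw [indicator_of_mem (by simpa using hy)]
      rw [mem_ball, dist_eq_norm, not_lt] at hy
      rw [mem_ball, dist_eq_norm] at hc
      -- The centres differ by less than R, at most half of ‖x₀ - y‖ outside B_{2R}(x₀); inside that
      -- ball the sup norm is used instead.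
      have h1 : ‖x₀ - y‖ / 2 ≤ ‖c - y‖ := by
        have := norm_sub_le_norm_sub_add_norm_sub y c x₀
        rw [norm_sub_rev y c] at this
        rw [norm_sub_rev x₀ y]
        linarith
      have h0 : 0 < ‖x₀ - y‖ := by rw [norm_sub_rev]; linarith
      have h2 : (‖x₀ - y‖ / 2) ^ ν ≤ ‖c - y‖ ^ ν := Real.rpow_le_rpow (by positivity) h1 hν0
      have h3 : |u' y| ^ (m - 1) / ‖c - y‖ ^ ν ≤ |u' y| ^ (m - 1) / (‖x₀ - y‖ / 2) ^ ν :=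
        div_le_div_of_nonneg_left (by positivity) (by positivity) h2
      have h4 : |u' y| ^ (m - 1) / (‖x₀ - y‖ / 2) ^ ν =
          2 ^ ν * (|u' y| ^ (m - 1) / ‖x₀ - y‖ ^ ν) := by
        rw [Real.div_rpow h0.le (by norm_num)]; field_simp
      have : 0 ≤ S ^ (m - 1) * ‖c - y‖ ^ (-ν) := by positivity
      linarith
  have hmain := integral_mono_ae i1 ((i3.const_mul (S ^ (m - 1))).add
    (i2.integrableOn.const_mul (2 ^ ν))) hpt
  have hsplit : ∫ y in (ball c R)ᶜ, (S ^ (m - 1) * ‖c - y‖ ^ (-ν) +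
      2 ^ ν * (ball x₀ (2 * R))ᶜ.indicator (fun y => |u' y| ^ (m - 1) / ‖x₀ - y‖ ^ ν) y) ≤
      S ^ (m - 1) * (sphereConst N / (s * m) * R ^ (-(s * m))) +
        2 ^ ν * rawTail s m u' x₀ (2 * R) := by
    rw [integral_add (i3.const_mul (S ^ (m - 1))) (i2.integrableOn.const_mul (2 ^ ν)),
      integral_const_mul, integral_const_mul, integral_norm_sub_rpow_far hsm hR]
    refine add_le_add le_rfl (mul_le_mul_of_nonneg_left ?_ (by positivity))
    refine (setIntegral_le_integral i2 (ae_of_all _ fun y =>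
      indicator_nonneg (fun y _ => by positivity) y)).trans (le_of_eq ?_)
    rw [integral_indicator measurableSet_ball.compl]
    rfl
  have htot : rawTail s m u c R ≤ S ^ (m - 1) * (sphereConst N / (s * m) * R ^ (-(s * m))) +
        2 ^ ν * rawTail s m u x₀ (2 * R) := by
    rw [rawTail_congr_ae he, rawTail_congr_ae he]
    exact hmain.trans hsplit
  have hRR : R ^ (s * m) * R ^ (-(s * m)) = 1 := by
    rw [← Real.rpow_add hR, add_neg_cancel, Real.rpow_zero]
  have hR2 : R ^ (s * m) ≤ (2 * R) ^ (s * m) :=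
    Real.rpow_le_rpow hR.le (by linarith) hsm.le
  have hT0 := rawTail_nonneg s m u x₀ (2 * R)
  calc R ^ (s * m) * rawTail s m u c R ≤ R ^ (s * m) *
        (S ^ (m - 1) * (sphereConst N / (s * m) * R ^ (-(s * m))) +
        2 ^ ν * rawTail s m u x₀ (2 * R)) := mul_le_mul_of_nonneg_left htot (by positivity)
    _ = sphereConst N / (s * m) * S ^ (m - 1) * (R ^ (s * m) * R ^ (-(s * m))) +
        2 ^ ν * (R ^ (s * m) * rawTail s m u x₀ (2 * R)) := by ring
    _ ≤ _ := by rw [hRR, mul_one]; gcongr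

lemma tail_nonneg {s m : ℝ} (hR : 0 < R) (u : Euc N → ℝ) (c : Euc N) : 0 ≤ tail s m u c R :=
  Real.rpow_nonneg (mul_nonneg (by positivity) (rawTail_nonneg s m u c R)) _

lemma mul_rawTail_eq {s m : ℝ} (hm : 2 ≤ m) (hR : 0 < R) (u : Euc N → ℝ) (c : Euc N) :
    R ^ (s * m) * rawTail s m u c R = tail s m u c R ^ (m - 1) := by
  rw [tail, one_div, Real.rpow_inv_rpow _ (by linarith)]
  · rfl
  · exact mul_nonneg (by positivity) (rawTail_nonneg s m u c R)

end Holder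

end FracPQ

/-! ### The main theorem: assembly of the constants. -/

theorem theorem3p3 (N : ℕ) (hN : 1 ≤ N) (s p q : ℝ) (hs0 : 0 < s) (hs1 : s < 1)
    (hq : 2 ≤ q) (hqp : q ≤ p) :
    ∃ α C : ℝ, 0 < α ∧ α < 1 ∧ 0 < C ∧
      (∀ (u : EuclideanSpace ℝ (Fin N) → ℝ) (K R₀ : ℝ), 0 ≤ K → 0 < R₀ → R₀ ≤ 1 →
        FracPQ.MemWpq s p q (ball 0 R₀) u → MemLp u ∞ volume →
        FracPQ.WeakAbsLE s p q (ball 0 R₀) u K →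
        ∀ r : ℝ, 0 < r → r ≤ R₀ →
          FracPQ.osc (ball 0 r) u ≤
            C * ((FracPQ.K0 q K u * R₀ ^ (s * (p - q))) ^ (1 / (p - 1)) + FracPQ.Q s p u 0 R₀) *
              (r / R₀) ^ α) ∧
      (∀ (u : EuclideanSpace ℝ (Fin N) → ℝ) (x₀ : EuclideanSpace ℝ (Fin N)) (K R₀ : ℝ),
        0 ≤ K → 0 < R₀ → R₀ ≤ 1 →
        FracPQ.MemWpq s p q (ball x₀ (2 * R₀)) u → MemLp u ∞ volume →
        FracPQ.WeakAbsLE s p q (ball x₀ (2 * R₀)) u K →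
        ∃ v : EuclideanSpace ℝ (Fin N) → ℝ, v =ᵐ[volume] u ∧
          FracPQ.holderSeminorm α (ball x₀ R₀) v ≤
            ENNReal.ofReal
              (C * ((FracPQ.K0 q K u * R₀ ^ (s * (p - q))) ^ (1 / (p - 1)) +
                FracPQ.Q s p u x₀ (2 * R₀)) * R₀ ^ (-α))) := by
  have : NeZero N := ⟨by omega⟩
  have hp : 2 ≤ p := hq.trans hqp
  obtain ⟨α, B, hα0, hα1, hB, hosc⟩ := FracPQ.exists_osc_le N hs0 hs1 hp hq
  have hκ := FracPQ.sphereConst_pos (N := N)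
  -- Price of recentring the tail: with X replaced by B₂X the tail hypothesis holds at every centre
  -- in B_{R₀}(x₀), since p - 1 ≥ 1.
  set B₂ : ℝ := max 1 (FracPQ.sphereConst N / (s * p) + 2 ^ ((N : ℝ) + s * p)) with hB₂
  have hB₂1 : 1 ≤ B₂ := le_max_left _ _
  have hB₂pow : FracPQ.sphereConst N / (s * p) + 2 ^ ((N : ℝ) + s * p) ≤ B₂ ^ (p - 1) := by
    refine (le_max_right 1 _).trans ?_
    calc B₂ = B₂ ^ (1 : ℝ) := (Real.rpow_one _).symm
      _ ≤ B₂ ^ (p - 1) := Real.rpow_le_rpow_of_exponent_le hB₂1 (by linarith)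
  have h8 : (1 : ℝ) ≤ 8 ^ α := Real.one_le_rpow (by norm_num) hα0.le
  have h3 : (1 : ℝ) ≤ 3 ^ α := Real.one_le_rpow (by norm_num) hα0.le
  have hK0nn : ∀ (u : EuclideanSpace ℝ (Fin N) → ℝ) (K : ℝ), 0 ≤ K → 0 ≤ FracPQ.K0 q K u :=
    fun u K hK => add_nonneg hK (Real.rpow_nonneg (FracPQ.supNorm_nonneg _ _) _)
  have hroot : ∀ Y : ℝ, 0 ≤ Y → ∀ Z : ℝ, Y ^ (1 / (p - 1)) ≤ Z → Y ≤ Z ^ (p - 1) := by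
    intro Y hY Z hYZ
    have := Real.rpow_le_rpow (Real.rpow_nonneg hY _) hYZ (by linarith : 0 ≤ p - 1)
    rwa [one_div, Real.rpow_inv_rpow hY (by linarith)] at this
  -- 8^α B comes from the decay, B₂ from recentring and 3^α from the passage to Hölder continuity;
  -- the first estimate needs only 8^α B.
  refine ⟨α, 8 ^ α * B * B₂ * 3 ^ α, hα0, hα1, by positivity, ?_, ?_⟩
  · intro u K R₀ hK hR hR1 hW hu hweak r hr hrR
    set Y := FracPQ.K0 q K u * R₀ ^ (s * (p - q)) with hY
    have hY0 : 0 ≤ Y := mul_nonneg (hK0nn u K hK) (by positivity)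
    have hYr : 0 ≤ Y ^ (1 / (p - 1)) := Real.rpow_nonneg hY0 _
    have ht := FracPQ.tail_nonneg (s := s) (m := p) hR u 0
    have hsn := FracPQ.supNorm_nonneg (ball 0 R₀) u
    set X := Y ^ (1 / (p - 1)) + FracPQ.Q s p u 0 R₀ with hX
    have hXe : X = Y ^ (1 / (p - 1)) +
      (FracPQ.supNorm (ball 0 R₀) u + FracPQ.tail s p u 0 R₀) := rfl
    have hX0 : 0 ≤ X := by linarith
    have := hosc u 0 0 R₀ R₀ K X hK hW hu hweak subset_rfl hR hR1 hX0 (by linarith)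
      (hroot Y hY0 X (by linarith))
      (by
        rw [FracPQ.mul_rawTail_eq hp hR]
        exact Real.rpow_le_rpow ht (by linarith) (by linarith)) r hr hrR
    refine this.trans ?_
    have hfac : 8 ^ α * (B * X) ≤ 8 ^ α * B * B₂ * 3 ^ α * X := by
      have h1 : 1 ≤ B₂ * 3 ^ α := one_le_mul_of_one_le_of_one_le hB₂1 h3
      have h2 : 0 ≤ 8 ^ α * (B * X) := by positivity
      calc 8 ^ α * (B * X) ≤ 8 ^ α * (B * X) * (B₂ * 3 ^ α) := le_mul_of_one_le_right h2 h1
        _ = _ := by ring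
    exact mul_le_mul_of_nonneg_right hfac (by positivity)
  · intro u x₀ K R₀ hK hR hR1 hW hu hweak
    set Y := FracPQ.K0 q K u * R₀ ^ (s * (p - q)) with hY
    have hY0 : 0 ≤ Y := mul_nonneg (hK0nn u K hK) (by positivity)
    have hYr : 0 ≤ Y ^ (1 / (p - 1)) := Real.rpow_nonneg hY0 _
    have hR2 : 0 < 2 * R₀ := by positivity
    have ht := FracPQ.tail_nonneg (s := s) (m := p) hR2 u x₀
    have hsn := FracPQ.supNorm_nonneg (ball x₀ (2 * R₀)) u
    set X := Y ^ (1 / (p - 1)) + FracPQ.Q s p u x₀ (2 * R₀) with hX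
    have hXe : X = Y ^ (1 / (p - 1)) +
      (FracPQ.supNorm (ball x₀ (2 * R₀)) u + FracPQ.tail s p u x₀ (2 * R₀)) := rfl
    have hX0 : 0 ≤ X := by linarith
    have hXB : X ≤ B₂ * X := le_mul_of_one_le_left hX0 hB₂1
    have hBX0 : 0 ≤ B₂ * X := hX0.trans hXB
    have hdecay : ∀ c ∈ ball x₀ R₀, ∀ r, 0 < r → r ≤ R₀ →
        FracPQ.osc (ball c r) u ≤ 8 ^ α * (B * (B₂ * X)) * (r / R₀) ^ α := by
      intro c hc r hr hrR
      have hsub : ball c R₀ ⊆ ball x₀ (2 * R₀) := by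
        refine ball_subset_ball' ?_
        have := mem_ball.1 hc
        linarith
      refine hosc u x₀ c (2 * R₀) R₀ K (B₂ * X) hK hW hu hweak hsub hR hR1 hBX0 ?_ ?_ ?_ r hr hrR
      · have := FracPQ.supNorm_mono hu hsub
        linarith
      · exact hroot Y hY0 _ (by linarith)
      · refine (FracPQ.rawTail_center_le hs0 hp hu hR hc).trans ?_
        rw [FracPQ.mul_rawTail_eq hp hR2, Real.mul_rpow (by linarith) hX0]
        have e1 : FracPQ.supNorm (ball x₀ (2 * R₀)) u ^ (p - 1) ≤ X ^ (p - 1) :=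
          Real.rpow_le_rpow hsn (by linarith) (by linarith)
        have e2 : FracPQ.tail s p u x₀ (2 * R₀) ^ (p - 1) ≤ X ^ (p - 1) :=
          Real.rpow_le_rpow ht (by linarith) (by linarith)
        calc _ ≤ FracPQ.sphereConst N / (s * p) * X ^ (p - 1) +
              2 ^ ((N : ℝ) + s * p) * X ^ (p - 1) := by gcongr
          _ = (FracPQ.sphereConst N / (s * p) + 2 ^ ((N : ℝ) + s * p)) * X ^ (p - 1) := by ring
          _ ≤ _ := mul_le_mul_of_nonneg_right hB₂pow (by positivity)
    have hsup : FracPQ.supNorm (ball x₀ R₀) u ≤ B₂ * X := by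
      have := FracPQ.supNorm_mono hu (ball_subset_ball (x := x₀) (by linarith : R₀ ≤ 2 * R₀))
      linarith
    have hC : 2 * (B₂ * X) ≤ 8 ^ α * (B * (B₂ * X)) := by
      have h1 : 2 * (B₂ * X) ≤ B * (B₂ * X) := mul_le_mul_of_nonneg_right hB hBX0
      exact h1.trans (le_mul_of_one_le_left (by positivity) h8)
    obtain ⟨v, hv1, hv2⟩ := FracPQ.exists_holder_rep hu hα0 hα1.le hR hsup hC hdecay
    refine ⟨v, hv1, hv2.trans (le_of_eq ?_)⟩
    congr 1
    ring
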